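/- **Setting.** Let $n \in \mathbb{N}$, $\hbar > 0$ and $p \in \mathbb{C}^n$. For multi-indices $N, I \in \mathbb{N}^n$ write $|N| = \sum_k N_k$, $N! = \prod_k N_k!$, $\binom{N}{I} = \prod_k \binom{N_k}{I_k}$, and let $I \le N$ be understood componentwise; $\partial_z^R$, $\partial_{\bar z}^S$ denote iterated Wirtinger derivatives on $\mathbb{C}^n$. For $f \in C^\infty(\mathbb{C}^n, \mathbb{C})$, $m \in \mathbb{N}$, $0 \le \ell \le 2^m - 1$ and $R, S \in \mathbb{N}^n$ define $h_{m,\ell,R,S}(f) \in [0,\infty]$ recursively by $$h_{0,0,R,S}(f) = \sum_{N \in \mathbb{N}^n} \frac{(2\hbar)^{|R|+|S|+|N|}}{N!} \left| \partial_z^R \partial_{\bar z}^{N+S} f(p) \right|^2,$$ $$h_{m,\ell,R,S}(f) = \sum_{N \in \mathbb{N}^n} \frac{1}{N!} \Big( \sum_{I \le R} \sum_{J \le N+S} \binom{R}{I} \binom{N+S}{J}\, h^{*}_{I,J}(f) \Big)^2 \qquad (m \ge 1),$$ where $h^{*}_{I,J} = h_{m-1,\ell/2,I,J}$ if $\ell$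 is even and $h^{*}_{I,J} = h_{m-1,(\ell-1)/2,J,I}$ if $\ell$ is odd. Put $\|f\|_{m,\ell,R,S} = h_{m,\ell,R,S}(f)^{1/2^{m+1}}$. Let $\tilde{\mathcal{A}}_{p,\hbar}$ be the vector space of all $f \in C^\infty(\mathbb{C}^n)$ with $\|f\|_{m,\ell,R,S} < \infty$ for all $m, \ell, R, S$, and let $\mathcal{A}_{p,\hbar}$ be its quotient by the functions whose Taylor expansion at $p$ vanishes, with the locally convex topology defined by the induced seminorms $\|\cdot\|_{m,\ell,R,S}$. **Theorem.** $\mathcal{A}_{p,\hbar}$ is a Fréchet space, and the following hold. 1. For all $\alpha \in \mathbb{C}$ and all $f, g \in \tilde{\mathcal{A}}_{p,\hbar}$, all terms of the series $$f \star_\alpha g = \sum_{N \in \mathbb{N}^n} \frac{(2\alpha)^{|N|}}{N!}\, \partial_z^N f\; \partial_{\bar z}^N g$$ lie in $\tilde{\mathcal{A}}_{p,\hbar}$, and the series of their classes converges absolutely in $\mathcal{A}_{p,\hbar}$ (that is, it converges, and for every continuous seminorm $q$ the values of $q$ on the terms are summable). Its sum depends only on the classes of $f$ and $g$, and $\star_\alpha$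 is a bilinear, associative and jointly continuous product on $\mathcal{A}_{p,\hbar}$. 2. For $\alpha = \hbar$, the product $\star_\hbar$ together with the complex conjugation $[f] \mapsto [\bar f]$ makes $\mathcal{A}_{p,\hbar}$ a Fréchet $^*$-algebra: the conjugation is a well-defined continuous antilinear involution of $\mathcal{A}_{p,\hbar}$ with $\overline{F \star_\hbar G} = \bar G \star_\hbar \bar F$ for all $F, G \in \mathcal{A}_{p,\hbar}$. 3. The products $(\star_\alpha)_{\alpha \in \mathbb{C}}$ are a holomorphic deformation of the pointwise product $[f][g] = [fg]$, which is well defined on $\mathcal{A}_{p,\hbar}$: $\star_0$ is the pointwise product; for all $F, G \in \mathcal{A}_{p,\hbar}$ the map $\alpha \mapsto F \star_\alpha G$ is an entire $\mathcal{A}_{p,\hbar}$-valued function; and $(F, G) \mapsto (\alpha \mapsto F \star_\alpha G)$ is continuous for the topology of locally uniform convergence, that is, for every compact $K \subset \mathbb{C}$ and every continuous seminorm $q$ there is a continuous seminorm $r$ with $q(F \star_\alpha G) \le r(F)\, r(G)$ for all $\alpha \in K$ and all $F, G \in \mathcal{A}_{p,\hbar}$. -/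

import Mathlib

open scoped ContDiff ENNReal Topology

noncomputable section

namespace WickStar

/-- Multi-indices `N ∈ ℕⁿ`. -/
abbrev MultiIndex (n : ℕ) : Type := Fin n → ℕ

/-- `|N| = N₁ + ⋯ + Nₙ`. -/
def MultiIndex.deg {n : ℕ} (N : MultiIndex n) : ℕ := ∑ k, N k

/-- `N! = N₁! ⋯ Nₙ!`. -/
def MultiIndex.fact {n : ℕ} (N : MultiIndex n) : ℕ := ∏ k, (N k).factorial

/-- The multi-index binomial coefficient `∏ₖ (Nₖ choose Iₖ)`. -/
def MultiIndex.binom {n : ℕ} (N I : MultiIndex n) : ℕ := ∏ k, (N k).choose (I k)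

/-- Complex valued functions on `ℂⁿ`. -/
abbrev Fn (n : ℕ) : Type := (Fin n → ℂ) → ℂ

/-- The Wirtinger derivative `∂/∂zₖ = (∂/∂xₖ - i ∂/∂yₖ) / 2`. -/
def dz {n : ℕ} (k : Fin n) (f : Fn n) : Fn n := fun x =>
  (1 / 2 : ℂ) * (fderiv ℝ f x (Pi.single k 1) - Complex.I * fderiv ℝ f x (Pi.single k Complex.I))

/-- The Wirtinger derivative `∂/∂z̄ₖ = (∂/∂xₖ + i ∂/∂yₖ) / 2`. -/
def dzbar {n : ℕ} (k : Fin n) (f : Fn n) : Fn n := fun x =>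
  (1 / 2 : ℂ) * (fderiv ℝ f x (Pi.single k 1) + Complex.I * fderiv ℝ f x (Pi.single k Complex.I))

/-- `D₁^{N₁} ⋯ Dₙ^{Nₙ} f` for a family of operators `D₁, …, Dₙ`. -/
def iterOp {n : ℕ} (D : Fin n → Fn n → Fn n) (N : MultiIndex n) (f : Fn n) : Fn n :=
  (List.finRange n).foldr (fun k g => (D k)^[N k] g) f

/-- `∂^{|R|} f / ∂z^R`. -/
def dzM {n : ℕ} (R : MultiIndex n) (f : Fn n) : Fn n := iterOp dz R f

/-- `∂^{|S|} f / ∂z̄^S`. -/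
def dzbarM {n : ℕ} (S : MultiIndex n) (f : Fn n) : Fn n := iterOp dzbar S f

/-- `∂^{|R|+|S|} f / ∂z^R ∂z̄^S`. -/
def wirt {n : ℕ} (R S : MultiIndex n) (f : Fn n) : Fn n := dzM R (dzbarM S f)

/-- The quantities `h_{m,ℓ,R,S}(f) ∈ [0,∞]` at the point `p` with parameter `ħ`, defined recursively
in `m`; they are used for `0 ≤ ℓ < 2^m` only. -/
def hSum {n : ℕ} (ħ : ℝ) (p : Fin n → ℂ) :
    ℕ → ℕ → MultiIndex n → MultiIndex n → Fn n → ℝ≥0∞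
  | 0, _, R, S, f =>
      ∑' N : MultiIndex n,
        ENNReal.ofReal ((2 * ħ) ^ (R.deg + S.deg + N.deg) / N.fact) * ‖wirt R (N + S) f p‖ₑ ^ 2
  | m + 1, ℓ, R, S, f =>
      if Even ℓ then
        ∑' N : MultiIndex n, (N.fact : ℝ≥0∞)⁻¹ *
          (∑ I ∈ Finset.Iic R, ∑ J ∈ Finset.Iic (N + S),
            ((R.binom I : ℝ≥0∞) * ((N + S).binom J : ℝ≥0∞)) * hSum ħ p m (ℓ / 2) I J f) ^ 2
      else
        ∑' N : MultiIndex n, (N.fact : ℝ≥0∞)⁻¹ *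
          (∑ I ∈ Finset.Iic R, ∑ J ∈ Finset.Iic (N + S),
            ((R.binom I : ℝ≥0∞) * ((N + S).binom J : ℝ≥0∞)) * hSum ħ p m ((ℓ - 1) / 2) J I f) ^ 2

/-- The labels `(m, ℓ, R, S)` with `0 ≤ ℓ ≤ 2^m - 1`. -/
abbrev Label (n : ℕ) : Type := (Σ m : ℕ, Fin (2 ^ m)) × MultiIndex n × MultiIndex n

/-- `‖f‖_{m,ℓ,R,S} = h_{m,ℓ,R,S}(f) ^ (1 / 2^(m+1)) ∈ [0,∞]`. -/
def eNorm {n : ℕ} (ħ : ℝ) (p : Fin n → ℂ) (i : Label n) (f : Fn n) : ℝ≥0∞ :=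
  hSum ħ p i.1.1 i.1.2 i.2.1 i.2.2 f ^ (1 / 2 ^ (i.1.1 + 1) : ℝ)

section Linearity

variable {n : ℕ}

/-- An operator which preserves smoothness and is linear on smooth functions. -/
structure SmoothLinear (T : Fn n → Fn n) : Prop where
  smooth : ∀ f, ContDiff ℝ ∞ f → ContDiff ℝ ∞ (T f)
  add : ∀ f g, ContDiff ℝ ∞ f → ContDiff ℝ ∞ g → T (f + g) = T f + T g
  smul : ∀ (c : ℂ) f, ContDiff ℝ ∞ f → T (c • f) = c • T f

lemma smoothLinear_id : SmoothLinear (fun f : Fn n => f) :=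
  ⟨fun _ h => h, fun _ _ _ _ => rfl, fun _ _ _ => rfl⟩

lemma SmoothLinear.comp {T U : Fn n → Fn n} (hT : SmoothLinear T) (hU : SmoothLinear U) :
    SmoothLinear (fun f => T (U f)) where
  smooth f hf := hT.smooth _ (hU.smooth f hf)
  add f g hf hg := by
    simp only [hU.add f g hf hg, hT.add _ _ (hU.smooth f hf) (hU.smooth g hg)]
  smul c f hf := by
    simp only [hU.smul c f hf, hT.smul c _ (hU.smooth f hf)]

lemma SmoothLinear.iterate {T : Fn n → Fn n} (hT : SmoothLinear T) (k : ℕ) :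
    SmoothLinear (fun f => T^[k] f) := by
  induction k with
  | zero => exact smoothLinear_id
  | succ k ih =>
    simp only [Function.iterate_succ_apply']
    exact hT.comp ih

lemma smoothLinear_iterOp {D : Fin n → Fn n → Fn n} (hD : ∀ k, SmoothLinear (D k))
    (N : MultiIndex n) : SmoothLinear (iterOp D N) := by
  have key : ∀ l : List (Fin n),
      SmoothLinear (fun f => l.foldr (fun k g => (D k)^[N k] g) f) := by
    intro l
    induction l with
    | nil => exact smoothLinear_id
    | cons k l ih =>
      simp only [List.foldr_cons]
      exact ((hD k).iterate (N k)).comp ih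
  exact key _

lemma smooth_dir (v : Fin n → ℂ) (f : Fn n) (hf : ContDiff ℝ ∞ f) :
    ContDiff ℝ ∞ (fun x => fderiv ℝ f x v) :=
  (hf.fderiv_right (m := ∞) (by simp)).clm_apply contDiff_const

lemma fderiv_add_dir (v x : Fin n → ℂ) (f g : Fn n) (hf : ContDiff ℝ ∞ f) (hg : ContDiff ℝ ∞ g) :
    fderiv ℝ (f + g) x v = fderiv ℝ f x v + fderiv ℝ g x v := by
  rw [fderiv_add (hf.differentiable (by simp) x) (hg.differentiable (by simp) x)]
  rfl

lemma fderiv_smul_dir (v x : Fin n → ℂ) (c : ℂ) (f : Fn n) (hf : ContDiff ℝ ∞ f) :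
    fderiv ℝ (c • f) x v = c * fderiv ℝ f x v := by
  rw [fderiv_const_smul (hf.differentiable (by simp) x)]
  rfl

lemma smoothLinear_dz (k : Fin n) : SmoothLinear (dz k) where
  smooth f hf := by
    unfold dz
    exact contDiff_const.mul ((smooth_dir _ f hf).sub (contDiff_const.mul (smooth_dir _ f hf)))
  add f g hf hg := by
    funext x
    simp only [dz, fderiv_add_dir _ _ f g hf hg, Pi.add_apply]
    ring
  smul c f hf := by
    funext x
    simp only [dz, fderiv_smul_dir _ _ c f hf, Pi.smul_apply, smul_eq_mul]
    ring

lemma smoothLinear_dzbar (k : Fin n) : SmoothLinear (dzbar k) where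
  smooth f hf := by
    unfold dzbar
    exact contDiff_const.mul ((smooth_dir _ f hf).add (contDiff_const.mul (smooth_dir _ f hf)))
  add f g hf hg := by
    funext x
    simp only [dzbar, fderiv_add_dir _ _ f g hf hg, Pi.add_apply]
    ring
  smul c f hf := by
    funext x
    simp only [dzbar, fderiv_smul_dir _ _ c f hf, Pi.smul_apply, smul_eq_mul]
    ring

lemma smoothLinear_wirt (R S : MultiIndex n) : SmoothLinear (wirt R S) :=
  (smoothLinear_iterOp smoothLinear_dz R).comp (smoothLinear_iterOp smoothLinear_dzbar S)

end Linearity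

section Minkowski

lemma minkowski_tsum {ι : Type*} {r : ℝ} (hr : 1 ≤ r) (w a b c : ι → ℝ≥0∞)
    (h : ∀ i, c i ≤ a i + b i) :
    (∑' i, w i * c i ^ r) ^ (1 / r) ≤
      (∑' i, w i * a i ^ r) ^ (1 / r) + (∑' i, w i * b i ^ r) ^ (1 / r) := by
  have hr0 : 0 < r := by linarith
  let _ : MeasurableSpace ι := ⊤
  have key := ENNReal.lintegral_Lp_add_le (μ := MeasureTheory.Measure.count)
    (f := fun i => w i ^ (1 / r) * a i) (g := fun i => w i ^ (1 / r) * b i)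
    (measurable_from_top.aemeasurable) (measurable_from_top.aemeasurable) hr
  have e : ∀ u v : ℝ≥0∞, (u ^ (1 / r) * v) ^ r = u * v ^ r := by
    intro u v
    rw [ENNReal.mul_rpow_of_nonneg _ _ hr0.le, ← ENNReal.rpow_mul, one_div,
      inv_mul_cancel₀ hr0.ne', ENNReal.rpow_one]
  simp only [MeasureTheory.lintegral_count, Pi.add_apply, ← mul_add, e] at key
  refine le_trans ?_ key
  gcongr with i
  exact h i

lemma minkowski_sum {ι : Type*} (s : Finset ι) {r : ℝ} (hr : 1 ≤ r) (w a b c : ι → ℝ≥0∞)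
    (h : ∀ i, c i ≤ a i + b i) :
    (∑ i ∈ s, w i * c i ^ r) ^ (1 / r) ≤
      (∑ i ∈ s, w i * a i ^ r) ^ (1 / r) + (∑ i ∈ s, w i * b i ^ r) ^ (1 / r) := by
  have key := minkowski_tsum hr (fun i : s => w i) (fun i => a i) (fun i => b i) (fun i => c i)
    (fun i => h i)
  simpa only [tsum_fintype, Finset.univ_eq_attach, Finset.sum_attach s (fun i => w i * c i ^ r),
    Finset.sum_attach s (fun i => w i * a i ^ r),
    Finset.sum_attach s (fun i => w i * b i ^ r)] using key

/-- Minkowski's inequality for the mixed sums in the recursion step. -/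
lemma minkowski_step {ι κ : Type*} (s : ι → Finset κ) (m : ℕ) (v : ι → ℝ≥0∞) (w : ι → κ → ℝ≥0∞)
    (a b c : κ → ℝ≥0∞)
    (h : ∀ j, c j ^ (1 / 2 ^ (m + 1) : ℝ) ≤
      a j ^ (1 / 2 ^ (m + 1) : ℝ) + b j ^ (1 / 2 ^ (m + 1) : ℝ)) :
    (∑' i, v i * (∑ j ∈ s i, w i j * c j) ^ 2) ^ (1 / 2 ^ (m + 1 + 1) : ℝ) ≤
      (∑' i, v i * (∑ j ∈ s i, w i j * a j) ^ 2) ^ (1 / 2 ^ (m + 1 + 1) : ℝ) +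
      (∑' i, v i * (∑ j ∈ s i, w i j * b j) ^ 2) ^ (1 / 2 ^ (m + 1 + 1) : ℝ) := by
  set r : ℝ := 2 ^ (m + 1) with hr
  have hr1 : 1 ≤ r := one_le_pow₀ (by norm_num)
  have hr0 : r ≠ 0 := by linarith
  have hrr : (2 ^ (m + 1 + 1) : ℝ) = r * 2 := pow_succ _ _
  have e1 : ∀ u : ℝ≥0∞, (u ^ (1 / r)) ^ r = u := fun u => by
    rw [← ENNReal.rpow_mul, one_div, inv_mul_cancel₀ hr0, ENNReal.rpow_one]
  have e2 : ∀ u : ℝ≥0∞, (u ^ (1 / r)) ^ (r * 2) = u ^ 2 := fun u => by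
    rw [ENNReal.rpow_mul, e1, ENNReal.rpow_two]
  have inner : ∀ i, (∑ j ∈ s i, w i j * c j) ^ (1 / r) ≤
      (∑ j ∈ s i, w i j * a j) ^ (1 / r) + (∑ j ∈ s i, w i j * b j) ^ (1 / r) := fun i => by
    simpa only [e1] using minkowski_sum (s i) hr1 (w i) (fun j => a j ^ (1 / r))
      (fun j => b j ^ (1 / r)) (fun j => c j ^ (1 / r)) h
  rw [hrr]
  simpa only [e2] using minkowski_tsum (r := r * 2) (by linarith) v
    (fun i => (∑ j ∈ s i, w i j * a j) ^ (1 / r)) (fun i => (∑ j ∈ s i, w i j * b j) ^ (1 / r))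
    (fun i => (∑ j ∈ s i, w i j * c j) ^ (1 / r)) inner

end Minkowski

section SeminormFacts

variable {n : ℕ} (ħ : ℝ) (p : Fin n → ℂ)

lemma hSum_add_le (m : ℕ) : ∀ (ℓ : ℕ) (R S : MultiIndex n) (f g : Fn n),
    ContDiff ℝ ∞ f → ContDiff ℝ ∞ g →
    hSum ħ p m ℓ R S (f + g) ^ (1 / 2 ^ (m + 1) : ℝ) ≤
      hSum ħ p m ℓ R S f ^ (1 / 2 ^ (m + 1) : ℝ) + hSum ħ p m ℓ R S g ^ (1 / 2 ^ (m + 1) : ℝ) := by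
  induction m with
  | zero =>
    intro ℓ R S f g hf hg
    have key := minkowski_tsum (r := 2) (by norm_num)
      (fun N : MultiIndex n => ENNReal.ofReal ((2 * ħ) ^ (R.deg + S.deg + N.deg) / N.fact))
      (fun N => ‖wirt R (N + S) f p‖ₑ) (fun N => ‖wirt R (N + S) g p‖ₑ)
      (fun N => ‖wirt R (N + S) (f + g) p‖ₑ)
      (fun N => by
        rw [(smoothLinear_wirt R (N + S)).add f g hf hg]
        exact enorm_add_le _ _)
    simpa only [hSum, zero_add, pow_one, ENNReal.rpow_two] using key
  | succ m ih =>
    intro ℓ R S f g hf hg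
    simp only [hSum, ← Finset.sum_product']
    split_ifs
    · exact minkowski_step (fun N : MultiIndex n => Finset.Iic R ×ˢ Finset.Iic (N + S)) m
        (fun N => (N.fact : ℝ≥0∞)⁻¹)
        (fun N x => (R.binom x.1 : ℝ≥0∞) * ((N + S).binom x.2 : ℝ≥0∞))
        (fun x => hSum ħ p m (ℓ / 2) x.1 x.2 f) (fun x => hSum ħ p m (ℓ / 2) x.1 x.2 g)
        (fun x => hSum ħ p m (ℓ / 2) x.1 x.2 (f + g)) (fun x => ih _ _ _ f g hf hg)
    · exact minkowski_step (fun N : MultiIndex n => Finset.Iic R ×ˢ Finset.Iic (N + S)) m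
        (fun N => (N.fact : ℝ≥0∞)⁻¹)
        (fun N x => (R.binom x.1 : ℝ≥0∞) * ((N + S).binom x.2 : ℝ≥0∞))
        (fun x => hSum ħ p m ((ℓ - 1) / 2) x.2 x.1 f)
        (fun x => hSum ħ p m ((ℓ - 1) / 2) x.2 x.1 g)
        (fun x => hSum ħ p m ((ℓ - 1) / 2) x.2 x.1 (f + g)) (fun x => ih _ _ _ f g hf hg)

lemma hSum_smul (m : ℕ) : ∀ (ℓ : ℕ) (R S : MultiIndex n) (c : ℂ) (f : Fn n),
    ContDiff ℝ ∞ f →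
    hSum ħ p m ℓ R S (c • f) = ‖c‖ₑ ^ (2 ^ (m + 1)) * hSum ħ p m ℓ R S f := by
  induction m with
  | zero =>
    intro ℓ R S c f hf
    simp only [hSum, zero_add, pow_one, ← ENNReal.tsum_mul_left]
    refine tsum_congr fun N => ?_
    rw [(smoothLinear_wirt R (N + S)).smul c f hf, Pi.smul_apply, smul_eq_mul, enorm_mul]
    ring
  | succ m ih =>
    intro ℓ R S c f hf
    simp only [hSum, ih _ _ _ c f hf, mul_left_comm _ (‖c‖ₑ ^ 2 ^ (m + 1)), ← Finset.mul_sum]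
    split_ifs <;>
    · rw [← ENNReal.tsum_mul_left]
      refine tsum_congr fun N => ?_
      rw [mul_pow, ← pow_mul, ← pow_succ]
      ring

lemma hSum_eq_zero (f : Fn n) (h : ∀ R S, wirt R S f p = 0) (m : ℕ) :
    ∀ (ℓ : ℕ) (R S : MultiIndex n), hSum ħ p m ℓ R S f = 0 := by
  induction m with
  | zero => intro ℓ R S; simp [hSum, h]
  | succ m ih => intro ℓ R S; simp [hSum, ih]

variable (i : Label n)

lemma eNorm_add_le {f g : Fn n} (hf : ContDiff ℝ ∞ f) (hg : ContDiff ℝ ∞ g) :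
    eNorm ħ p i (f + g) ≤ eNorm ħ p i f + eNorm ħ p i g :=
  hSum_add_le ħ p _ _ _ _ f g hf hg

lemma eNorm_smul (c : ℂ) {f : Fn n} (hf : ContDiff ℝ ∞ f) :
    eNorm ħ p i (c • f) = ‖c‖ₑ * eNorm ħ p i f := by
  unfold eNorm
  rw [hSum_smul ħ p _ _ _ _ c f hf, ENNReal.mul_rpow_of_nonneg _ _ (by positivity),
    ← ENNReal.rpow_natCast, ← ENNReal.rpow_mul]
  simp

lemma eNorm_eq_zero {f : Fn n} (h : ∀ R S, wirt R S f p = 0) : eNorm ħ p i f = 0 := by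
  unfold eNorm
  rw [hSum_eq_zero ħ p f h, ENNReal.zero_rpow_of_pos (by positivity)]

end SeminormFacts

section Spaces

variable {n : ℕ} (ħ : ℝ) (p : Fin n → ℂ)

/-- The space `Ã_{p,ħ}` of all smooth `f : ℂⁿ → ℂ` for which all `‖f‖_{m,ℓ,R,S}` are finite. -/
def tildeA : Submodule ℂ (Fn n) where
  carrier := {f | ContDiff ℝ ∞ f ∧ ∀ i, eNorm ħ p i f < ⊤}
  zero_mem' := by
    refine ⟨contDiff_const, fun i => ?_⟩
    have := eNorm_smul ħ p i 0 (f := 0) contDiff_const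
    rw [smul_zero, enorm_zero, zero_mul] at this
    rw [this]
    exact ENNReal.zero_lt_top
  add_mem' := fun hf hg => ⟨hf.1.add hg.1, fun i =>
    (eNorm_add_le ħ p i hf.1 hg.1).trans_lt (ENNReal.add_lt_top.2 ⟨hf.2 i, hg.2 i⟩)⟩
  smul_mem' := fun c f hf => ⟨contDiff_const.smul hf.1, fun i => by
    rw [eNorm_smul ħ p i c hf.1]
    exact ENNReal.mul_lt_top enorm_lt_top (hf.2 i)⟩

/-- The functions whose Taylor expansion (infinite jet) at `p` vanishes: all partial derivatives
with respect to `z` and `z̄`, of all orders, are zero at `p`. -/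
def flat : Submodule ℂ (tildeA ħ p) where
  carrier := {f | ∀ R S, wirt R S (f : Fn n) p = 0}
  zero_mem' := fun R S => by
    have := (smoothLinear_wirt R S).smul 0 (0 : Fn n) contDiff_const
    rw [smul_zero, zero_smul] at this
    exact congrFun this p
  add_mem' := fun {f g} hf hg R S => by
    rw [Submodule.coe_add, (smoothLinear_wirt R S).add _ _ f.2.1 g.2.1, Pi.add_apply, hf R S,
      hg R S, add_zero]
  smul_mem' := fun c f hf R S => by
    rw [Submodule.coe_smul, (smoothLinear_wirt R S).smul c _ f.2.1, Pi.smul_apply, hf R S,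
      smul_zero]

/-- `‖·‖_{m,ℓ,R,S}` as a seminorm on `Ã_{p,ħ}`. -/
def tildeSeminorm (i : Label n) : Seminorm ℂ (tildeA ħ p) :=
  Seminorm.of (fun f => (eNorm ħ p i (f : Fn n)).toReal)
    (fun f g => by
      rw [← ENNReal.toReal_add (f.2.2 i).ne (g.2.2 i).ne]
      exact ENNReal.toReal_mono (ENNReal.add_lt_top.2 ⟨f.2.2 i, g.2.2 i⟩).ne
        (eNorm_add_le ħ p i f.2.1 g.2.1))
    (fun c f => by
      rw [Submodule.coe_smul, eNorm_smul ħ p i c f.2.1, ENNReal.toReal_mul, toReal_enorm])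

lemma tildeSeminorm_congr (i : Label n) (f g : tildeA ħ p) (h : f - g ∈ flat ħ p) :
    tildeSeminorm ħ p i f = tildeSeminorm ħ p i g := by
  have h0 : tildeSeminorm ħ p i (f - g) = 0 := by
    change (eNorm ħ p i ((f - g : tildeA ħ p) : Fn n)).toReal = 0
    rw [eNorm_eq_zero ħ p i h, ENNReal.toReal_zero]
  have := abs_sub_map_le_sub (tildeSeminorm ħ p i) f g
  rw [h0] at this
  exact sub_eq_zero.1 (abs_nonpos_iff.1 this)

/-- The space `A_{p,ħ}`: the quotient of `Ã_{p,ħ}` by the functions that are flat at `p`. -/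
def Alg : Type := tildeA ħ p ⧸ flat ħ p

instance : AddCommGroup (Alg ħ p) := inferInstanceAs (AddCommGroup (tildeA ħ p ⧸ flat ħ p))

instance : Module ℂ (Alg ħ p) := inferInstanceAs (Module ℂ (tildeA ħ p ⧸ flat ħ p))

/-- The class `[f] ∈ A_{p,ħ}` of a function `f ∈ Ã_{p,ħ}`. -/
def cls : tildeA ħ p →ₗ[ℂ] Alg ħ p := (flat ħ p).mkQ

lemma cls_surjective : Function.Surjective (cls ħ p) := (flat ħ p).mkQ_surjective

/-- The seminorm on `A_{p,ħ}` induced by `‖·‖_{m,ℓ,R,S}`. -/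
def algSeminorm (i : Label n) : Seminorm ℂ (Alg ħ p) :=
  Seminorm.of
    (fun F => Quotient.liftOn' F (tildeSeminorm ħ p i) fun f g h =>
      tildeSeminorm_congr ħ p i f g ((Submodule.quotientRel_def _).1 h))
    (fun F G => by
      obtain ⟨f, rfl⟩ := cls_surjective ħ p F
      obtain ⟨g, rfl⟩ := cls_surjective ħ p G
      rw [← map_add]
      exact map_add_le_add (tildeSeminorm ħ p i) f g)
    (fun c F => by
      obtain ⟨f, rfl⟩ := cls_surjective ħ p F
      rw [← map_smul]
      exact map_smul_eq_mul (tildeSeminorm ħ p i) c f)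

lemma algSeminorm_cls (i : Label n) (f : tildeA ħ p) :
    algSeminorm ħ p i (cls ħ p f) = (eNorm ħ p i (f : Fn n)).toReal := rfl

/-- The family of all the seminorms `‖·‖_{m,ℓ,R,S}` on `A_{p,ħ}`. -/
def algFamily : SeminormFamily ℂ (Alg ħ p) (Label n) := algSeminorm ħ p

/-- The locally convex topology of `A_{p,ħ}`, defined by the seminorms `‖·‖_{m,ℓ,R,S}`. -/
instance : TopologicalSpace (Alg ħ p) := (algFamily ħ p).moduleFilterBasis.topology

lemma alg_withSeminorms : WithSeminorms (algFamily ħ p) := ⟨rfl⟩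

instance : IsTopologicalAddGroup (Alg ħ p) := (alg_withSeminorms ħ p).topologicalAddGroup

end Spaces

/-- Fréchet spaces over `ℂ`: Hausdorff, metrizable, complete, locally convex topological vector
spaces. -/
structure IsFrechetSpace (E : Type*) [AddCommGroup E] [Module ℂ E] [TopologicalSpace E]
    [IsTopologicalAddGroup E] : Prop where
  continuousSMul : ContinuousSMul ℂ E
  locallyConvex : LocallyConvexSpace ℝ E
  metrizable : TopologicalSpace.MetrizableSpace E
  complete : @CompleteSpace E (IsTopologicalAddGroup.rightUniformSpace E)

/-- The bilinear product `μ` and the conjugate linear map `inv` turn `E` into a Fréchet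
`*`-algebra: `E` is a Fréchet space, `μ` is associative and continuous on `E × E`, and `inv` is a
continuous antilinear involution that reverses products. -/
structure IsFrechetStarAlgebra {E : Type*} [AddCommGroup E] [Module ℂ E] [TopologicalSpace E]
    [IsTopologicalAddGroup E] (μ : E →ₗ[ℂ] E →ₗ[ℂ] E) (inv : E →ₗ⋆[ℂ] E) : Prop where
  frechet : IsFrechetSpace E
  assoc : ∀ F G H : E, μ (μ F G) H = μ F (μ G H)
  continuous_mul : Continuous fun x : E × E => μ x.1 x.2
  continuous_inv : Continuous inv
  inv_inv : ∀ F : E, inv (inv F) = F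
  inv_mul : ∀ F G : E, inv (μ F G) = μ (inv G) (inv F)

/-- The associative products `μ_α`, `α ∈ ℂ`, are a holomorphic deformation of the product `μ₀`:
all products `α ↦ μ_α(F, G)` are entire `E`-valued functions, and
`(F, G) ↦ (α ↦ μ_α(F, G))` is continuous for the topology of locally uniform convergence. -/
structure IsHolomorphicDeformation {E : Type*} [AddCommGroup E] [Module ℂ E] [TopologicalSpace E]
    (μ₀ : E →ₗ[ℂ] E →ₗ[ℂ] E) (μ : ℂ → E →ₗ[ℂ] E →ₗ[ℂ] E) : Prop where
  at_zero : μ 0 = μ₀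
  assoc : ∀ (α : ℂ) (F G H : E), μ α (μ α F G) H = μ α F (μ α G H)
  entire : ∀ F G : E, Differentiable ℂ fun α => μ α F G
  bound : ∀ K : Set ℂ, IsCompact K → ∀ q : Seminorm ℂ E, Continuous q →
    ∃ r : Seminorm ℂ E, Continuous r ∧ ∀ α ∈ K, ∀ F G : E, q (μ α F G) ≤ r F * r G

/-- The `N`-th term `(2α)^{|N|} / N! · ∂^{|N|}f/∂z^N · ∂^{|N|}g/∂z̄^N` of the Wick star product. -/
def wickTerm {n : ℕ} (α : ℂ) (f g : Fn n) (N : MultiIndex n) : Fn n := fun x =>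
  (2 * α) ^ N.deg / (N.fact : ℂ) * (dzM N f x * dzbarM N g x)

/-- The Wick star product series of all `f, g ∈ Ã_{p,ħ}` converges absolutely in `A_{p,ħ}` with sum
`μ [f] [g]`: all terms lie in `Ã_{p,ħ}`, for every continuous seminorm the values on the terms are
summable, and the sum of the classes of the terms is `μ [f] [g]`. -/
def IsWickProduct {n : ℕ} (ħ : ℝ) (p : Fin n → ℂ) (α : ℂ)
    (μ : Alg ħ p →ₗ[ℂ] Alg ħ p →ₗ[ℂ] Alg ħ p) : Prop :=
  ∀ f g : tildeA ħ p, ∃ hmem : ∀ N, wickTerm α (f : Fn n) (g : Fn n) N ∈ tildeA ħ p,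
    (∀ q : Seminorm ℂ (Alg ħ p), Continuous q →
      Summable fun N => q (cls ħ p ⟨wickTerm α (f : Fn n) (g : Fn n) N, hmem N⟩)) ∧
    HasSum (fun N => cls ħ p ⟨wickTerm α (f : Fn n) (g : Fn n) N, hmem N⟩)
      (μ (cls ħ p f) (cls ħ p g))

/-- `μ` is the pointwise product: `μ [f] [g] = [fg]`. -/
def IsPointwiseProduct {n : ℕ} (ħ : ℝ) (p : Fin n → ℂ)
    (μ : Alg ħ p →ₗ[ℂ] Alg ħ p →ₗ[ℂ] Alg ħ p) : Prop :=
  ∀ f g : tildeA ħ p, ∃ hmem : (f : Fn n) * (g : Fn n) ∈ tildeA ħ p,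
    μ (cls ħ p f) (cls ħ p g) = cls ħ p ⟨(f : Fn n) * (g : Fn n), hmem⟩

/-- `inv` is the complex conjugation: `inv [f] = [f̄]`. -/
def IsConjugation {n : ℕ} (ħ : ℝ) (p : Fin n → ℂ) (inv : Alg ħ p →ₗ⋆[ℂ] Alg ħ p) : Prop :=
  ∀ f : tildeA ħ p, ∃ hmem : star (f : Fn n) ∈ tildeA ħ p,
    inv (cls ħ p f) = cls ħ p ⟨star (f : Fn n), hmem⟩

end WickStar

end

/-! The recursive seminorms hide a simple growth condition on Taylor coefficients. Write `a R S` for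
the coefficient `∂_z^R ∂_z̄^S f(p)`. All `‖f‖_{m,ℓ,R,S}` are finite exactly when, for every `δ > 0`,
there is `A` with `|a R S| ≤ A (R! S!)^δ`, and the topology is the one given by these bounds
(`JetBound`, `SlowGrowth`, `mem_tildeA_iff`).

Upper estimate (`hSum_le`): each recursion step only squares, inserts binomial sums of exponential
size and divides by `N!`. Exponentials are absorbed by arbitrarily small powers of factorials
(`pow_mdeg_le`), and `1/N!` makes the series converge geometrically. Lower estimate
(`enorm_jet_pow_le`): a single coefficient can be followed through the recursion up to the label
`(m+2, 1, 0, 0)`. This costs only `(R! S!)^2` against the power `2^(m+3)` of the coefficient, so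
after taking roots the exponent of the factorials is as small as desired.

Taking jets is injective on `A_{p,ħ}`, because flat functions are divided out. Every slowly growing
jet is realised by a convergent power series in `z - p` and its conjugate (`jet_synth`). Hence
`A_{p,ħ}` is identified with the space of slowly growing jets, where completeness is a
coefficientwise limit argument.

On jets the `N`-th Wick term is `(2α)^|N| / N!` times a Leibniz convolution of shifted jets. Again
`1/N!` beats every loss, with geometric decay and locally uniformly in `α` (`exists_wickJet_bound`).
This yields absolute convergence, joint continuity and the locally uniform bound. The product is a
power series in `α`, and a quadratic Taylor remainder gives holomorphy. For associativity, both
bracketings obey the Leibniz rule for the index shifts, so it suffices to compare constant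
coefficients; there both equal one absolutely convergent triple sum. Conjugation interchanges the
two kinds of Wirtinger derivatives, hence the factors of each term, and conjugates `α`; it is an
anti-automorphism at the real value `ħ`. -/

noncomputable section

namespace WickStar


/-! ### Factorial weights and the exponentials they absorb. -/

section Weights

variable {κ : Type*} [Fintype κ]

/-- The degree `∑ₖ Tₖ` of a multi-index over an arbitrary finite index type. -/
def mdeg (T : κ → ℕ) : ℕ := ∑ k, T k

/-- The factorial `∏ₖ Tₖ!` of a multi-index over an arbitrary finite index type. -/
def mfact (T : κ → ℕ) : ℕ := ∏ k, (T k).factorial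

lemma mdeg_add (T S : κ → ℕ) : mdeg (T + S) = mdeg T + mdeg S := by
  simp [mdeg, Finset.sum_add_distrib]

lemma mfact_pos (T : κ → ℕ) : 0 < mfact T :=
  Finset.prod_pos fun _ _ => Nat.factorial_pos _

lemma one_le_mfact (T : κ → ℕ) : (1 : ℝ) ≤ mfact T := by
  exact_mod_cast mfact_pos T

lemma mfact_mono {T S : κ → ℕ} (h : T ≤ S) : mfact T ≤ mfact S :=
  Finset.prod_le_prod' fun k _ => Nat.factorial_le (h k)

/-- In each coordinate the quotient is a binomial coefficient, at most `2 ^ (T k + S k)`. -/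
lemma mfact_add_le (T S : κ → ℕ) :
    mfact (T + S) ≤ 2 ^ (mdeg T + mdeg S) * (mfact T * mfact S) := by
  unfold mfact mdeg
  rw [← Finset.sum_add_distrib, ← Finset.prod_pow_eq_pow_sum, ← Finset.prod_mul_distrib,
    ← Finset.prod_mul_distrib]
  refine Finset.prod_le_prod' fun k _ => ?_
  rw [Pi.add_apply, ← Nat.add_choose_mul_factorial_mul_factorial, mul_assoc]
  gcongr
  exact Nat.choose_le_two_pow _ _

/-- The main absorption device. With `x = c^(1/ε)`, the inequality `x^k ≤ e^x k!` raised to the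
power `ε` is the one-variable case; the rest is a product over coordinates. -/
lemma pow_mdeg_le (c : ℝ) (hc : 0 ≤ c) {ε : ℝ} (hε : 0 < ε) :
    ∃ C : ℝ, 0 < C ∧ ∀ T : κ → ℕ, c ^ mdeg T ≤ C * (mfact T : ℝ) ^ ε := by
  set x := c ^ (1 / ε) with hx
  have hx0 : 0 ≤ x := Real.rpow_nonneg hc _
  refine ⟨(Real.exp x ^ ε) ^ Fintype.card κ, by positivity, fun T => ?_⟩
  have h1 : ∀ k : ℕ, c ^ k ≤ Real.exp x ^ ε * (k.factorial : ℝ) ^ ε := fun k => by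
    have h := Real.pow_div_factorial_le_exp x hx0 k
    rw [div_le_iff₀ (by positivity)] at h
    have h' := Real.rpow_le_rpow (by positivity) h hε.le
    rw [Real.mul_rpow (by positivity) (by positivity)] at h'
    refine le_of_eq_of_le ?_ h'
    rw [← Real.rpow_natCast x, hx, ← Real.rpow_mul hc, ← Real.rpow_mul hc,
      ← Real.rpow_natCast c]
    congr 1
    field_simp
  unfold mdeg mfact
  rw [← Finset.prod_pow_eq_pow_sum, Nat.cast_prod,
    ← Real.finsetProd_rpow _ _ (fun _ _ => by positivity), Fintype.card, ← Finset.prod_const,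
    ← Finset.prod_mul_distrib]
  exact Finset.prod_le_prod (fun _ _ => by positivity) fun k _ => h1 _

/-- Geometric decay of exponentials relative to powers of factorials. -/
lemma pow_mdeg_le_half (c : ℝ) (hc : 0 ≤ c) {ε : ℝ} (hε : 0 < ε) :
    ∃ C : ℝ, 0 < C ∧ ∀ T : κ → ℕ, c ^ mdeg T ≤ C * (1 / 2) ^ mdeg T * (mfact T : ℝ) ^ ε := by
  obtain ⟨C, hC, h⟩ := pow_mdeg_le (κ := κ) (2 * c) (by positivity) hε
  refine ⟨C, hC, fun T => ?_⟩
  have := mul_le_mul_of_nonneg_left (h T) (show (0 : ℝ) ≤ (1 / 2) ^ mdeg T by positivity)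
  rw [← mul_pow] at this
  calc c ^ mdeg T = (1 / 2 * (2 * c)) ^ mdeg T := by ring
    _ ≤ _ := this
    _ = _ := by ring

lemma summable_half_pow_mdeg [DecidableEq κ] :
    Summable fun T : κ → ℕ => (1 / 2 : ℝ) ^ mdeg T := by
  refine summable_of_sum_le (c := ∏ _k : κ, (2 : ℝ)) (fun _ => by positivity) fun s => ?_
  -- A finite set of multi-indices lies in a cube of side `M`, over which the sum factors into
  -- partial geometric series.
  set M : ℕ := s.sup mdeg + 1
  have hs : s ⊆ Fintype.piFinset fun _ : κ => Finset.range M := fun T hT => by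
    simp only [Fintype.mem_piFinset, Finset.mem_range]
    intro k
    have h1 : T k ≤ mdeg T := Finset.single_le_sum (f := T) (fun _ _ => Nat.zero_le _)
      (Finset.mem_univ k)
    have h2 : mdeg T ≤ s.sup mdeg := Finset.le_sup hT
    omega
  calc ∑ T ∈ s, (1 / 2 : ℝ) ^ mdeg T
      ≤ ∑ T ∈ Fintype.piFinset fun _ : κ => Finset.range M, (1 / 2 : ℝ) ^ mdeg T :=
        Finset.sum_le_sum_of_subset_of_nonneg hs fun _ _ _ => by positivity
    _ = ∏ _k : κ, ∑ j ∈ Finset.range M, (1 / 2 : ℝ) ^ j := by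
        rw [Finset.prod_univ_sum]
        refine Finset.sum_congr rfl fun T _ => ?_
        rw [mdeg, Finset.prod_pow_eq_pow_sum]
    _ ≤ ∏ _k : κ, (2 : ℝ) := by
        refine Finset.prod_le_prod (fun _ _ => Finset.sum_nonneg fun _ _ => by positivity)
          fun _ _ => ?_
        exact (summable_geometric_two.sum_le_tsum _ fun _ _ => by positivity).trans_eq
          tsum_geometric_two

lemma rpow_mfact_mono {T S : κ → ℕ} (h : T ≤ S) {ε : ℝ} (hε : 0 ≤ ε) :
    (mfact T : ℝ) ^ ε ≤ (mfact S : ℝ) ^ ε :=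
  Real.rpow_le_rpow (by positivity) (by exact_mod_cast mfact_mono h) hε

lemma rpow_mfact_add_le (T S : κ → ℕ) {ε : ℝ} (hε : 0 ≤ ε) (hε1 : ε ≤ 1) :
    (mfact (T + S) : ℝ) ^ ε ≤
      2 ^ mdeg T * 2 ^ mdeg S * ((mfact T : ℝ) ^ ε * (mfact S : ℝ) ^ ε) := by
  have h : (mfact (T + S) : ℝ) ≤ 2 ^ (mdeg T + mdeg S) * (mfact T * mfact S) := by
    exact_mod_cast mfact_add_le T S
  refine (Real.rpow_le_rpow (by positivity) h hε).trans ?_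
  rw [Real.mul_rpow (by positivity) (by positivity), Real.mul_rpow (by positivity) (by positivity),
    ← pow_add]
  gcongr
  calc ((2 : ℝ) ^ (mdeg T + mdeg S)) ^ ε ≤ ((2 : ℝ) ^ (mdeg T + mdeg S)) ^ (1 : ℝ) :=
        Real.rpow_le_rpow_of_exponent_le (one_le_pow₀ (by norm_num)) hε1
    _ = _ := Real.rpow_one _

lemma rpow_mfact_le_exponent (T : κ → ℕ) {δ ε : ℝ} (h : δ ≤ ε) :
    (mfact T : ℝ) ^ δ ≤ (mfact T : ℝ) ^ ε :=
  Real.rpow_le_rpow_of_exponent_le (one_le_mfact T) h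

end Weights

/-! ### Total mass of the multi-index binomials. -/

section Binomial

variable {n : ℕ}

lemma sum_binom (R : MultiIndex n) : ∑ I ∈ Finset.Iic R, R.binom I = 2 ^ R.deg := by
  have h : (Finset.Iic R : Finset (Fin n → ℕ)) =
      Fintype.piFinset fun k => Finset.range (R k + 1) := by
    ext I
    simp [Pi.le_def]
  rw [h]
  unfold MultiIndex.binom MultiIndex.deg
  rw [← Finset.prod_univ_sum (fun k => Finset.range (R k + 1)) fun k j => (R k).choose j,
    ← Finset.prod_pow_eq_pow_sum]
  exact Finset.prod_congr rfl fun k _ => Nat.sum_range_choose _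

end Binomial


/-! ### Jets and their growth bounds. -/

section Jets

variable {n : ℕ}

/-- Jets: families of complex numbers indexed by pairs of multi-indices. -/
abbrev Jet (n : ℕ) : Type := MultiIndex n → MultiIndex n → ℂ

/-- The Taylor coefficients `∂_z^R ∂_z̄^S f (p)` of a function `f` at `p`. -/
def jet (p : Fin n → ℂ) (f : Fn n) : Jet n := fun R S => wirt R S f p

/-- The coefficients of `a` are bounded by `A (R! S!)^δ`. -/
def JetBound (δ A : ℝ) (a : Jet n) : Prop :=
  ∀ R S, ‖a R S‖ ≤ A * ((mfact R : ℝ) ^ δ * (mfact S : ℝ) ^ δ)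

lemma JetBound.nonneg {δ A : ℝ} {a : Jet n} (h : JetBound δ A a) : 0 ≤ A := by
  have := (norm_nonneg _).trans (h 0 0)
  simpa [mfact] using this

lemma JetBound.mono {δ ε A B : ℝ} {a : Jet n} (h : JetBound δ A a) (hδ : δ ≤ ε) (hA : A ≤ B) :
    JetBound ε B a := fun R S => (h R S).trans <| by
  have := h.nonneg
  have := this.trans hA
  gcongr
  · exact one_le_mfact _
  · exact one_le_mfact _

end Jets

/-! ### Growth bounds on jets control the seminorms. -/

section SeminormUpper

variable {n : ℕ}

/-- The single estimate behind both the base case and the recursion step of `hSum_le`: the weights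
are squared, the index `S` is enlarged to `N + S`, and `1/N!` pays for the dependence on `N`. -/
lemma step_weight_bound (K : ℝ) (hK : 0 ≤ K) {ε : ℝ} (hε : 0 < ε) :
    ∃ δ : ℝ, 0 < δ ∧ ∃ C : ℝ, 0 < C ∧ ∀ R S N : MultiIndex n,
      K ^ (mdeg R + mdeg S + mdeg N) / mfact N *
        ((mfact R : ℝ) ^ δ * (mfact (N + S) : ℝ) ^ δ) ^ 2 ≤
      C * ((mfact R : ℝ) ^ ε * (mfact S : ℝ) ^ ε) * (1 / 2) ^ mdeg N := by
  -- Squaring doubles the exponent and absorbing exponentials costs one further `δ`. So `3δ ≤ ε` is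
  -- needed for `R` and `S`, and `3δ ≤ 1` for cancellation against `N!`.
  set δ := min ε 1 / 8 with hδ
  have hδ0 : 0 < δ := by positivity
  have hδε : δ + δ + δ ≤ ε := by have := min_le_left ε 1; linarith
  have hδ1 : δ + δ + δ ≤ 1 := by have := min_le_right ε 1; linarith
  obtain ⟨C, hC, h⟩ := pow_mdeg_le (κ := Fin n) (4 * K) (by positivity) hδ0
  obtain ⟨D, hD, h'⟩ := pow_mdeg_le_half (κ := Fin n) (4 * K) (by positivity) hδ0
  refine ⟨δ, hδ0, C * C * D, by positivity, fun R S N => ?_⟩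
  have key : ((mfact R : ℝ) ^ δ * (mfact (N + S) : ℝ) ^ δ) ^ 2 ≤
      4 ^ mdeg N * 4 ^ mdeg S * ((mfact R : ℝ) ^ (δ + δ) * (mfact S : ℝ) ^ (δ + δ) *
        (mfact N : ℝ) ^ (δ + δ)) := by
    calc ((mfact R : ℝ) ^ δ * (mfact (N + S) : ℝ) ^ δ) ^ 2
        ≤ ((mfact R : ℝ) ^ δ *
          (2 ^ mdeg N * 2 ^ mdeg S * ((mfact N : ℝ) ^ δ * (mfact S : ℝ) ^ δ))) ^ 2 := by
          gcongr
          exact rpow_mfact_add_le N S hδ0.le (by linarith)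
      _ = _ := by
          have e : ∀ T : MultiIndex n, (mfact T : ℝ) ^ (δ + δ) = ((mfact T : ℝ) ^ δ) ^ 2 :=
            fun T => by rw [Real.rpow_add (by have := one_le_mfact T; linarith), sq]
          have e4 : ∀ k : ℕ, (4 : ℝ) ^ k = (2 ^ k) ^ 2 := fun k => by
            rw [← pow_mul, mul_comm, pow_mul]; norm_num
          rw [e, e, e, e4, e4]
          ring
  have e3 : ∀ T : MultiIndex n, (mfact T : ℝ) ^ δ * (mfact T : ℝ) ^ (δ + δ) =
      (mfact T : ℝ) ^ (δ + δ + δ) := fun T => by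
    rw [← Real.rpow_add (by have := one_le_mfact T; linarith), add_assoc]
  have hN0 : (0 : ℝ) < mfact N := by have := one_le_mfact N; linarith
  calc K ^ (mdeg R + mdeg S + mdeg N) / mfact N *
        ((mfact R : ℝ) ^ δ * (mfact (N + S) : ℝ) ^ δ) ^ 2
      ≤ K ^ (mdeg R + mdeg S + mdeg N) / mfact N *
        (4 ^ mdeg N * 4 ^ mdeg S * ((mfact R : ℝ) ^ (δ + δ) * (mfact S : ℝ) ^ (δ + δ) *
        (mfact N : ℝ) ^ (δ + δ))) := by gcongr
    _ = (K ^ mdeg R * (mfact R : ℝ) ^ (δ + δ)) * ((4 * K) ^ mdeg S * (mfact S : ℝ) ^ (δ + δ)) *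
        ((4 * K) ^ mdeg N * (mfact N : ℝ) ^ (δ + δ) / mfact N) := by
        rw [mul_pow, mul_pow, pow_add, pow_add]; ring
    _ ≤ ((C * (mfact R : ℝ) ^ δ) * (mfact R : ℝ) ^ (δ + δ)) *
        ((C * (mfact S : ℝ) ^ δ) * (mfact S : ℝ) ^ (δ + δ)) *
        ((D * (1 / 2) ^ mdeg N * (mfact N : ℝ) ^ δ) * (mfact N : ℝ) ^ (δ + δ) / mfact N) := by
        gcongr
        · refine le_trans ?_ (h R)
          gcongr
          linarith
        · exact h S
        · exact h' N
    _ = C * C * D * ((mfact R : ℝ) ^ (δ + δ + δ) * (mfact S : ℝ) ^ (δ + δ + δ)) *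
        (1 / 2) ^ mdeg N * ((mfact N : ℝ) ^ (δ + δ + δ) / mfact N) := by
        rw [← e3, ← e3, ← e3]; ring
    _ ≤ C * C * D * ((mfact R : ℝ) ^ ε * (mfact S : ℝ) ^ ε) * (1 / 2) ^ mdeg N * 1 := by
        gcongr
        · exact one_le_mfact R
        · exact one_le_mfact S
        · rw [div_le_one hN0]
          refine (rpow_mfact_le_exponent N hδ1).trans_eq (Real.rpow_one _)
    _ = _ := mul_one _

/-- The sum `∑_N 2^{-|N|}` over all multi-indices. -/
def geomConst (n : ℕ) : ℝ := ∑' N : MultiIndex n, (1 / 2 : ℝ) ^ mdeg N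

lemma tsum_ofReal_le {u : MultiIndex n → ℝ≥0∞} {c : ℝ} (hc : 0 ≤ c)
    (h : ∀ N, u N ≤ ENNReal.ofReal (c * (1 / 2) ^ mdeg N)) :
    ∑' N, u N ≤ ENNReal.ofReal (c * geomConst n) := by
  refine (ENNReal.tsum_le_tsum h).trans_eq ?_
  rw [← ENNReal.ofReal_tsum_of_nonneg (fun _ => by positivity)
    (summable_half_pow_mdeg.mul_left c), tsum_mul_left, geomConst]

lemma geomConst_nonneg (n : ℕ) : 0 ≤ geomConst n := tsum_nonneg fun _ => by positivity

lemma binom_sum_le {H : MultiIndex n → MultiIndex n → ℝ≥0∞} {R T : MultiIndex n} {B : ℝ}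
    (h : ∀ I ≤ R, ∀ J ≤ T, H I J ≤ ENNReal.ofReal B) :
    ∑ I ∈ Finset.Iic R, ∑ J ∈ Finset.Iic T,
      ((R.binom I : ℝ≥0∞) * (T.binom J : ℝ≥0∞)) * H I J ≤
    ENNReal.ofReal (2 ^ mdeg R * 2 ^ mdeg T * B) := by
  calc _ ≤ ∑ I ∈ Finset.Iic R, ∑ J ∈ Finset.Iic T,
      ((R.binom I : ℝ≥0∞) * (T.binom J : ℝ≥0∞)) * ENNReal.ofReal B := by
        gcongr with I hI J hJ
        exact h I (Finset.mem_Iic.1 hI) J (Finset.mem_Iic.1 hJ)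
    _ = ((∑ I ∈ Finset.Iic R, R.binom I : ℕ) : ℝ≥0∞) * ((∑ J ∈ Finset.Iic T, T.binom J : ℕ) : ℝ≥0∞)
        * ENNReal.ofReal B := by
        simp only [Nat.cast_sum, ← Finset.sum_mul, Finset.sum_mul_sum]
    _ = _ := by
        rw [sum_binom, sum_binom, ENNReal.ofReal_mul (by positivity),
          ENNReal.ofReal_mul (by positivity), ENNReal.ofReal_pow (by norm_num),
          ENNReal.ofReal_pow (by norm_num)]
        simp [MultiIndex.deg, mdeg]

/-- Induction on `m` with `ε` universally quantified, since each level must start from a smaller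
exponent than the one it produces. The constants are uniform in `f`, `ℓ`, `R`, `S`, and the power of
`A` reflects the homogeneity of `hSum`. -/
lemma hSum_le (ħ : ℝ) (hħ : 0 < ħ) (p : Fin n → ℂ) (m : ℕ) : ∀ ε : ℝ, 0 < ε →
    ∃ δ : ℝ, 0 < δ ∧ ∃ C : ℝ, 0 ≤ C ∧ ∀ (f : Fn n) (A : ℝ), JetBound δ A (jet p f) →
      ∀ (ℓ : ℕ) (R S : MultiIndex n), hSum ħ p m ℓ R S f ≤
        ENNReal.ofReal (C * A ^ 2 ^ (m + 1) * ((mfact R : ℝ) ^ ε * (mfact S : ℝ) ^ ε)) := by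
  induction m with
  | zero =>
    intro ε hε
    obtain ⟨δ, hδ, C, hC, h⟩ := step_weight_bound (n := n) (2 * ħ) (by positivity) hε
    refine ⟨δ, hδ, C * geomConst n, mul_nonneg hC.le (geomConst_nonneg n), fun f A hA ℓ R S => ?_⟩
    have hA0 := hA.nonneg
    rw [hSum]
    refine (tsum_ofReal_le
      (c := C * A ^ 2 * ((mfact R : ℝ) ^ ε * (mfact S : ℝ) ^ ε)) (by positivity)
      fun N => ?_).trans_eq (by congr 1; ring)
    rw [← ofReal_norm, ← ENNReal.ofReal_pow (norm_nonneg _),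
      ← ENNReal.ofReal_mul (by positivity)]
    apply ENNReal.ofReal_le_ofReal
    calc (2 * ħ) ^ (R.deg + S.deg + N.deg) / N.fact * ‖wirt R (N + S) f p‖ ^ 2
        ≤ (2 * ħ) ^ (R.deg + S.deg + N.deg) / N.fact *
          (A * ((mfact R : ℝ) ^ δ * (mfact (N + S) : ℝ) ^ δ)) ^ 2 := by
          gcongr
          exact hA R (N + S)
      _ = A ^ 2 * ((2 * ħ) ^ (mdeg R + mdeg S + mdeg N) / mfact N *
          ((mfact R : ℝ) ^ δ * (mfact (N + S) : ℝ) ^ δ) ^ 2) := by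
          simp only [MultiIndex.deg, MultiIndex.fact, mdeg, mfact]; ring
      _ ≤ A ^ 2 * (C * ((mfact R : ℝ) ^ ε * (mfact S : ℝ) ^ ε) * (1 / 2) ^ mdeg N) := by
          exact mul_le_mul_of_nonneg_left (h R S N) (by positivity)
      _ = _ := by ring
  | succ m ih =>
    intro ε hε
    -- The base `4` is the square of the `2` produced by the binomial sums.
    obtain ⟨η, hη, D, hD, h⟩ := step_weight_bound (n := n) 4 (by positivity) hε
    obtain ⟨δ, hδ, C, hC, ih⟩ := ih η hη
    refine ⟨δ, hδ, D * C ^ 2 * geomConst n,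
      mul_nonneg (by positivity) (geomConst_nonneg n), fun f A hA ℓ R S => ?_⟩
    have hA0 := hA.nonneg
    have step : ∀ H : MultiIndex n → MultiIndex n → ℝ≥0∞,
        (∀ I J, H I J ≤ ENNReal.ofReal
          (C * A ^ 2 ^ (m + 1) * ((mfact I : ℝ) ^ η * (mfact J : ℝ) ^ η))) →
        ∑' N : MultiIndex n, (N.fact : ℝ≥0∞)⁻¹ *
          (∑ I ∈ Finset.Iic R, ∑ J ∈ Finset.Iic (N + S),
            ((R.binom I : ℝ≥0∞) * ((N + S).binom J : ℝ≥0∞)) * H I J) ^ 2 ≤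
        ENNReal.ofReal (D * C ^ 2 * geomConst n * A ^ 2 ^ (m + 1 + 1) *
          ((mfact R : ℝ) ^ ε * (mfact S : ℝ) ^ ε)) := by
      intro H hH
      refine (tsum_ofReal_le (c := D * C ^ 2 * A ^ 2 ^ (m + 1 + 1) *
        ((mfact R : ℝ) ^ ε * (mfact S : ℝ) ^ ε)) (by positivity)
        fun N => ?_).trans_eq (by congr 1; ring)
      have hb := binom_sum_le (H := H) (R := R) (T := N + S)
        (B := C * A ^ 2 ^ (m + 1) * ((mfact R : ℝ) ^ η * (mfact (N + S) : ℝ) ^ η))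
        fun I hI J hJ => (hH I J).trans <| ENNReal.ofReal_le_ofReal <| by
          gcongr <;> exact_mod_cast mfact_mono ‹_›
      have hN : (N.fact : ℝ≥0∞)⁻¹ = ENNReal.ofReal (mfact N : ℝ)⁻¹ := by
        rw [ENNReal.ofReal_inv_of_pos (by exact_mod_cast mfact_pos N), ENNReal.ofReal_natCast]
        rfl
      calc _ ≤ ENNReal.ofReal (mfact N : ℝ)⁻¹ * ENNReal.ofReal (2 ^ mdeg R * 2 ^ mdeg (N + S) *
            (C * A ^ 2 ^ (m + 1) * ((mfact R : ℝ) ^ η * (mfact (N + S) : ℝ) ^ η))) ^ 2 := by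
            rw [hN]
            gcongr
        _ = ENNReal.ofReal (C ^ 2 * A ^ 2 ^ (m + 1 + 1) *
            (4 ^ (mdeg R + mdeg S + mdeg N) / mfact N *
            ((mfact R : ℝ) ^ η * (mfact (N + S) : ℝ) ^ η) ^ 2)) := by
            rw [← ENNReal.ofReal_pow (by positivity), ← ENNReal.ofReal_mul (by positivity)]
            congr 1
            have e4 : (4 : ℝ) ^ (mdeg R + mdeg S + mdeg N) =
                (2 ^ mdeg R * 2 ^ mdeg (N + S)) ^ 2 := by
              rw [mdeg_add, ← pow_add, ← pow_mul, mul_comm _ 2, pow_mul]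
              norm_num
              ring
            rw [e4, pow_succ 2 (m + 1), pow_mul]
            ring
        _ ≤ ENNReal.ofReal (C ^ 2 * A ^ 2 ^ (m + 1 + 1) *
            (D * ((mfact R : ℝ) ^ ε * (mfact S : ℝ) ^ ε) * (1 / 2) ^ mdeg N)) := by
            apply ENNReal.ofReal_le_ofReal
            exact mul_le_mul_of_nonneg_left (h R S N) (by positivity)
        _ = _ := by congr 1; ring
    rw [hSum]
    split_ifs
    · exact step _ fun I J => ih f A hA _ I J
    -- The bound is symmetric in the two indices, so the swap for odd `ℓ` is harmless.
    · refine step _ fun I J => (ih f A hA _ J I).trans_eq ?_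
      rw [mul_comm ((mfact J : ℝ) ^ η)]

lemma eNorm_le (ħ : ℝ) (hħ : 0 < ħ) (p : Fin n → ℂ) (i : Label n) :
    ∃ δ : ℝ, 0 < δ ∧ ∃ C : ℝ, 0 ≤ C ∧ ∀ (f : Fn n) (A : ℝ), JetBound δ A (jet p f) →
      eNorm ħ p i f ≤ ENNReal.ofReal (C * A) := by
  -- The exponent `1` is arbitrary: `R` and `S` are fixed by the label, so their weight is just a
  -- constant.
  obtain ⟨δ, hδ, C, hC, h⟩ := hSum_le ħ hħ p i.1.1 1 one_pos
  set W : ℝ := (mfact i.2.1 : ℝ) ^ (1 : ℝ) * (mfact i.2.2 : ℝ) ^ (1 : ℝ)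
  have hW : 0 ≤ W := by positivity
  refine ⟨δ, hδ, (C * W) ^ (1 / 2 ^ (i.1.1 + 1) : ℝ), by positivity, fun f A hA => ?_⟩
  have hA0 := hA.nonneg
  refine (ENNReal.rpow_le_rpow (h f A hA i.1.2 i.2.1 i.2.2) (by positivity)).trans_eq ?_
  rw [ENNReal.ofReal_rpow_of_nonneg (by positivity) (by positivity)]
  congr 1
  rw [mul_right_comm, Real.mul_rpow (by positivity) (by positivity), ← Real.rpow_natCast A,
    ← Real.rpow_mul hA0]
  simp [W]

end SeminormUpper

/-! ### The seminorms control the growth of jets. -/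

section SeminormLower

variable {n : ℕ} (ħ : ℝ) (p : Fin n → ℂ)

/-- All summands are nonnegative, so one may keep only the term `N` with `I = R` and `J = N + S`,
where both binomials are `1`. -/
lemma sq_le_fact_mul_hSum (R S N : MultiIndex n)
    (H : MultiIndex n → MultiIndex n → ℝ≥0∞) :
    H R (N + S) ^ 2 ≤ (N.fact : ℝ≥0∞) * ∑' N : MultiIndex n, (N.fact : ℝ≥0∞)⁻¹ *
          (∑ I ∈ Finset.Iic R, ∑ J ∈ Finset.Iic (N + S),
            ((R.binom I : ℝ≥0∞) * ((N + S).binom J : ℝ≥0∞)) * H I J) ^ 2 := by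
  have h0 : (N.fact : ℝ≥0∞) ≠ 0 := by exact_mod_cast (mfact_pos N).ne'
  have hb : ∀ R : MultiIndex n, R.binom R = 1 := fun R => by simp [MultiIndex.binom]
  calc H R (N + S) ^ 2 = N.fact * ((N.fact : ℝ≥0∞)⁻¹ * H R (N + S) ^ 2) := by
        rw [← mul_assoc, ENNReal.mul_inv_cancel h0 (ENNReal.natCast_ne_top _), one_mul]
    _ ≤ _ := by
        gcongr
        refine le_trans ?_ (ENNReal.le_tsum N)
        gcongr
        refine le_trans ?_ (Finset.single_le_sum (fun _ _ => zero_le)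
          (Finset.mem_Iic.2 (le_refl R)))
        refine le_trans ?_ (Finset.single_le_sum (fun _ _ => zero_le)
          (Finset.mem_Iic.2 (le_refl (N + S))))
        simp [hb]

lemma hSum_sq_le_even (m ℓ : ℕ) (R N : MultiIndex n) (f : Fn n) :
    hSum ħ p m ℓ R N f ^ 2 ≤ N.fact * hSum ħ p (m + 1) (2 * ℓ) R 0 f := by
  have := sq_le_fact_mul_hSum R 0 N fun I J => hSum ħ p m ℓ I J f
  simpa [hSum] using this

lemma hSum_sq_le_odd (m ℓ : ℕ) (R N : MultiIndex n) (f : Fn n) :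
    hSum ħ p m ℓ N R f ^ 2 ≤ N.fact * hSum ħ p (m + 1) (2 * ℓ + 1) R 0 f := by
  have := sq_le_fact_mul_hSum R 0 N fun I J => hSum ħ p m ℓ J I f
  simpa [hSum] using this

lemma pow_le_hSum_zero (m : ℕ) (R S : MultiIndex n) (f : Fn n) :
    hSum ħ p 0 0 R S f ^ 2 ^ m ≤ hSum ħ p m 0 R S f := by
  induction m with
  | zero => simp
  | succ m ih =>
    have := sq_le_fact_mul_hSum R S 0 fun I J => hSum ħ p m 0 I J f
    calc hSum ħ p 0 0 R S f ^ 2 ^ (m + 1) = (hSum ħ p 0 0 R S f ^ 2 ^ m) ^ 2 := by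
          rw [pow_succ, pow_mul]
      _ ≤ hSum ħ p m 0 R S f ^ 2 := by gcongr
      _ ≤ _ := by simpa [hSum, MultiIndex.fact] using this

lemma le_hSum_zero_zero (R S : MultiIndex n) (f : Fn n) :
    ENNReal.ofReal ((2 * ħ) ^ (R.deg + S.deg)) * ‖jet p f R S‖ₑ ^ 2 ≤ hSum ħ p 0 0 R S f := by
  rw [hSum]
  refine le_trans ?_ (ENNReal.le_tsum 0)
  simp [MultiIndex.fact, MultiIndex.deg, jet]

/-- The first `m` steps use the term `N = 0` and merely square. Then an even step with `N = S` moves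
`S` into a factor `S!`, and an odd step, which exchanges the two indices, does the same for `R`. The
cost in factorials does not grow with `m`, whereas the power of the coefficient does. -/
lemma enorm_jet_pow_le (m : ℕ) (R S : MultiIndex n) (f : Fn n) :
    (ENNReal.ofReal ((2 * ħ) ^ (R.deg + S.deg)) * ‖jet p f R S‖ₑ ^ 2) ^ 2 ^ (m + 2) ≤
      ((R.fact : ℝ≥0∞) * S.fact) ^ 2 * hSum ħ p (m + 2) 1 0 0 f := by
  have h1 := (le_hSum_zero_zero ħ p R S f)
  have h2 := pow_le_hSum_zero ħ p m R S f
  have h3 := hSum_sq_le_even ħ p m 0 R S f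
  have h4 := hSum_sq_le_odd ħ p (m + 1) 0 0 R f
  simp only [mul_zero, zero_add] at h3 h4
  have hR : (R.fact : ℝ≥0∞) ≤ R.fact ^ 2 := by
    have : 1 ≤ R.fact := mfact_pos R
    exact_mod_cast Nat.le_self_pow two_ne_zero _
  calc _ ≤ hSum ħ p 0 0 R S f ^ 2 ^ (m + 2) := by gcongr
    _ = ((hSum ħ p 0 0 R S f ^ 2 ^ m) ^ 2) ^ 2 := by
        rw [← pow_mul, ← pow_mul, pow_add]
        norm_num [mul_assoc]
    _ ≤ (hSum ħ p m 0 R S f ^ 2) ^ 2 := by gcongr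
    _ ≤ (S.fact * hSum ħ p (m + 1) 0 R 0 f) ^ 2 := by gcongr
    _ = S.fact ^ 2 * hSum ħ p (m + 1) 0 R 0 f ^ 2 := mul_pow _ _ _
    _ ≤ S.fact ^ 2 * (R.fact * hSum ħ p (m + 2) 1 0 0 f) := by gcongr
    _ ≤ S.fact ^ 2 * (R.fact ^ 2 * hSum ħ p (m + 2) 1 0 0 f) := by gcongr
    _ = _ := by ring

/-- The label `(m + 2, 1, 0, 0)`. -/
def cofinalLabel (n m : ℕ) : Label n := (⟨m + 2, ⟨1, Nat.one_lt_two_pow (by omega)⟩⟩, 0, 0)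

/-- The `2^(m+3)`-th root of `enorm_jet_pow_le`: the factor `(R! S!)^2` becomes the power `1 /
2^(m+2)`, and `(2ħ)^(|R|+|S|)` contributes its square root. -/
lemma norm_jet_le (hħ : 0 < ħ) (m : ℕ) (R S : MultiIndex n) (f : Fn n)
    (hf : eNorm ħ p (cofinalLabel n m) f < ⊤) :
    ‖jet p f R S‖ ≤ (eNorm ħ p (cofinalLabel n m) f).toReal *
      ((√(2 * ħ))⁻¹ ^ mdeg R * (√(2 * ħ))⁻¹ ^ mdeg S) *
      ((mfact R : ℝ) ^ (1 / 2 ^ (m + 2) : ℝ) * (mfact S : ℝ) ^ (1 / 2 ^ (m + 2) : ℝ)) := by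
  have hh : (0 : ℝ) < 2 * ħ := by positivity
  set q := (eNorm ħ p (cofinalLabel n m) f).toReal
  set s := √(2 * ħ)
  have hs : 0 < s := Real.sqrt_pos.2 hh
  have hs2 : s ^ 2 = 2 * ħ := Real.sq_sqrt hh.le
  have e : hSum ħ p (m + 2) 1 0 0 f = ENNReal.ofReal (q ^ 2 ^ (m + 3)) := by
    rw [ENNReal.ofReal_pow ENNReal.toReal_nonneg, ENNReal.ofReal_toReal hf.ne]
    simp only [eNorm, cofinalLabel]
    rw [← ENNReal.rpow_natCast, ← ENNReal.rpow_mul]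
    simp
  have key := enorm_jet_pow_le ħ p m R S f
  rw [e, ← ofReal_norm, ← ENNReal.ofReal_pow (norm_nonneg _), ← ENNReal.ofReal_mul (by positivity),
    ← ENNReal.ofReal_pow (by positivity), ← ENNReal.ofReal_natCast, ← ENNReal.ofReal_natCast,
    ← ENNReal.ofReal_mul (by positivity), ← ENNReal.ofReal_pow (by positivity),
    ← ENNReal.ofReal_mul (by positivity), ENNReal.ofReal_le_ofReal_iff (by positivity)] at key
  have hq : 0 ≤ q := ENNReal.toReal_nonneg
  set w : ℝ := (mfact R : ℝ) ^ (1 / 2 ^ (m + 2) : ℝ) * (mfact S : ℝ) ^ (1 / 2 ^ (m + 2) : ℝ)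
  have hw1 : ∀ T : MultiIndex n,
      ((mfact T : ℝ) ^ (1 / 2 ^ (m + 2) : ℝ)) ^ 2 ^ (m + 2) = mfact T := fun T => by
    rw [← Real.rpow_natCast _ (2 ^ (m + 2)), ← Real.rpow_mul (by positivity)]
    simp
  have hw : w ^ 2 ^ (m + 2) = mfact R * mfact S := by rw [mul_pow, hw1, hw1]
  have hw0 : 0 ≤ w := by positivity
  have key2 : (s ^ (mdeg R + mdeg S) * ‖jet p f R S‖) ^ 2 ^ (m + 3) ≤ (q * w) ^ 2 ^ (m + 3) := by
    have e3 : 2 ^ (m + 3) = 2 ^ (m + 2) * 2 := pow_succ _ _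
    calc (s ^ (mdeg R + mdeg S) * ‖jet p f R S‖) ^ 2 ^ (m + 3)
        = ((2 * ħ) ^ (R.deg + S.deg) * ‖jet p f R S‖ ^ 2) ^ 2 ^ (m + 2) := by
          rw [e3, mul_comm _ 2, pow_mul, mul_pow, ← pow_mul, mul_comm _ 2, pow_mul s, hs2]; rfl
      _ ≤ _ := key
      _ = (q * w) ^ 2 ^ (m + 3) := by
          rw [mul_pow q, e3, pow_mul w, hw]
          simp only [MultiIndex.fact, mfact]
          ring
  have key3 := le_of_pow_le_pow_left₀ (by positivity) (by positivity) key2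
  calc ‖jet p f R S‖ = (s⁻¹ ^ mdeg R * s⁻¹ ^ mdeg S) * (s ^ (mdeg R + mdeg S) * ‖jet p f R S‖) := by
        rw [← pow_add, ← mul_assoc, ← mul_pow, inv_mul_cancel₀ hs.ne', one_pow, one_mul]
    _ ≤ (s⁻¹ ^ mdeg R * s⁻¹ ^ mdeg S) * (q * w) := by gcongr
    _ = _ := by ring

lemma exists_jetBound_eNorm (hħ : 0 < ħ) {δ : ℝ} (hδ : 0 < δ) : ∃ i : Label n, ∃ C : ℝ, 0 ≤ C ∧
    ∀ f : Fn n, eNorm ħ p i f < ⊤ → JetBound δ (C * (eNorm ħ p i f).toReal) (jet p f) := by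
  -- Half of `δ` is spent on the factorial power left by `norm_jet_le`, the other half on absorbing
  -- the powers of `1/√(2ħ)`.
  obtain ⟨m, hm⟩ := exists_pow_lt_of_lt_one (half_pos hδ) (one_half_lt_one (α := ℝ))
  obtain ⟨C, hC, h⟩ := pow_mdeg_le (κ := Fin n) (√(2 * ħ))⁻¹ (by positivity) (half_pos hδ)
  refine ⟨cofinalLabel n m, C * C, by positivity, fun f hf R S => ?_⟩
  have hm' : (1 / 2 ^ (m + 2) : ℝ) ≤ δ / 2 := by
    rw [one_div_pow] at hm
    refine le_trans ?_ hm.le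
    gcongr <;> norm_num
  refine (norm_jet_le ħ p hħ m R S f hf).trans ?_
  set q := (eNorm ħ p (cofinalLabel n m) f).toReal
  have hq : 0 ≤ q := ENNReal.toReal_nonneg
  have e : ∀ T : MultiIndex n, (mfact T : ℝ) ^ (δ / 2) * (mfact T : ℝ) ^ (δ / 2) =
      (mfact T : ℝ) ^ δ := fun T => by
    rw [← Real.rpow_add (by have := one_le_mfact T; linarith), add_halves]
  calc _ ≤ q * ((C * (mfact R : ℝ) ^ (δ / 2)) * (C * (mfact S : ℝ) ^ (δ / 2))) *
        ((mfact R : ℝ) ^ (δ / 2) * (mfact S : ℝ) ^ (δ / 2)) := by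
        gcongr
        · exact h R
        · exact h S
        · exact one_le_mfact R
        · exact one_le_mfact S
    _ = _ := by rw [← e R, ← e S]; ring

end SeminormLower


/-! ### Induction by adding unit multi-indices. -/

section MultiIndexInduction

variable {n : ℕ}

lemma multiIndex_induction {P : MultiIndex n → Prop} (h0 : P 0)
    (hs : ∀ k N, P N → P (N + Pi.single k 1)) (N : MultiIndex n) : P N := by
  induction hd : mdeg N generalizing N with
  | zero =>
    have : N = 0 := by
      funext k
      exact Finset.sum_eq_zero_iff.1 hd k (Finset.mem_univ k)
    rwa [this]
  | succ d ih =>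
    obtain ⟨k, hk⟩ : ∃ k, N k ≠ 0 := by
      by_contra! h
      have : mdeg N = 0 := Finset.sum_eq_zero fun k _ => h k
      omega
    have hle : Pi.single k 1 ≤ N := by
      intro j
      by_cases hj : j = k
      · subst hj; simp; omega
      · simp [hj]
    have e : N - Pi.single k 1 + Pi.single k 1 = N := tsub_add_cancel_of_le hle
    rw [← e]
    refine hs _ _ (ih _ ?_)
    have h1 := mdeg_add (N - Pi.single k 1) (Pi.single k 1)
    have h2 : mdeg (Pi.single k 1 : MultiIndex n) = 1 := by
      simp [mdeg]
    rw [e, h2] at h1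
    omega

end MultiIndexInduction

/-! ### Calculus of iterated Wirtinger derivatives. -/

section Wirtinger

variable {n : ℕ}

lemma fderiv_dir_comm {f : Fn n} (hf : ContDiff ℝ ∞ f) (v w x : Fin n → ℂ) :
    fderiv ℝ (fun y => fderiv ℝ f y v) x w = fderiv ℝ (fun y => fderiv ℝ f y w) x v := by
  have hd : DifferentiableAt ℝ (fderiv ℝ f) x :=
    (hf.fderiv_right (m := ∞) (by simp)).differentiable (by simp) x
  have hsymm : IsSymmSndFDerivAt ℝ f x := hf.contDiffAt.isSymmSndFDerivAt <| by
    rw [minSmoothness_of_isRCLikeNormedField]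
    exact WithTop.coe_le_coe.2 le_top
  rw [fderiv_clm_apply hd (differentiableAt_const _),
    fderiv_clm_apply hd (differentiableAt_const _)]
  simpa using hsymm w v

lemma fderiv_half_comb {f : Fn n} (hf : ContDiff ℝ ∞ f) (c : ℂ) (v v' w x : Fin n → ℂ) :
    fderiv ℝ (fun y => (1 / 2 : ℂ) * (fderiv ℝ f y v + c * fderiv ℝ f y v')) x w =
      (1 / 2 : ℂ) * (fderiv ℝ (fun y => fderiv ℝ f y v) x w +
        c * fderiv ℝ (fun y => fderiv ℝ f y v') x w) := by
  have h1 := (smooth_dir v f hf).differentiable (by simp) x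
  have h2 := (smooth_dir v' f hf).differentiable (by simp) x
  have h : HasFDerivAt (fun y => (1 / 2 : ℂ) * (fderiv ℝ f y v + c * fderiv ℝ f y v')) _ x :=
    (h1.hasFDerivAt.add (h2.hasFDerivAt.const_mul c)).const_mul (1 / 2 : ℂ)
  rw [h.fderiv]
  rfl

/-- Treats all three commutation relations at once: `dz` and `dzbar` are the cases `c = -i` and `c =
i`. -/
lemma half_comb_comm {f : Fn n} (hf : ContDiff ℝ ∞ f) (c d : ℂ) (v v' w w' x : Fin n → ℂ) :
    (1 / 2 : ℂ) * (fderiv ℝ (fun y => (1 / 2 : ℂ) * (fderiv ℝ f y v + c * fderiv ℝ f y v')) x w +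
      d * fderiv ℝ (fun y => (1 / 2 : ℂ) * (fderiv ℝ f y v + c * fderiv ℝ f y v')) x w') =
    (1 / 2 : ℂ) * (fderiv ℝ (fun y => (1 / 2 : ℂ) * (fderiv ℝ f y w + d * fderiv ℝ f y w')) x v +
      c * fderiv ℝ (fun y => (1 / 2 : ℂ) * (fderiv ℝ f y w + d * fderiv ℝ f y w')) x v') := by
  simp only [fderiv_half_comb hf]
  rw [fderiv_dir_comm hf v w, fderiv_dir_comm hf v w', fderiv_dir_comm hf v' w,
    fderiv_dir_comm hf v' w']
  ring

lemma dz_eq (k : Fin n) (f : Fn n) : dz k f = fun x => (1 / 2 : ℂ) *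
    (fderiv ℝ f x (Pi.single k 1) + -Complex.I * fderiv ℝ f x (Pi.single k Complex.I)) := by
  funext x
  simp only [dz]
  ring

lemma dz_comm (j k : Fin n) {f : Fn n} (hf : ContDiff ℝ ∞ f) : dz j (dz k f) = dz k (dz j f) := by
  simp only [dz_eq]
  funext x
  exact half_comb_comm hf _ _ _ _ _ _ x

lemma dzbar_comm (j k : Fin n) {f : Fn n} (hf : ContDiff ℝ ∞ f) :
    dzbar j (dzbar k f) = dzbar k (dzbar j f) := by
  funext x
  exact half_comb_comm hf _ _ _ _ _ _ x

lemma dz_dzbar_comm (j k : Fin n) {f : Fn n} (hf : ContDiff ℝ ∞ f) :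
    dz j (dzbar k f) = dzbar k (dz j f) := by
  simp only [dz_eq]
  funext x
  exact half_comb_comm hf _ _ _ _ _ _ x

lemma iterOp_zero (D : Fin n → Fn n → Fn n) (f : Fn n) : iterOp D 0 f = f := by
  unfold iterOp
  induction List.finRange n with
  | nil => rfl
  | cons k l ih => simp

/-- An operator commuting with all the `D k` on smooth functions commutes with `D^N`. -/
lemma comm_iterOp {D : Fin n → Fn n → Fn n} (hD : ∀ k, SmoothLinear (D k)) {U : Fn n → Fn n}
    (hU : ∀ k f, ContDiff ℝ ∞ f → U (D k f) = D k (U f)) (N : MultiIndex n) {f : Fn n}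
    (hf : ContDiff ℝ ∞ f) : U (iterOp D N f) = iterOp D N (U f) := by
  have hit : ∀ (k : Fin n) (m : ℕ) (g : Fn n), ContDiff ℝ ∞ g →
      U ((D k)^[m] g) = (D k)^[m] (U g) := by
    intro k m
    induction m with
    | zero => intro g _; rfl
    | succ m ih =>
      intro g hg
      rw [Function.iterate_succ_apply, Function.iterate_succ_apply, ih _ ((hD k).smooth g hg),
        hU k g hg]
  have key : ∀ l : List (Fin n), ContDiff ℝ ∞ (l.foldr (fun k g => (D k)^[N k] g) f) ∧
      U (l.foldr (fun k g => (D k)^[N k] g) f) = l.foldr (fun k g => (D k)^[N k] g) (U f) := by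
    intro l
    induction l with
    | nil => exact ⟨hf, rfl⟩
    | cons k l ih =>
      simp only [List.foldr_cons]
      exact ⟨((hD k).iterate (N k)).smooth _ ih.1, by rw [hit _ _ _ ih.1, ih.2]⟩
  exact (key _).2

/-- The additional `D k` arises in the middle of the ordered product and is commuted to the outside,
then to the inside. -/
lemma iterOp_add_single {D : Fin n → Fn n → Fn n} (hD : ∀ k, SmoothLinear (D k))
    (hcomm : ∀ j k f, ContDiff ℝ ∞ f → D j (D k f) = D k (D j f)) (N : MultiIndex n) (k : Fin n)
    {f : Fn n} (hf : ContDiff ℝ ∞ f) :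
    iterOp D (N + Pi.single k 1) f = iterOp D N (D k f) := by
  rw [← comm_iterOp hD (fun j g hg => hcomm k j g hg) N hf]
  have hsm : ∀ l : List (Fin n), ContDiff ℝ ∞ (l.foldr (fun k g => (D k)^[N k] g) f) := by
    intro l
    induction l with
    | nil => exact hf
    | cons k l ih => exact ((hD k).iterate (N k)).smooth _ ih
  have hit : ∀ (j : Fin n) (m : ℕ) (g : Fn n), ContDiff ℝ ∞ g →
      D k ((D j)^[m] g) = (D j)^[m] (D k g) := by
    intro j m
    induction m with
    | zero => intro g _; rfl
    | succ m ih =>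
      intro g hg
      rw [Function.iterate_succ_apply, Function.iterate_succ_apply, ih _ ((hD j).smooth g hg),
        hcomm k j g hg]
  -- For a partial product the extra factor is present only if `k` has already been met; absence of
  -- duplicates ensures that it occurs once.
  have key : ∀ l : List (Fin n), l.Nodup →
      l.foldr (fun j g => (D j)^[(N + Pi.single k 1 : MultiIndex n) j] g) f =
        if k ∈ l then D k (l.foldr (fun j g => (D j)^[N j] g) f)
        else l.foldr (fun j g => (D j)^[N j] g) f := by
    intro l
    induction l with
    | nil => intro _; rfl
    | cons j l ih =>
      intro hl
      rw [List.nodup_cons] at hl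
      simp only [List.foldr_cons, ih hl.2, List.mem_cons]
      by_cases hj : k = j
      · subst hj
        rw [if_neg hl.1, if_pos (Or.inl rfl), Pi.add_apply, Pi.single_eq_same,
          Function.iterate_succ_apply']
      · have : (Pi.single k 1 : MultiIndex n) j = 0 := Pi.single_eq_of_ne (Ne.symm hj) _
        simp only [hj, false_or, Pi.add_apply, this, add_zero]
        split_ifs
        · rw [hit _ _ _ (hsm l)]
        · rfl
  have := key (List.finRange n) (List.nodup_finRange n)
  rwa [if_pos (List.mem_finRange k)] at this

lemma smooth_dz (k : Fin n) {f : Fn n} (hf : ContDiff ℝ ∞ f) : ContDiff ℝ ∞ (dz k f) :=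
  (smoothLinear_dz k).smooth f hf

lemma smooth_dzbar (k : Fin n) {f : Fn n} (hf : ContDiff ℝ ∞ f) : ContDiff ℝ ∞ (dzbar k f) :=
  (smoothLinear_dzbar k).smooth f hf

lemma smooth_dzM (N : MultiIndex n) {f : Fn n} (hf : ContDiff ℝ ∞ f) : ContDiff ℝ ∞ (dzM N f) :=
  (smoothLinear_iterOp smoothLinear_dz N).smooth f hf

lemma smooth_dzbarM (N : MultiIndex n) {f : Fn n} (hf : ContDiff ℝ ∞ f) :
    ContDiff ℝ ∞ (dzbarM N f) :=
  (smoothLinear_iterOp smoothLinear_dzbar N).smooth f hf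

lemma dzM_zero (f : Fn n) : dzM 0 f = f := iterOp_zero _ _

lemma dzbarM_zero (f : Fn n) : dzbarM 0 f = f := iterOp_zero _ _

lemma dzM_add_single (N : MultiIndex n) (k : Fin n) {f : Fn n} (hf : ContDiff ℝ ∞ f) :
    dzM (N + Pi.single k 1) f = dzM N (dz k f) :=
  iterOp_add_single smoothLinear_dz (fun j k _ h => dz_comm j k h) N k hf

lemma dzbarM_add_single (N : MultiIndex n) (k : Fin n) {f : Fn n} (hf : ContDiff ℝ ∞ f) :
    dzbarM (N + Pi.single k 1) f = dzbarM N (dzbar k f) :=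
  iterOp_add_single smoothLinear_dzbar (fun j k _ h => dzbar_comm j k h) N k hf

lemma dz_dzbarM (k : Fin n) (N : MultiIndex n) {f : Fn n} (hf : ContDiff ℝ ∞ f) :
    dz k (dzbarM N f) = dzbarM N (dz k f) :=
  comm_iterOp smoothLinear_dzbar (fun j _ h => dz_dzbar_comm k j h) N hf

lemma dzM_dzbarM (R S : MultiIndex n) {f : Fn n} (hf : ContDiff ℝ ∞ f) :
    dzM R (dzbarM S f) = dzbarM S (dzM R f) :=
  (comm_iterOp smoothLinear_dz (fun k _ h => (dz_dzbarM k S h).symm) R hf).symm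

lemma wirt_zero (f : Fn n) : wirt 0 0 f = f := by
  rw [wirt, dzM_zero, dzbarM_zero]

lemma wirt_add_single_left (R S : MultiIndex n) (k : Fin n) {f : Fn n} (hf : ContDiff ℝ ∞ f) :
    wirt (R + Pi.single k 1) S f = wirt R S (dz k f) := by
  rw [wirt, wirt, dzM_add_single R k (smooth_dzbarM S hf), dz_dzbarM k S hf]

lemma wirt_add_single_right (R S : MultiIndex n) (k : Fin n) {f : Fn n} (hf : ContDiff ℝ ∞ f) :
    wirt R (S + Pi.single k 1) f = wirt R S (dzbar k f) := by
  rw [wirt, wirt, dzbarM_add_single S k hf]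

lemma wirt_dzM (N R S : MultiIndex n) {f : Fn n} (hf : ContDiff ℝ ∞ f) :
    wirt R S (dzM N f) = wirt (R + N) S f := by
  induction N using multiIndex_induction generalizing f with
  | h0 => rw [dzM_zero, add_zero]
  | hs k N ih =>
    rw [dzM_add_single N k hf, ih (smooth_dz k hf), ← add_assoc, wirt_add_single_left _ _ _ hf]

lemma wirt_dzbarM (N R S : MultiIndex n) {f : Fn n} (hf : ContDiff ℝ ∞ f) :
    wirt R S (dzbarM N f) = wirt R (S + N) f := by
  induction N using multiIndex_induction generalizing f with
  | h0 => rw [dzbarM_zero, add_zero]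
  | hs k N ih =>
    rw [dzbarM_add_single N k hf, ih (smooth_dzbar k hf), ← add_assoc,
      wirt_add_single_right _ _ _ hf]

lemma smooth_mul {f g : Fn n} (hf : ContDiff ℝ ∞ f) (hg : ContDiff ℝ ∞ g) :
    ContDiff ℝ ∞ (f * g) :=
  hf.mul hg

lemma dz_mul (k : Fin n) {f g : Fn n} (hf : ContDiff ℝ ∞ f) (hg : ContDiff ℝ ∞ g) :
    dz k (f * g) = dz k f * g + f * dz k g := by
  funext x
  simp only [dz, Pi.add_apply, Pi.mul_apply,
    fderiv_mul (hf.differentiable (by simp) x) (hg.differentiable (by simp) x)]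
  simp
  ring

lemma dzbar_mul (k : Fin n) {f g : Fn n} (hf : ContDiff ℝ ∞ f) (hg : ContDiff ℝ ∞ g) :
    dzbar k (f * g) = dzbar k f * g + f * dzbar k g := by
  funext x
  simp only [dzbar, Pi.add_apply, Pi.mul_apply,
    fderiv_mul (hf.differentiable (by simp) x) (hg.differentiable (by simp) x)]
  simp
  ring

lemma fderiv_star_apply {f : Fn n} (hf : ContDiff ℝ ∞ f) (x v : Fin n → ℂ) :
    fderiv ℝ (star f) x v = star (fderiv ℝ f x v) := by
  have := (hf.differentiable (by simp) x).hasFDerivAt.star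
  rw [show star f = fun y => star (f y) from rfl, this.fderiv]
  rfl

lemma smooth_star {f : Fn n} (hf : ContDiff ℝ ∞ f) : ContDiff ℝ ∞ (star f) :=
  (starL' ℝ : ℂ ≃L[ℝ] ℂ).contDiff.comp hf

lemma dz_star (k : Fin n) {f : Fn n} (hf : ContDiff ℝ ∞ f) : dz k (star f) = star (dzbar k f) := by
  funext x
  simp only [dz, dzbar, fderiv_star_apply hf, Pi.star_apply]
  simp
  ring

lemma dzM_star (N : MultiIndex n) {f : Fn n} (hf : ContDiff ℝ ∞ f) :
    dzM N (star f) = star (dzbarM N f) := by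
  induction N using multiIndex_induction generalizing f with
  | h0 => rw [dzM_zero, dzbarM_zero]
  | hs k N ih =>
    rw [dzM_add_single N k (smooth_star hf), dzbarM_add_single N k hf, dz_star k hf,
      ih (smooth_dzbar k hf)]

lemma dzbarM_star (N : MultiIndex n) {f : Fn n} (hf : ContDiff ℝ ∞ f) :
    dzbarM N (star f) = star (dzM N f) := by
  have := dzM_star N (smooth_star hf)
  rw [star_star] at this
  rw [this, star_star]

lemma wirt_star (R S : MultiIndex n) {f : Fn n} (hf : ContDiff ℝ ∞ f) :
    wirt R S (star f) = star (wirt S R f) := by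
  rw [wirt, wirt, dzbarM_star S hf, dzM_star R (smooth_dzM S hf), dzM_dzbarM S R hf]

end Wirtinger

/-! ### The Leibniz rule on jets. -/

section Leibniz

variable {n : ℕ}

lemma binom_of_not_le {T I : MultiIndex n} (h : ¬ I ≤ T) : T.binom I = 0 := by
  obtain ⟨k, hk⟩ := not_forall.1 h
  exact Finset.prod_eq_zero (Finset.mem_univ k) (Nat.choose_eq_zero_of_lt (not_le.1 hk))

lemma binom_add_single_add_single (T I : MultiIndex n) (k : Fin n) :
    (T + Pi.single k 1 : MultiIndex n).binom (I + Pi.single k 1) =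
      T.binom I + T.binom (I + Pi.single k 1) := by
  simp only [MultiIndex.binom, Fintype.prod_eq_mul_prod_compl k, Pi.add_apply, Pi.single_eq_same]
  have h : ∀ j ∈ ({k}ᶜ : Finset (Fin n)), (Pi.single k 1 : MultiIndex n) j = 0 := fun j hj =>
    Pi.single_eq_of_ne (by simpa using hj) _
  have h1 : ∏ j ∈ {k}ᶜ, (T j + (Pi.single k 1 : MultiIndex n) j).choose
      (I j + (Pi.single k 1 : MultiIndex n) j) = ∏ j ∈ {k}ᶜ, (T j).choose (I j) :=
    Finset.prod_congr rfl fun j hj => by rw [h j hj, add_zero, add_zero]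
  have h2 : ∏ j ∈ {k}ᶜ, (T j).choose (I j + (Pi.single k 1 : MultiIndex n) j) =
      ∏ j ∈ {k}ᶜ, (T j).choose (I j) :=
    Finset.prod_congr rfl fun j hj => by rw [h j hj, add_zero]
  rw [h1, h2, Nat.choose_succ_succ, add_mul]

lemma binom_add_single_of_eq_zero (T I : MultiIndex n) (k : Fin n) (hI : I k = 0) :
    (T + Pi.single k 1 : MultiIndex n).binom I = T.binom I := by
  refine Finset.prod_congr rfl fun j _ => ?_
  by_cases hj : j = k
  · subst hj; simp [hI]
  · simp [hj]

/-- Pascal's rule for binomial sums over multi-indices. -/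
lemma binom_sum_add_single (T : MultiIndex n) (k : Fin n) (x : MultiIndex n → MultiIndex n → ℂ) :
    ∑ I ∈ Finset.Iic (T + Pi.single k 1), ((T + Pi.single k 1 : MultiIndex n).binom I : ℂ) *
        x I (T + Pi.single k 1 - I) =
      ∑ I ∈ Finset.Iic T, (T.binom I : ℂ) *
        (x (I + Pi.single k 1) (T - I) + x I (T - I + Pi.single k 1)) := by
  set e : MultiIndex n := Pi.single k 1
  -- Pascal's rule. The case `I k = 0` is separate because the truncated `I - e` would then not
  -- satisfy `I - e + e = I`.
  have hsplit : ∀ I ∈ Finset.Iic (T + e), ((T + e).binom I : ℂ) * x I (T + e - I) =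
      (T.binom I : ℂ) * x I (T + e - I) +
        if I k = 0 then 0 else (T.binom (I - e) : ℂ) * x I (T + e - I) := by
    intro I _
    split_ifs with hI
    · rw [binom_add_single_of_eq_zero T I k hI, add_zero]
    · have he : I - e + e = I := tsub_add_cancel_of_le fun j => by
        by_cases hj : j = k
        · subst hj; simp [e]; omega
        · simp [e, hj]
      have := binom_add_single_add_single T (I - e) k
      rw [show (Pi.single k 1 : MultiIndex n) = e from rfl, he] at this
      rw [this]
      push_cast
      ring
  rw [Finset.sum_congr rfl hsplit, Finset.sum_add_distrib, add_comm]
  simp only [mul_add]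
  rw [Finset.sum_add_distrib]
  congr 1
  · symm
    refine Finset.sum_of_injOn (fun I => I + e) (fun I _ J _ h => add_right_cancel h)
      (fun I hI => ?_) (fun I hI hI' => ?_) (fun I hI => ?_)
    · simp only [Finset.coe_Iic, Set.mem_Iic] at hI ⊢
      exact add_le_add_left hI e
    · rw [if_pos]
      by_contra h
      apply hI'
      have he : I - e + e = I := tsub_add_cancel_of_le fun j => by
        by_cases hj : j = k
        · subst hj; simp [e]; omega
        · simp [e, hj]
      refine ⟨I - e, ?_, he⟩
      simp only [Finset.coe_Iic, Set.mem_Iic]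
      exact tsub_le_iff_right.2 (Finset.mem_Iic.1 hI)
    · rw [if_neg (by simp [e]), add_tsub_cancel_right, add_tsub_add_eq_tsub_right]
  · symm
    -- The indices below `T + e` but not below `T` have vanishing binomial.
    refine Finset.sum_subset_zero_on_sdiff (fun I hI => ?_) (fun I hI => ?_) (fun I hI => ?_)
    · exact Finset.mem_Iic.2 ((Finset.mem_Iic.1 hI).trans le_self_add)
    · rw [binom_of_not_le (by simpa using (Finset.mem_sdiff.1 hI).2), Nat.cast_zero, zero_mul]
    · rw [tsub_add_eq_add_tsub (Finset.mem_Iic.1 hI)]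

/-- The jet of a product, by the Leibniz rule. -/
def conv (a b : Jet n) : Jet n := fun R S =>
  ∑ I ∈ Finset.Iic R, ∑ J ∈ Finset.Iic S,
    (R.binom I : ℂ) * ((S.binom J : ℂ) * (a I J * b (R - I) (S - J)))

/-- The jet of `∂f/∂zₖ` in terms of the jet of `f`. -/
def shiftL (k : Fin n) (a : Jet n) : Jet n := fun R S => a (R + Pi.single k 1) S

/-- The jet of `∂f/∂z̄ₖ` in terms of the jet of `f`. -/
def shiftR (k : Fin n) (a : Jet n) : Jet n := fun R S => a R (S + Pi.single k 1)

lemma shiftL_conv (k : Fin n) (a b : Jet n) :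
    shiftL k (conv a b) = conv (shiftL k a) b + conv a (shiftL k b) := by
  funext R S
  have := binom_sum_add_single R k fun I I' => ∑ J ∈ Finset.Iic S,
    ((S.binom J : ℂ) * (a I J * b I' (S - J)))
  simpa only [shiftL, conv, Finset.mul_sum, Pi.add_apply, mul_add, Finset.sum_add_distrib]
    using this

lemma shiftR_conv (k : Fin n) (a b : Jet n) :
    shiftR k (conv a b) = conv (shiftR k a) b + conv a (shiftR k b) := by
  funext R S
  have := fun I => binom_sum_add_single S k fun J J' => a I J * b (R - I) J'
  simp only [shiftR, conv, ← Finset.mul_sum, this, Pi.add_apply, mul_add, Finset.sum_add_distrib]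

variable (p : Fin n → ℂ)

lemma jet_dz (k : Fin n) {f : Fn n} (hf : ContDiff ℝ ∞ f) : jet p (dz k f) = shiftL k (jet p f) := by
  funext R S
  simp only [jet, shiftL, wirt_add_single_left R S k hf]

lemma jet_dzbar (k : Fin n) {f : Fn n} (hf : ContDiff ℝ ∞ f) :
    jet p (dzbar k f) = shiftR k (jet p f) := by
  funext R S
  simp only [jet, shiftR, wirt_add_single_right R S k hf]

lemma jet_add {f g : Fn n} (hf : ContDiff ℝ ∞ f) (hg : ContDiff ℝ ∞ g) :
    jet p (f + g) = jet p f + jet p g := by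
  funext R S
  simp only [jet, (smoothLinear_wirt R S).add f g hf hg, Pi.add_apply]

lemma jet_smul (c : ℂ) {f : Fn n} (hf : ContDiff ℝ ∞ f) : jet p (c • f) = c • jet p f := by
  funext R S
  simp only [jet, (smoothLinear_wirt R S).smul c f hf, Pi.smul_apply]

/-- Both sides are turned into sums by the index shifts in the same way, since derivatives and
`conv` satisfy the same product rule. Only the value at `p` remains to be compared. -/
lemma jet_mul {f g : Fn n} (hf : ContDiff ℝ ∞ f) (hg : ContDiff ℝ ∞ g) :
    jet p (f * g) = conv (jet p f) (jet p g) := by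
  funext R S
  induction R using multiIndex_induction generalizing f g with
  | h0 =>
    induction S using multiIndex_induction generalizing f g with
    | h0 =>
      have hI : (Finset.Iic (0 : MultiIndex n)) = {0} := by ext; simp
      simp [jet, conv, wirt_zero, hI, MultiIndex.binom]
    | hs k S ih =>
      change shiftR k (jet p (f * g)) 0 S = shiftR k (conv (jet p f) (jet p g)) 0 S
      rw [shiftR_conv, ← jet_dzbar p k (smooth_mul hf hg), dzbar_mul k hf hg,
        jet_add p (smooth_mul (smooth_dzbar k hf) hg)
          (smooth_mul hf (smooth_dzbar k hg)), Pi.add_apply,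
        Pi.add_apply, ih (smooth_dzbar k hf) hg, ih hf (smooth_dzbar k hg), jet_dzbar p k hf,
        jet_dzbar p k hg]
      rfl
  | hs k R ih =>
    change shiftL k (jet p (f * g)) R S = shiftL k (conv (jet p f) (jet p g)) R S
    rw [shiftL_conv, ← jet_dz p k (smooth_mul hf hg), dz_mul k hf hg,
      jet_add p (smooth_mul (smooth_dz k hf) hg)
          (smooth_mul hf (smooth_dz k hg)), Pi.add_apply,
      Pi.add_apply, ih (smooth_dz k hf) hg, ih hf (smooth_dz k hg), jet_dz p k hf, jet_dz p k hg]
    rfl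

end Leibniz


/-! ### Everywhere convergent power series in several variables. -/

section EntireSeries

variable {κ : Type*} [Fintype κ]

/-- The normalized monomial `w^T / T!`. -/
def expMono (T : κ → ℕ) (w : κ → ℂ) : ℂ := ∏ k, w k ^ T k / ((T k).factorial : ℂ)

/-- The coefficients `a` of `∑ a_T w^T / T!` define an everywhere convergent power series. -/
def EntireCoeff (a : (κ → ℕ) → ℂ) : Prop :=
  ∀ ρ : ℝ, 0 ≤ ρ → ∃ C : ℝ, ∀ T, ‖a T‖ * ρ ^ mdeg T ≤ C * mfact T

/-- The entire function `∑ a_T w^T / T!`. -/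
def entireSum (a : (κ → ℕ) → ℂ) (w : κ → ℂ) : ℂ := ∑' T, a T * expMono T w

lemma norm_expMono_le (T : κ → ℕ) {w : κ → ℂ} {ρ : ℝ} (hw : ‖w‖ ≤ ρ) :
    ‖expMono T w‖ ≤ ρ ^ mdeg T / mfact T := by
  rw [expMono, norm_prod, mdeg, mfact, ← Finset.prod_pow_eq_pow_sum, Nat.cast_prod,
    ← Finset.prod_div_distrib]
  refine Finset.prod_le_prod (fun _ _ => norm_nonneg _) fun k _ => ?_
  rw [norm_div, norm_pow, Complex.norm_natCast]
  gcongr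
  exact (norm_le_pi_norm w k).trans hw

lemma entireSum_zero (a : (κ → ℕ) → ℂ) : entireSum a 0 = a 0 := by
  rw [entireSum, tsum_eq_single 0]
  · simp [expMono]
  · intro T hT
    obtain ⟨k, hk⟩ := Function.ne_iff.1 hT
    have : expMono T (0 : κ → ℂ) = 0 := Finset.prod_eq_zero (Finset.mem_univ k) (by
      simp [zero_pow (show T k ≠ 0 from hk)])
    rw [this, mul_zero]

variable [DecidableEq κ]

/-- The coefficients of the `j`-th partial derivative. -/
def coeffShift (j : κ) (a : (κ → ℕ) → ℂ) : (κ → ℕ) → ℂ := fun T => a (T + Pi.single j 1)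

lemma EntireCoeff.summable {a : (κ → ℕ) → ℂ} (ha : EntireCoeff a) {ρ : ℝ} (hρ : 0 ≤ ρ) :
    Summable fun T => ‖a T‖ * (ρ ^ mdeg T / mfact T) := by
  -- The bound at twice the radius supplies the geometric factor `2^(-|T|)`.
  obtain ⟨C, hC⟩ := ha (2 * ρ) (by positivity)
  refine Summable.of_nonneg_of_le (fun _ => by positivity) (fun T => ?_)
    ((summable_half_pow_mdeg (κ := κ)).mul_left C)
  have h0 : (0 : ℝ) < mfact T := by exact_mod_cast mfact_pos T
  have := hC T
  rw [mul_pow, ← div_le_iff₀ h0] at this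
  calc ‖a T‖ * (ρ ^ mdeg T / mfact T)
      = (‖a T‖ * (2 ^ mdeg T * ρ ^ mdeg T) / mfact T) * (1 / 2) ^ mdeg T := by
        rw [one_div, inv_pow]; field_simp
    _ ≤ _ := by gcongr

lemma EntireCoeff.shift {a : (κ → ℕ) → ℂ} (ha : EntireCoeff a) (j : κ) :
    EntireCoeff (coeffShift j a) := by
  intro ρ hρ
  -- The factor `2` pays for `(T + e_j)! ≤ 2^(|T|+1) T!`; adding `1` makes the base at least `1`, so
  -- that the degree may be raised.
  obtain ⟨C, hC⟩ := ha (2 * (ρ + 1)) (by positivity)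
  refine ⟨C, fun T => ?_⟩
  have hC0 : 0 ≤ C := by
    have := (by positivity : (0 : ℝ) ≤ _).trans (hC 0)
    simpa [mfact] using this
  have h1 : mdeg (Pi.single j 1 : κ → ℕ) = 1 := by simp [mdeg]
  have h2 : mfact (Pi.single j 1 : κ → ℕ) = 1 := by
    refine Finset.prod_eq_one fun k _ => ?_
    by_cases hk : k = j
    · subst hk; simp
    · simp [hk]
  have h3 := mfact_add_le T (Pi.single j 1)
  rw [h1, h2, mul_one] at h3
  have h3' : (mfact (T + Pi.single j 1) : ℝ) ≤ 2 ^ (mdeg T + 1) * mfact T := by exact_mod_cast h3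
  have h4 := hC (T + Pi.single j 1)
  rw [mdeg_add, h1, mul_pow] at h4
  have h5 : (2 : ℝ) ^ (mdeg T + 1) * (‖coeffShift j a T‖ * ρ ^ mdeg T) ≤
      2 ^ (mdeg T + 1) * (C * mfact T) := by
    calc (2 : ℝ) ^ (mdeg T + 1) * (‖coeffShift j a T‖ * ρ ^ mdeg T)
        ≤ 2 ^ (mdeg T + 1) * (‖coeffShift j a T‖ * (ρ + 1) ^ (mdeg T + 1)) := by
          gcongr
          calc ρ ^ mdeg T ≤ (ρ + 1) ^ mdeg T := by gcongr; linarith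
            _ ≤ (ρ + 1) ^ (mdeg T + 1) := pow_le_pow_right₀ (by linarith) (by omega)
      _ = ‖a (T + Pi.single j 1)‖ * (2 ^ (mdeg T + 1) * (ρ + 1) ^ (mdeg T + 1)) := by
          rw [coeffShift]; ring
      _ ≤ C * mfact (T + Pi.single j 1) := h4
      _ ≤ C * (2 ^ (mdeg T + 1) * mfact T) := by gcongr
      _ = _ := by ring
  exact le_of_mul_le_mul_left h5 (by positivity)

/-- The `j`-th partial derivative of `w^T / T!`. -/
def expMonoDeriv (j : κ) (T : κ → ℕ) (w : κ → ℂ) : ℂ :=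
  if T j = 0 then 0 else expMono (T - Pi.single j 1) w

lemma hasFDerivAt_expMono (T : κ → ℕ) (w : κ → ℂ) :
    HasFDerivAt (expMono T)
      (∑ j, expMonoDeriv j T w • (ContinuousLinearMap.proj j : (κ → ℂ) →L[ℂ] ℂ)) w := by
  have h1 : ∀ k ∈ Finset.univ, HasFDerivAt (fun w : κ → ℂ => w k ^ T k / ((T k).factorial : ℂ))
      (((T k : ℂ) * w k ^ (T k - 1) / ((T k).factorial : ℂ)) •
        (ContinuousLinearMap.proj k : (κ → ℂ) →L[ℂ] ℂ)) w := fun k _ => by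
    have := ((hasDerivAt_pow (T k) (w k)).div_const ((T k).factorial : ℂ)).comp_hasFDerivAt w
      (ContinuousLinearMap.proj k : (κ → ℂ) →L[ℂ] ℂ).hasFDerivAt
    exact this
  have h2 := HasFDerivAt.finsetProd h1
  convert! h2 using 1
  refine Finset.sum_congr rfl fun j _ => ?_
  rw [smul_smul]
  congr 1
  unfold expMonoDeriv
  split_ifs with h
  · simp [h]
  · rw [expMono, ← Finset.mul_prod_erase _ _ (Finset.mem_univ j), mul_comm]
    obtain ⟨m, hm⟩ := Nat.exists_eq_succ_of_ne_zero h
    congr 1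
    · refine Finset.prod_congr rfl fun k hk => ?_
      simp [Finset.ne_of_mem_erase hk]
    · have hm0 : (m : ℂ) + 1 ≠ 0 := by exact_mod_cast m.succ_ne_zero
      simp only [Pi.sub_apply, Pi.single_eq_same, hm, Nat.succ_eq_add_one, Nat.add_sub_cancel,
        Nat.factorial_succ]
      push_cast
      rw [mul_div_mul_left _ _ hm0]

lemma norm_expMonoDeriv_le (j : κ) (T : κ → ℕ) {w : κ → ℂ} {ρ : ℝ} (hρ : 1 ≤ ρ) (hw : ‖w‖ ≤ ρ) :
    ‖expMonoDeriv j T w‖ ≤ (2 * ρ) ^ mdeg T / mfact T := by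
  unfold expMonoDeriv
  split_ifs with h
  · rw [norm_zero]; positivity
  · have he : T - Pi.single j 1 + Pi.single j 1 = T := tsub_add_cancel_of_le fun k => by
      by_cases hk : k = j
      · subst hk; simp; omega
      · simp [hk]
    have h1 : mdeg (Pi.single j 1 : κ → ℕ) = 1 := by simp [mdeg]
    have h2 : mfact (Pi.single j 1 : κ → ℕ) = 1 := by
      refine Finset.prod_eq_one fun k _ => ?_
      by_cases hk : k = j
      · subst hk; simp
      · simp [hk]
    set U := T - Pi.single j 1
    have h3 := mfact_add_le U (Pi.single j 1)
    have h4 := mdeg_add U (Pi.single j 1)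
    rw [he, h1] at h4
    rw [he, h1, h2, mul_one, ← h4] at h3
    have h3' : (mfact T : ℝ) ≤ 2 ^ mdeg T * mfact U := by exact_mod_cast h3
    have hT : (0 : ℝ) < mfact T := by exact_mod_cast mfact_pos T
    have hU : (0 : ℝ) < mfact U := by exact_mod_cast mfact_pos U
    refine (norm_expMono_le U hw).trans ?_
    rw [div_le_div_iff₀ hU hT, mul_pow]
    calc ρ ^ mdeg U * mfact T ≤ ρ ^ mdeg T * (2 ^ mdeg T * mfact U) := by
          gcongr
          omega
      _ = _ := by ring

lemma tsum_expMonoDeriv (a : (κ → ℕ) → ℂ) (j : κ) (w : κ → ℂ) :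
    ∑' T, a T * expMonoDeriv j T w = entireSum (coeffShift j a) w := by
  have hinj : Function.Injective fun T : κ → ℕ => T + Pi.single j 1 := add_left_injective _
  rw [entireSum, ← hinj.tsum_eq (f := fun T => a T * expMonoDeriv j T w)]
  · refine tsum_congr fun T => ?_
    simp [coeffShift, expMonoDeriv]
  · intro T hT
    have h : T j ≠ 0 := fun h => hT (by simp [expMonoDeriv, h])
    refine ⟨T - Pi.single j 1, tsub_add_cancel_of_le fun k => ?_⟩
    by_cases hk : k = j
    · subst hk; simp; omega
    · simp [hk]

/-- Termwise differentiation on a ball of radius `‖w‖ + 1`, where the derivatives of the monomials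
are dominated by the monomial bound at twice that radius. -/
lemma hasFDerivAt_entireSum {a : (κ → ℕ) → ℂ} (ha : EntireCoeff a) (w : κ → ℂ) :
    HasFDerivAt (entireSum a) (∑ j, entireSum (coeffShift j a) w •
      (ContinuousLinearMap.proj j : (κ → ℂ) →L[ℂ] ℂ)) w := by
  set ρ : ℝ := ‖w‖ + 1
  have hρ : 1 ≤ ρ := by simp [ρ]
  have hproj : ∀ j, ‖(ContinuousLinearMap.proj j : (κ → ℂ) →L[ℂ] ℂ)‖ ≤ 1 := fun j =>
    ContinuousLinearMap.opNorm_le_bound _ zero_le_one fun x => by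
      rw [one_mul]; exact norm_le_pi_norm x j
  have hsum : ∀ j, Summable fun T => a T * expMonoDeriv j T w := fun j =>
    Summable.of_norm_bounded (ha.summable (ρ := 2 * ρ) (by positivity)) fun T => by
      rw [norm_mul]
      gcongr
      exact norm_expMonoDeriv_le j T hρ (by simp [ρ])
  have h1 := hasFDerivAt_tsum_of_isPreconnected
    (f := fun T (w : κ → ℂ) => a T * expMono T w)
    (f' := fun T w => a T • ∑ j, expMonoDeriv j T w •
      (ContinuousLinearMap.proj j : (κ → ℂ) →L[ℂ] ℂ))
    (u := fun T => (Fintype.card κ : ℝ) * (‖a T‖ * ((2 * ρ) ^ mdeg T / mfact T)))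
    (s := Metric.ball 0 ρ) (x₀ := w) (x := w)
    ((ha.summable (by positivity)).mul_left _) Metric.isOpen_ball
    (convex_ball (0 : κ → ℂ) ρ).isPreconnected
    (fun T w _ => (hasFDerivAt_expMono T w).const_mul (a T))
    (fun T w hw => by
      have hw' : ‖w‖ ≤ ρ := by simpa using (Metric.mem_ball.1 hw).le
      rw [norm_smul, mul_left_comm]
      gcongr
      refine (norm_sum_le _ _).trans ?_
      rw [← nsmul_eq_mul, Fintype.card]
      refine Finset.sum_le_card_nsmul _ _ _ fun j _ => ?_
      rw [norm_smul]
      refine (mul_le_mul (norm_expMonoDeriv_le j T hρ hw') (hproj j) (norm_nonneg _)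
        (by positivity)).trans_eq (mul_one _))
    (by simp [ρ])
    (Summable.of_norm_bounded (ha.summable (ρ := ρ) (by positivity)) fun T => by
      rw [norm_mul]
      gcongr
      exact norm_expMono_le T (by simp [ρ]))
    (by simp [ρ])
  convert! h1 using 1
  simp only [Finset.smul_sum, smul_smul]
  rw [Summable.tsum_finsetSum fun j _ => (hsum j).smul_const _]
  refine Finset.sum_congr rfl fun j _ => ?_
  rw [(hsum j).tsum_smul_const, tsum_expMonoDeriv]

/-- The partial derivatives are series of the same kind, so the order of smoothness can be raised by
induction. -/
lemma contDiff_entireSum {a : (κ → ℕ) → ℂ} (ha : EntireCoeff a) : ContDiff ℂ ∞ (entireSum a) := by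
  rw [contDiff_infty]
  intro m
  induction m generalizing a with
  | zero =>
    rw [Nat.cast_zero, contDiff_zero, continuous_iff_continuousAt]
    exact fun w => (hasFDerivAt_entireSum ha w).continuousAt
  | succ m ih =>
    rw [Nat.cast_add, Nat.cast_one, contDiff_succ_iff_hasFDerivAt]
    exact ⟨_, ContDiff.sum fun j _ => (ih (ha.shift j)).smul contDiff_const,
      fun w => hasFDerivAt_entireSum ha w⟩

end EntireSeries

/-! ### Realising a jet by a function. -/

section Synthesis

variable {n : ℕ}

/-- The coefficients of a jet as a family indexed by multi-indices in `z` and `z̄` together. -/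
def jetCoeff (a : Jet n) : (Fin n ⊕ Fin n → ℕ) → ℂ := fun T => a (T ∘ Sum.inl) (T ∘ Sum.inr)

/-- The real linear map `z ↦ (z, z̄)`. -/
def zzbar (n : ℕ) : (Fin n → ℂ) →L[ℝ] (Fin n ⊕ Fin n → ℂ) :=
  ContinuousLinearMap.pi (Sum.elim (fun k => ContinuousLinearMap.proj k)
    fun k => (Complex.conjCLE : ℂ →L[ℝ] ℂ).comp (ContinuousLinearMap.proj k))

/-- The function with a given Taylor expansion at `p`. -/
def synth (p : Fin n → ℂ) (a : Jet n) : Fn n := fun x => entireSum (jetCoeff a) (zzbar n (x - p))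

lemma coeffShift_inl (a : Jet n) (k : Fin n) :
    coeffShift (Sum.inl k) (jetCoeff a) = jetCoeff (shiftL k a) := by
  funext T
  simp only [coeffShift, jetCoeff, shiftL]
  congr 1
  funext j
  simp [Pi.single_apply]

lemma coeffShift_inr (a : Jet n) (k : Fin n) :
    coeffShift (Sum.inr k) (jetCoeff a) = jetCoeff (shiftR k a) := by
  funext T
  simp only [coeffShift, jetCoeff, shiftR]
  congr 1
  funext j
  simp [Pi.single_apply]

lemma smooth_synth (p : Fin n → ℂ) {a : Jet n} (ha : EntireCoeff (jetCoeff a)) :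
    ContDiff ℝ ∞ (synth p a) :=
  ((contDiff_entireSum ha).restrict_scalars ℝ).comp
    ((zzbar n).contDiff.comp (contDiff_id.sub contDiff_const))

lemma fderiv_synth (p : Fin n → ℂ) {a : Jet n} (ha : EntireCoeff (jetCoeff a)) (x v : Fin n → ℂ) :
    fderiv ℝ (synth p a) x v =
      ∑ k, (synth p (shiftL k a) x * v k + synth p (shiftR k a) x * star (v k)) := by
  have h1 := (hasFDerivAt_entireSum ha (zzbar n (x - p))).restrictScalars ℝ
  have h2 : HasFDerivAt (fun x => zzbar n (x - p)) ((zzbar n).comp (.id ℝ _)) x :=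
    (zzbar n).hasFDerivAt.comp x ((hasFDerivAt_id x).sub_const p)
  have h3 : HasFDerivAt (synth p a) _ x := h1.comp x h2
  rw [h3.fderiv]
  simp [Fintype.sum_sum_type, coeffShift_inl, coeffShift_inr, Finset.sum_add_distrib, synth, zzbar]

lemma dz_synth (p : Fin n → ℂ) {a : Jet n} (ha : EntireCoeff (jetCoeff a)) (k : Fin n) :
    dz k (synth p a) = synth p (shiftL k a) := by
  funext x
  simp only [dz, fderiv_synth p ha, Finset.sum_add_distrib]
  simp [Pi.single_apply, apply_ite]
  -- By `i² = -1` the conjugate contribution cancels and the holomorphic one doubles.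
  linear_combination (synth p (shiftR k a) x - synth p (shiftL k a) x) / 2 * Complex.I_sq

lemma dzbar_synth (p : Fin n → ℂ) {a : Jet n} (ha : EntireCoeff (jetCoeff a)) (k : Fin n) :
    dzbar k (synth p a) = synth p (shiftR k a) := by
  funext x
  simp only [dzbar, fderiv_synth p ha, Finset.sum_add_distrib]
  simp [Pi.single_apply, apply_ite]
  linear_combination (synth p (shiftL k a) x - synth p (shiftR k a) x) / 2 * Complex.I_sq

/-- Wirtinger derivatives of the series are the series of the shifted jets, so every coefficient
reduces to a value at `p`, which is the constant term. -/
lemma jet_synth (p : Fin n → ℂ) {a : Jet n} (ha : EntireCoeff (jetCoeff a)) :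
    jet p (synth p a) = a := by
  funext R S
  induction R using multiIndex_induction generalizing a with
  | h0 =>
    induction S using multiIndex_induction generalizing a with
    | h0 =>
      rw [jet, wirt_zero, synth, sub_self, map_zero, entireSum_zero]
      rfl
    | hs k S ih =>
      rw [jet, wirt_add_single_right _ _ _ (smooth_synth p ha), dzbar_synth p ha]
      exact ih (a := shiftR k a) (coeffShift_inr a k ▸ ha.shift _)
  | hs k R ih =>
    rw [jet, wirt_add_single_left _ _ _ (smooth_synth p ha), dz_synth p ha]
    exact ih (a := shiftL k a) (coeffShift_inl a k ▸ ha.shift _)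

/-- Half of the factorial covers the coefficient, and the other half absorbs `ρ^|T|`. -/
lemma JetBound.entireCoeff {A : ℝ} {a : Jet n} (ha : JetBound (1 / 2) A a) :
    EntireCoeff (jetCoeff a) := by
  intro ρ hρ
  obtain ⟨C, hC, h⟩ := pow_mdeg_le (κ := Fin n ⊕ Fin n) ρ hρ (ε := 1 / 2) (by norm_num)
  refine ⟨A * C, fun T => ?_⟩
  have hA := ha.nonneg
  have e : mfact T = mfact (T ∘ Sum.inl) * mfact (T ∘ Sum.inr) := Fintype.prod_sum_type _
  have h1 : ‖jetCoeff a T‖ ≤ A * (mfact T : ℝ) ^ (1 / 2 : ℝ) := by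
    rw [e, Nat.cast_mul, Real.mul_rpow (by positivity) (by positivity)]
    exact ha _ _
  calc ‖jetCoeff a T‖ * ρ ^ mdeg T
      ≤ (A * (mfact T : ℝ) ^ (1 / 2 : ℝ)) * (C * (mfact T : ℝ) ^ (1 / 2 : ℝ)) := by
        gcongr
        exact h T
    _ = A * C * ((mfact T : ℝ) ^ (1 / 2 : ℝ) * (mfact T : ℝ) ^ (1 / 2 : ℝ)) := by ring
    _ = A * C * mfact T := by
        rw [← Real.rpow_add (by exact_mod_cast mfact_pos T)]
        norm_num

end Synthesis


/-! ### Linear combinations and series of bounded jets. -/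

section JetSpace

variable {n : ℕ}

/-- Jets which grow slower than every positive power of `R! S!`. -/
def SlowGrowth (a : Jet n) : Prop := ∀ δ : ℝ, 0 < δ → ∃ A : ℝ, JetBound δ A a

lemma JetBound.add {δ A B : ℝ} {a b : Jet n} (ha : JetBound δ A a) (hb : JetBound δ B b) :
    JetBound δ (A + B) (a + b) := fun R S => by
  rw [add_mul]
  exact (norm_add_le _ _).trans (add_le_add (ha R S) (hb R S))

lemma JetBound.smul {δ A : ℝ} {a : Jet n} (ha : JetBound δ A a) (c : ℂ) :
    JetBound δ (‖c‖ * A) (c • a) := fun R S => by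
  rw [mul_assoc, Pi.smul_apply, Pi.smul_apply, norm_smul]
  exact mul_le_mul_of_nonneg_left (ha R S) (norm_nonneg c)

lemma JetBound.summable {β : Type*} {δ : ℝ} {u : β → ℝ} (hu : Summable u) {c : β → Jet n}
    (hc : ∀ b, JetBound δ (u b) (c b)) (R S : MultiIndex n) : Summable fun b => c b R S :=
  Summable.of_norm_bounded (hu.mul_right _) fun b => hc b R S

lemma JetBound.tsum {β : Type*} {δ : ℝ} {u : β → ℝ} (hu : Summable u) {c : β → Jet n}
    (hc : ∀ b, JetBound δ (u b) (c b)) : JetBound δ (∑' b, u b) fun R S => ∑' b, c b R S :=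
  fun R S => by
    rw [← tsum_mul_right]
    exact tsum_of_norm_bounded (hu.mul_right _).hasSum fun b => hc b R S

end JetSpace

/-! ### The identification of `A_{p,ħ}` with slowly growing jets. -/

section AlgJets

variable {n : ℕ} {ħ : ℝ} {p : Fin n → ℂ}

/-- Combines the two comparison estimates. From here on the recursive seminorms enter only through
growth bounds, in which `ħ` no longer appears. -/
lemma mem_tildeA_iff (hħ : 0 < ħ) {f : Fn n} :
    f ∈ tildeA ħ p ↔ ContDiff ℝ ∞ f ∧ SlowGrowth (jet p f) := by
  constructor
  · rintro ⟨h1, h2⟩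
    refine ⟨h1, fun δ hδ => ?_⟩
    obtain ⟨i, C, -, h⟩ := exists_jetBound_eNorm ħ p hħ hδ
    exact ⟨_, h f (h2 i)⟩
  · rintro ⟨h1, h2⟩
    refine ⟨h1, fun i => ?_⟩
    obtain ⟨δ, hδ, C, -, h⟩ := eNorm_le ħ hħ p i
    obtain ⟨A, hA⟩ := h2 δ hδ
    exact (h f A hA).trans_lt ENNReal.ofReal_lt_top

/-- The jet at `p` of an element of `A_{p,ħ}`. -/
def algJet (ħ : ℝ) (p : Fin n → ℂ) : Alg ħ p →ₗ[ℂ] Jet n :=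
  (flat ħ p).liftQ
    { toFun := fun f => jet p (f : Fn n)
      map_add' := fun f g => jet_add p f.2.1 g.2.1
      map_smul' := fun c f => jet_smul p c f.2.1 }
    fun _ hf => funext fun R => funext fun S => hf R S

lemma algJet_cls (f : tildeA ħ p) : algJet ħ p (cls ħ p f) = jet p (f : Fn n) := rfl

lemma algJet_injective : Function.Injective (algJet ħ p) := by
  rw [injective_iff_map_eq_zero]
  intro F hF
  obtain ⟨f, rfl⟩ := cls_surjective ħ p F
  refine (Submodule.Quotient.mk_eq_zero (flat ħ p)).2 fun R S => ?_
  exact congrFun (congrFun hF R) S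

lemma slowGrowth_algJet (hħ : 0 < ħ) (F : Alg ħ p) : SlowGrowth (algJet ħ p F) := by
  obtain ⟨f, rfl⟩ := cls_surjective ħ p F
  exact ((mem_tildeA_iff hħ).1 f.2).2

lemma exists_algJet_eq (hħ : 0 < ħ) {a : Jet n} (ha : SlowGrowth a) :
    ∃ F : Alg ħ p, algJet ħ p F = a := by
  -- The exponent `1/2` is enough for convergence of the series; slow growth for all exponents is
  -- needed only for membership.
  obtain ⟨A, hA⟩ := ha (1 / 2) (by norm_num)
  have hj := jet_synth p hA.entireCoeff
  have hm : synth p a ∈ tildeA ħ p :=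
    (mem_tildeA_iff hħ).2 ⟨smooth_synth p hA.entireCoeff, by rwa [hj]⟩
  exact ⟨cls ħ p ⟨_, hm⟩, hj⟩

open Classical in
/-- The element of `A_{p,ħ}` with a given jet at `p` (and `0` if there is none). -/
def ofJet (ħ : ℝ) (p : Fin n → ℂ) (a : Jet n) : Alg ħ p :=
  if h : ∃ F : Alg ħ p, algJet ħ p F = a then h.choose else 0

lemma algJet_ofJet (hħ : 0 < ħ) {a : Jet n} (ha : SlowGrowth a) :
    algJet ħ p (ofJet ħ p a) = a := by
  have h := exists_algJet_eq (p := p) hħ ha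
  rw [ofJet, dif_pos h]
  exact h.choose_spec

lemma continuous_algSeminorm (i : Label n) : Continuous (algSeminorm ħ p i) :=
  (alg_withSeminorms ħ p).continuous_seminorm i

lemma algSeminorm_le (hħ : 0 < ħ) (i : Label n) : ∃ δ : ℝ, 0 < δ ∧ ∃ C : ℝ, 0 ≤ C ∧
    ∀ (F : Alg ħ p) (A : ℝ), JetBound δ A (algJet ħ p F) → algSeminorm ħ p i F ≤ C * A := by
  obtain ⟨δ, hδ, C, hC, h⟩ := eNorm_le ħ hħ p i
  refine ⟨δ, hδ, C, hC, fun F A hA => ?_⟩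
  obtain ⟨f, rfl⟩ := cls_surjective ħ p F
  exact ENNReal.toReal_le_of_le_ofReal (mul_nonneg hC hA.nonneg) (h _ A hA)

/-- Every continuous seminorm is controlled by a growth bound on jets. -/
lemma seminorm_le_of_continuous (hħ : 0 < ħ) (q : Seminorm ℂ (Alg ħ p)) (hq : Continuous q) :
    ∃ δ : ℝ, 0 < δ ∧ ∃ C : ℝ, 0 ≤ C ∧
      ∀ (F : Alg ħ p) (A : ℝ), JetBound δ A (algJet ħ p F) → q F ≤ C * A := by
  obtain ⟨s, C, -, hs⟩ := Seminorm.bound_of_continuous (alg_withSeminorms ħ p) q hq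
  have key : ∀ s : Finset (Label n), ∃ δ : ℝ, 0 < δ ∧ ∃ C : ℝ, 0 ≤ C ∧
      ∀ (F : Alg ħ p) (A : ℝ), JetBound δ A (algJet ħ p F) →
        s.sup (algFamily ħ p) F ≤ C * A := by
    intro s
    induction s using Finset.cons_induction with
    | empty => exact ⟨1, one_pos, 0, le_rfl, fun F A _ => by simp⟩
    | cons i s hi ih =>
      obtain ⟨δ, hδ, C, hC, h⟩ := ih
      obtain ⟨δ', hδ', C', hC', h'⟩ := algSeminorm_le (p := p) hħ i
      -- The bound with the smaller exponent is the stronger one and implies both.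
      refine ⟨min δ δ', lt_min hδ hδ', max C C', hC.trans (le_max_left _ _), fun F A hA => ?_⟩
      have hA0 := hA.nonneg
      rw [Finset.sup_cons, Seminorm.sup_apply]
      refine max_le ?_ ?_
      · exact (h' F A (hA.mono (min_le_right _ _) le_rfl)).trans
          (mul_le_mul_of_nonneg_right (le_max_right _ _) hA0)
      · exact (h F A (hA.mono (min_le_left _ _) le_rfl)).trans
          (mul_le_mul_of_nonneg_right (le_max_left _ _) hA0)
  obtain ⟨δ, hδ, D, hD, h⟩ := key s
  refine ⟨δ, hδ, C * D, by positivity, fun F A hA => (hs F).trans ?_⟩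
  rw [smul_apply, NNReal.smul_def, smul_eq_mul, mul_assoc]
  exact mul_le_mul_of_nonneg_left (h F A hA) C.2

/-- Growth bounds on jets are controlled by continuous seminorms. -/
lemma exists_continuous_seminorm (hħ : 0 < ħ) (p : Fin n → ℂ) {δ : ℝ} (hδ : 0 < δ) :
    ∃ r : Seminorm ℂ (Alg ħ p), Continuous r ∧ ∀ F, JetBound δ (r F) (algJet ħ p F) := by
  obtain ⟨i, C, hC, h⟩ := exists_jetBound_eNorm ħ p hħ hδ
  refine ⟨C.toNNReal • algSeminorm ħ p i, ?_, fun F => ?_⟩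
  · exact (continuous_algSeminorm i).const_smul C.toNNReal
  · obtain ⟨f, rfl⟩ := cls_surjective ħ p F
    have := h f (f.2.2 i)
    rwa [smul_apply, NNReal.smul_def, Real.coe_toNNReal _ hC, smul_eq_mul, algSeminorm_cls]

lemma tendsto_of_jetBound (hħ : 0 < ħ) {β : Type*} {l : Filter β} {u : β → Alg ħ p} {F : Alg ħ p}
    (h : ∀ δ : ℝ, 0 < δ → ∀ ε : ℝ, 0 < ε → ∀ᶠ b in l, JetBound δ ε (algJet ħ p (u b - F))) :
    Filter.Tendsto u l (𝓝 F) := by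
  rw [(alg_withSeminorms ħ p).tendsto_nhds]
  intro i ε hε
  obtain ⟨δ, hδ, C, hC, hi⟩ := algSeminorm_le (p := p) hħ i
  -- `C + 1` because `C` may be zero.
  filter_upwards [h δ hδ (ε / (C + 1)) (by positivity)] with b hb
  refine (hi _ _ hb).trans_lt ?_
  rw [mul_div_assoc', div_lt_iff₀ (by positivity)]
  linarith [mul_comm C ε]

/-- Absolutely convergent series in `A_{p,ħ}`, in terms of jets. -/
lemma hasSum_ofJet (hħ : 0 < ħ) {β : Type*} {u : β → ℝ} (hu : Summable u) {F : β → Alg ħ p}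
    (hF : ∀ δ : ℝ, 0 < δ → ∃ C : ℝ, ∀ b, JetBound δ (C * u b) (algJet ħ p (F b))) :
    SlowGrowth (fun R S => ∑' b, algJet ħ p (F b) R S) ∧
      HasSum F (ofJet ħ p fun R S => ∑' b, algJet ħ p (F b) R S) := by
  have hg : SlowGrowth (fun R S => ∑' b, algJet ħ p (F b) R S) := fun δ hδ => by
    obtain ⟨C, hC⟩ := hF δ hδ
    exact ⟨_, JetBound.tsum (hu.mul_left C) hC⟩
  refine ⟨hg, tendsto_of_jetBound hħ fun δ hδ ε hε => ?_⟩
  obtain ⟨C, hC⟩ := hF δ hδ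
  filter_upwards [(tendsto_tsum_compl_atTop_zero fun b => C * u b).eventually (gt_mem_nhds hε)]
    with s hs
  refine JetBound.mono ?_ le_rfl hs.le
  -- The error of a partial sum is minus the tail of the jets, which is bounded by the tail of `C *
  -- u`.
  have e : algJet ħ p (∑ b ∈ s, F b - ofJet ħ p fun R S => ∑' b, algJet ħ p (F b) R S) =
      fun R S => ∑' b : {b // b ∉ s}, -algJet ħ p (F b) R S := by
    funext R S
    rw [map_sub, algJet_ofJet hħ hg, map_sum, Pi.sub_apply, Pi.sub_apply, Finset.sum_apply,
      Finset.sum_apply, ← (JetBound.summable (hu.mul_left C) hC R S).sum_add_tsum_subtype_compl s,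
      tsum_neg]
    ring
  rw [e]
  refine JetBound.tsum (c := fun b : {b // b ∉ s} => fun R S => -algJet ħ p (F b) R S)
    ((hu.mul_left C).subtype _) fun b R S => ?_
  rw [norm_neg]
  exact hC b R S

lemma summable_seminorm (hħ : 0 < ħ) {β : Type*} {u : β → ℝ} (hu : Summable u) {F : β → Alg ħ p}
    (hF : ∀ δ : ℝ, 0 < δ → ∃ C : ℝ, ∀ b, JetBound δ (C * u b) (algJet ħ p (F b)))
    (q : Seminorm ℂ (Alg ħ p)) (hq : Continuous q) : Summable fun b => q (F b) := by
  obtain ⟨δ, hδ, D, -, h⟩ := seminorm_le_of_continuous hħ q hq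
  obtain ⟨C, hC⟩ := hF δ hδ
  exact Summable.of_nonneg_of_le (fun _ => apply_nonneg q _) (fun b => h _ _ (hC b))
    ((hu.mul_left C).mul_left D)

end AlgJets

/-! ### Metrizability and completeness. -/

section Frechet

variable {n : ℕ} {ħ : ℝ} {p : Fin n → ℂ}

lemma t1Space_alg (hħ : 0 < ħ) : T1Space (Alg ħ p) := by
  refine (alg_withSeminorms ħ p).T1_of_separating fun F hF => ?_
  by_contra! h
  apply hF
  apply algJet_injective
  rw [map_zero]
  obtain ⟨f, rfl⟩ := cls_surjective ħ p F
  obtain ⟨i, C, hC, hi⟩ := exists_jetBound_eNorm ħ p hħ one_pos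
  have h0 : (eNorm ħ p i (f : Fn n)).toReal = 0 := h i
  have := hi f (f.2.2 i)
  rw [h0, mul_zero] at this
  funext R S
  have h1 := this R S
  rw [zero_mul] at h1
  exact norm_le_zero_iff.1 h1

/-- Metrizable because there are only countably many labels and the seminorms separate points. For
completeness, the jets of a Cauchy sequence converge coefficientwise, the growth bounds pass to the
limit, and the limit jet is again realised in the space. -/
lemma isFrechetSpace_alg (hħ : 0 < ħ) (p : Fin n → ℂ) : IsFrechetSpace (Alg ħ p) := by
  have hw := alg_withSeminorms ħ p
  have : T1Space (Alg ħ p) := t1Space_alg hħ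
  have : FirstCountableTopology (Alg ħ p) := hw.firstCountableTopology
  let U : UniformSpace (Alg ħ p) := IsTopologicalAddGroup.rightUniformSpace (Alg ħ p)
  have : IsUniformAddGroup (Alg ħ p) := isUniformAddGroup_of_addCommGroup
  have hc : (uniformity (Alg ħ p)).IsCountablyGenerated :=
    IsUniformAddGroup.uniformity_countably_generated
  refine ⟨hw.continuousSMul, hw.toLocallyConvexSpace, ?_, ?_⟩
  · exact UniformSpace.metrizableSpace
  · refine UniformSpace.complete_of_cauchySeq_tendsto fun u hu => ?_
    have hu' : ∀ q : Seminorm ℂ (Alg ħ p), Continuous q → ∀ ε > 0, ∃ N, ∀ j ≥ N, ∀ k ≥ N,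
        q (u j - u k) < ε := fun q hq ε hε => by
      have hV : {x : Alg ħ p | q x < ε} ∈ 𝓝 (0 : Alg ħ p) :=
        (isOpen_lt hq continuous_const).mem_nhds (by simpa using hε)
      have hV' : {x : Alg ħ p × Alg ħ p | q (x.2 - x.1) < ε} ∈ uniformity (Alg ħ p) := by
        rw [uniformity_eq_comap_nhds_zero]
        exact ⟨_, hV, fun _ h => h⟩
      obtain ⟨N, hN⟩ := hu.mem_entourage hV'
      exact ⟨N, fun j hj k hk => hN k j hk hj⟩
    have hbd : ∀ δ : ℝ, 0 < δ → ∀ ε : ℝ, 0 < ε → ∃ N, ∀ j ≥ N, ∀ k ≥ N,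
        JetBound δ ε (algJet ħ p (u j) - algJet ħ p (u k)) := fun δ hδ ε hε => by
      obtain ⟨r, hr, h⟩ := exists_continuous_seminorm hħ p hδ
      obtain ⟨N, hN⟩ := hu' r hr ε hε
      refine ⟨N, fun j hj k hk => ?_⟩
      rw [← map_sub]
      exact (h _).mono le_rfl (hN j hj k hk).le
    have hlim : ∀ R S, ∃ c, Filter.Tendsto (fun j => algJet ħ p (u j) R S) Filter.atTop (𝓝 c) := by
      intro R S
      refine cauchySeq_tendsto_of_complete (Metric.cauchySeq_iff.2 fun ε hε => ?_)
      have hW : 0 < (mfact R : ℝ) ^ (1 : ℝ) * (mfact S : ℝ) ^ (1 : ℝ) := by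
        have := mfact_pos R
        have := mfact_pos S
        positivity
      obtain ⟨N, hN⟩ := hbd 1 one_pos (ε / 2 / ((mfact R : ℝ) ^ (1 : ℝ) * (mfact S : ℝ) ^ (1 : ℝ)))
        (by positivity)
      refine ⟨N, fun j hj k hk => ?_⟩
      have := hN j hj k hk R S
      rw [div_mul_cancel₀ _ hW.ne'] at this
      rw [dist_eq_norm]
      exact this.trans_lt (half_lt_self hε)
    choose a ha using hlim
    -- Let `k → ∞` in the Cauchy estimate, coefficient by coefficient.
    have hbd' : ∀ δ : ℝ, 0 < δ → ∀ ε : ℝ, 0 < ε → ∃ N, ∀ j ≥ N,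
        JetBound δ ε (algJet ħ p (u j) - a) := fun δ hδ ε hε => by
      obtain ⟨N, hN⟩ := hbd δ hδ ε hε
      refine ⟨N, fun j hj R S => ?_⟩
      refine le_of_tendsto ((tendsto_const_nhds.sub (ha R S)).norm)
        (Filter.eventually_atTop.2 ⟨N, fun k hk => hN j hj k hk R S⟩)
    have hg : SlowGrowth a := fun δ hδ => by
      obtain ⟨N, hN⟩ := hbd' δ hδ 1 one_pos
      obtain ⟨A, hA⟩ := slowGrowth_algJet hħ (u N) δ hδ
      -- From `a = u_N - (u_N - a)` on the level of jets.
      refine ⟨A + ‖(-1 : ℂ)‖ * 1, ?_⟩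
      have := hA.add ((hN N le_rfl).smul (-1))
      simpa using this
    refine ⟨ofJet ħ p a, tendsto_of_jetBound hħ fun δ hδ ε hε => ?_⟩
    obtain ⟨N, hN⟩ := hbd' δ hδ ε hε
    refine Filter.eventually_atTop.2 ⟨N, fun j hj => ?_⟩
    rw [map_sub, algJet_ofJet hħ hg]
    exact hN j hj

end Frechet


/-! ### The star product on jets. -/

section WickJets

variable {n : ℕ}

/-- The jet of the `N`-th term of the star product of functions with jets `a` and `b`. -/
def wickJet (α : ℂ) (N : MultiIndex n) (a b : Jet n) : Jet n :=
  ((2 * α) ^ N.deg / (N.fact : ℂ)) • conv (fun R S => a (R + N) S) (fun R S => b R (S + N))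

/-- The jet of the star product of functions with jets `a` and `b`. -/
def starJet (α : ℂ) (a b : Jet n) : Jet n := fun R S => ∑' N, wickJet α N a b R S

lemma jet_wickTerm (p : Fin n → ℂ) (α : ℂ) {f g : Fn n} (hf : ContDiff ℝ ∞ f)
    (hg : ContDiff ℝ ∞ g) (N : MultiIndex n) :
    ContDiff ℝ ∞ (wickTerm α f g N) ∧
      jet p (wickTerm α f g N) = wickJet α N (jet p f) (jet p g) := by
  have h1 := smooth_dzM N hf
  have h2 := smooth_dzbarM N hg
  have e : wickTerm α f g N = ((2 * α) ^ N.deg / (N.fact : ℂ)) • (dzM N f * dzbarM N g) := rfl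
  rw [e]
  refine ⟨contDiff_const.smul (smooth_mul h1 h2), ?_⟩
  rw [jet_smul p _ (smooth_mul h1 h2), jet_mul p h1 h2, wickJet]
  congr 2
  · funext R S; rw [jet, wirt_dzM N R S hf]; rfl
  · funext R S; rw [jet, wirt_dzbarM N R S hg]; rfl

lemma conv_add_left (a a' b : Jet n) : conv (a + a') b = conv a b + conv a' b := by
  funext R S
  simp only [conv, Pi.add_apply, ← Finset.sum_add_distrib]
  exact Finset.sum_congr rfl fun I _ => Finset.sum_congr rfl fun J _ => by ring

lemma conv_add_right (a b b' : Jet n) : conv a (b + b') = conv a b + conv a b' := by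
  funext R S
  simp only [conv, Pi.add_apply, ← Finset.sum_add_distrib]
  exact Finset.sum_congr rfl fun I _ => Finset.sum_congr rfl fun J _ => by ring

lemma conv_smul_left (c : ℂ) (a b : Jet n) : conv (c • a) b = c • conv a b := by
  funext R S
  simp only [conv, Pi.smul_apply, smul_eq_mul, Finset.mul_sum]
  exact Finset.sum_congr rfl fun I _ => Finset.sum_congr rfl fun J _ => by ring

lemma conv_smul_right (c : ℂ) (a b : Jet n) : conv a (c • b) = c • conv a b := by
  funext R S
  simp only [conv, Pi.smul_apply, smul_eq_mul, Finset.mul_sum]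
  exact Finset.sum_congr rfl fun I _ => Finset.sum_congr rfl fun J _ => by ring

lemma wickJet_add_left (α : ℂ) (N : MultiIndex n) (a a' b : Jet n) :
    wickJet α N (a + a') b = wickJet α N a b + wickJet α N a' b := by
  simp only [wickJet, ← smul_add, ← conv_add_left]
  rfl

lemma wickJet_add_right (α : ℂ) (N : MultiIndex n) (a b b' : Jet n) :
    wickJet α N a (b + b') = wickJet α N a b + wickJet α N a b' := by
  simp only [wickJet, ← smul_add, ← conv_add_right]
  rfl

lemma wickJet_smul_left (α : ℂ) (N : MultiIndex n) (c : ℂ) (a b : Jet n) :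
    wickJet α N (c • a) b = c • wickJet α N a b := by
  simp only [wickJet]
  rw [smul_comm c, ← conv_smul_left c]
  rfl

lemma wickJet_smul_right (α : ℂ) (N : MultiIndex n) (c : ℂ) (a b : Jet n) :
    wickJet α N a (c • b) = c • wickJet α N a b := by
  simp only [wickJet]
  rw [smul_comm c, ← conv_smul_right c]
  rfl

/-- Every Leibniz term has the same bound `M`, obtained by splitting `(I+N)!` and `(S-J+N)!`. The
binomial sums contribute a second `2^(|R|+|S|)`, which turns the base `2` into `4`. -/
lemma norm_conv_shift_le {δ A B : ℝ} (hδ : 0 ≤ δ) (hδ1 : δ ≤ 1) {a b : Jet n}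
    (ha : JetBound δ A a) (hb : JetBound δ B b) (N R S : MultiIndex n) :
    ‖conv (fun R S => a (R + N) S) (fun R S => b R (S + N)) R S‖ ≤
      A * B * (4 ^ mdeg R * 4 ^ mdeg S * 4 ^ mdeg N) *
        ((mfact R : ℝ) ^ δ * (mfact S : ℝ) ^ δ * (mfact N : ℝ) ^ δ) ^ 2 := by
  have hA := ha.nonneg
  have hB := hb.nonneg
  set r := (mfact R : ℝ) ^ δ
  set s := (mfact S : ℝ) ^ δ
  set t := (mfact N : ℝ) ^ δ
  set M : ℝ := A * B * (2 ^ mdeg R * 2 ^ mdeg S * 4 ^ mdeg N) * (r * s * t) ^ 2 with hM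
  have mono2 : ∀ {T U : MultiIndex n}, T ≤ U → (2 : ℝ) ^ mdeg T ≤ 2 ^ mdeg U := fun h =>
    pow_le_pow_right₀ (by norm_num) (Finset.sum_le_sum fun k _ => h k)
  have term : ∀ I ≤ R, ∀ J ≤ S, ‖a (I + N) J * b (R - I) (S - J + N)‖ ≤ M := by
    intro I hI J hJ
    have h1 : (mfact (I + N) : ℝ) ^ δ ≤ 2 ^ mdeg R * 2 ^ mdeg N * (r * t) := by
      refine (rpow_mfact_add_le I N hδ hδ1).trans ?_
      gcongr ?_ * _ * (?_ * _)
      · exact mono2 hI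
      · exact rpow_mfact_mono hI hδ
    have h2 : (mfact (S - J + N) : ℝ) ^ δ ≤ 2 ^ mdeg S * 2 ^ mdeg N * (s * t) := by
      refine (rpow_mfact_add_le (S - J) N hδ hδ1).trans ?_
      gcongr ?_ * _ * (?_ * _)
      · exact mono2 tsub_le_self
      · exact rpow_mfact_mono tsub_le_self hδ
    have h3 : (mfact J : ℝ) ^ δ ≤ s := rpow_mfact_mono hJ hδ
    have h4 : (mfact (R - I) : ℝ) ^ δ ≤ r := rpow_mfact_mono tsub_le_self hδ
    have e4 : (4 : ℝ) ^ mdeg N = 2 ^ mdeg N * 2 ^ mdeg N := by rw [← mul_pow]; norm_num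
    rw [norm_mul]
    calc ‖a (I + N) J‖ * ‖b (R - I) (S - J + N)‖
        ≤ (A * ((mfact (I + N) : ℝ) ^ δ * (mfact J : ℝ) ^ δ)) *
          (B * ((mfact (R - I) : ℝ) ^ δ * (mfact (S - J + N) : ℝ) ^ δ)) :=
          mul_le_mul (ha _ _) (hb _ _) (norm_nonneg _) (by positivity)
      _ ≤ (A * ((2 ^ mdeg R * 2 ^ mdeg N * (r * t)) * s)) *
          (B * (r * (2 ^ mdeg S * 2 ^ mdeg N * (s * t)))) := by gcongr
      _ = M := by rw [hM, e4]; ring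
  have hM0 : 0 ≤ M := by positivity
  calc ‖conv (fun R S => a (R + N) S) (fun R S => b R (S + N)) R S‖
      ≤ ∑ I ∈ Finset.Iic R, ∑ J ∈ Finset.Iic S, (R.binom I : ℝ) * ((S.binom J : ℝ) * M) := by
        unfold conv
        refine (norm_sum_le _ _).trans (Finset.sum_le_sum fun I hI => ?_)
        refine (norm_sum_le _ _).trans (Finset.sum_le_sum fun J hJ => ?_)
        rw [norm_mul, norm_mul, Complex.norm_natCast, Complex.norm_natCast]
        gcongr
        exact term I (Finset.mem_Iic.1 hI) J (Finset.mem_Iic.1 hJ)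
    _ = ((∑ I ∈ Finset.Iic R, R.binom I : ℕ) : ℝ) * (((∑ J ∈ Finset.Iic S, S.binom J : ℕ) : ℝ) * M)
        := by simp only [← Finset.mul_sum, ← Finset.sum_mul, Nat.cast_sum]
    _ = 2 ^ mdeg R * (2 ^ mdeg S * M) := by
        rw [sum_binom, sum_binom]
        simp [MultiIndex.deg, mdeg]
    _ = _ := by
        have e4 : ∀ T : MultiIndex n, (4 : ℝ) ^ mdeg T = 2 ^ mdeg T * 2 ^ mdeg T := fun T => by
          rw [← mul_pow]; norm_num
        rw [hM, e4 R, e4 S]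
        ring

/-- The central estimate: bilinear in the bounds, geometrically decaying in `N` and uniform for `‖α‖
≤ ρ`. The factor `1/N!` outweighs all that depends on `N`, and the exponentials in `R` and `S` cost
a small increase of the exponent. -/
lemma exists_wickJet_bound (n : ℕ) {η : ℝ} (hη : 0 < η) {ρ : ℝ} (hρ : 0 ≤ ρ) :
    ∃ δ : ℝ, 0 < δ ∧ ∃ C : ℝ, 0 ≤ C ∧ ∀ (α : ℂ), ‖α‖ ≤ ρ → ∀ (a b : Jet n) (A B : ℝ),
      JetBound δ A a → JetBound δ B b → ∀ N : MultiIndex n,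
        JetBound η (C * A * B * (1 / 2) ^ mdeg N) (wickJet α N a b) := by
  set δ := min η 1 / 8 with hδ
  have hδ0 : 0 < δ := by positivity
  have hδη : δ + δ + δ ≤ η := by have := min_le_left η 1; linarith
  have hδ1 : δ + δ + δ ≤ 1 := by have := min_le_right η 1; linarith
  obtain ⟨C, hC, h⟩ := pow_mdeg_le (κ := Fin n) 4 (by positivity) hδ0
  -- `8ρ` is `2ρ` from the coefficient of the series times `4` from the convolution.
  obtain ⟨D, hD, h'⟩ := pow_mdeg_le_half (κ := Fin n) (8 * ρ) (by positivity) hδ0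
  refine ⟨δ, hδ0, C * C * D, by positivity, fun α hα a b A B ha hb N R S => ?_⟩
  have hA := ha.nonneg
  have hB := hb.nonneg
  have e3 : ∀ T : MultiIndex n, (mfact T : ℝ) ^ δ * ((mfact T : ℝ) ^ δ) ^ 2 =
      (mfact T : ℝ) ^ (δ + δ + δ) := fun T => by
    have : (0 : ℝ) < mfact T := by exact_mod_cast mfact_pos T
    rw [Real.rpow_add this, Real.rpow_add this]
    ring
  have hN0 : (0 : ℝ) < mfact N := by exact_mod_cast mfact_pos N
  rw [wickJet, Pi.smul_apply, Pi.smul_apply, norm_smul]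
  have hc : ‖(2 * α) ^ MultiIndex.deg N / (MultiIndex.fact N : ℂ)‖ ≤ (2 * ρ) ^ mdeg N / mfact N := by
    rw [norm_div, norm_pow, norm_mul, Complex.norm_natCast, Complex.norm_ofNat]
    change (2 * ‖α‖) ^ mdeg N / (mfact N : ℝ) ≤ _
    gcongr
  calc ‖(2 * α) ^ MultiIndex.deg N / (MultiIndex.fact N : ℂ)‖ *
        ‖conv (fun R S => a (R + N) S) (fun R S => b R (S + N)) R S‖
      ≤ ((2 * ρ) ^ mdeg N / mfact N) * (A * B * (4 ^ mdeg R * 4 ^ mdeg S * 4 ^ mdeg N) *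
        ((mfact R : ℝ) ^ δ * (mfact S : ℝ) ^ δ * (mfact N : ℝ) ^ δ) ^ 2) :=
        mul_le_mul hc (norm_conv_shift_le hδ0.le (by linarith) ha hb N R S) (norm_nonneg _)
          (by positivity)
    _ = A * B * (4 ^ mdeg R * ((mfact R : ℝ) ^ δ) ^ 2) * (4 ^ mdeg S * ((mfact S : ℝ) ^ δ) ^ 2) *
        ((8 * ρ) ^ mdeg N * ((mfact N : ℝ) ^ δ) ^ 2 / mfact N) := by
        rw [show 8 * ρ = 4 * (2 * ρ) by ring, mul_pow 4 (2 * ρ)]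
        ring
    _ ≤ A * B * (C * (mfact R : ℝ) ^ δ * ((mfact R : ℝ) ^ δ) ^ 2) *
        (C * (mfact S : ℝ) ^ δ * ((mfact S : ℝ) ^ δ) ^ 2) *
        (D * (1 / 2) ^ mdeg N * (mfact N : ℝ) ^ δ * ((mfact N : ℝ) ^ δ) ^ 2 / mfact N) := by
        gcongr
        · exact h R
        · exact h S
        · exact h' N
    _ = C * C * D * A * B * (1 / 2) ^ mdeg N *
        ((mfact R : ℝ) ^ (δ + δ + δ) * (mfact S : ℝ) ^ (δ + δ + δ)) *
        ((mfact N : ℝ) ^ (δ + δ + δ) / mfact N) := by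
        rw [← e3, ← e3, ← e3]; ring
    _ ≤ C * C * D * A * B * (1 / 2) ^ mdeg N * ((mfact R : ℝ) ^ η * (mfact S : ℝ) ^ η) * 1 := by
        gcongr
        · exact one_le_mfact R
        · exact one_le_mfact S
        · rw [div_le_one hN0]
          exact (rpow_mfact_le_exponent N hδ1).trans_eq (Real.rpow_one _)
    _ = _ := mul_one _

lemma wickJet_bound (α : ℂ) {a b : Jet n} (ha : SlowGrowth a) (hb : SlowGrowth b) {η : ℝ}
    (hη : 0 < η) : ∃ C : ℝ, ∀ N, JetBound η (C * (1 / 2) ^ mdeg N) (wickJet α N a b) := by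
  obtain ⟨δ, hδ, C, -, h⟩ := exists_wickJet_bound n hη (norm_nonneg α)
  obtain ⟨A, hA⟩ := ha δ hδ
  obtain ⟨B, hB⟩ := hb δ hδ
  exact ⟨C * A * B, h α le_rfl a b A B hA hB⟩

lemma summable_wickJet (α : ℂ) {a b : Jet n} (ha : SlowGrowth a) (hb : SlowGrowth b)
    (R S : MultiIndex n) : Summable fun N => wickJet α N a b R S := by
  obtain ⟨C, hC⟩ := wickJet_bound α ha hb one_pos
  exact JetBound.summable (summable_half_pow_mdeg.mul_left C) hC R S

lemma slowGrowth_wickJet (α : ℂ) {a b : Jet n} (ha : SlowGrowth a) (hb : SlowGrowth b)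
    (N : MultiIndex n) : SlowGrowth (wickJet α N a b) := fun η hη => by
  obtain ⟨C, hC⟩ := wickJet_bound α ha hb hη
  exact ⟨_, hC N⟩

lemma slowGrowth_starJet (α : ℂ) {a b : Jet n} (ha : SlowGrowth a) (hb : SlowGrowth b) :
    SlowGrowth (starJet α a b) := fun η hη => by
  obtain ⟨C, hC⟩ := wickJet_bound α ha hb hη
  exact ⟨_, JetBound.tsum (summable_half_pow_mdeg.mul_left C) hC⟩

lemma starJet_add_left (α : ℂ) {a a' b : Jet n} (ha : SlowGrowth a) (ha' : SlowGrowth a')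
    (hb : SlowGrowth b) : starJet α (a + a') b = starJet α a b + starJet α a' b := by
  funext R S
  simp only [starJet, wickJet_add_left, Pi.add_apply]
  exact (summable_wickJet α ha hb R S).tsum_add (summable_wickJet α ha' hb R S)

lemma starJet_add_right (α : ℂ) {a b b' : Jet n} (ha : SlowGrowth a) (hb : SlowGrowth b)
    (hb' : SlowGrowth b') : starJet α a (b + b') = starJet α a b + starJet α a b' := by
  funext R S
  simp only [starJet, wickJet_add_right, Pi.add_apply]
  exact (summable_wickJet α ha hb R S).tsum_add (summable_wickJet α ha hb' R S)

lemma starJet_smul_left (α c : ℂ) (a b : Jet n) : starJet α (c • a) b = c • starJet α a b := by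
  funext R S
  simp only [starJet, wickJet_smul_left, Pi.smul_apply, smul_eq_mul, tsum_mul_left]

lemma starJet_smul_right (α c : ℂ) (a b : Jet n) : starJet α a (c • b) = c • starJet α a b := by
  funext R S
  simp only [starJet, wickJet_smul_right, Pi.smul_apply, smul_eq_mul, tsum_mul_left]

end WickJets

/-! ### The star product on `A_{p,ħ}` and its continuity. -/

section WickProduct

variable {n : ℕ} {ħ : ℝ} (hħ : 0 < ħ) (p : Fin n → ℂ)

/-- The Wick star product `⋆_α` on `A_{p,ħ}`. -/
def wick (α : ℂ) : Alg ħ p →ₗ[ℂ] Alg ħ p →ₗ[ℂ] Alg ħ p :=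
  have key : ∀ F G : Alg ħ p, algJet ħ p (ofJet ħ p (starJet α (algJet ħ p F) (algJet ħ p G))) =
      starJet α (algJet ħ p F) (algJet ħ p G) := fun F G =>
    algJet_ofJet hħ (slowGrowth_starJet α (slowGrowth_algJet hħ F) (slowGrowth_algJet hħ G))
  LinearMap.mk₂ ℂ (fun F G => ofJet ħ p (starJet α (algJet ħ p F) (algJet ħ p G)))
    (fun F F' G => algJet_injective <| by
      rw [key (F + F') G, map_add, map_add, key, key, starJet_add_left α (slowGrowth_algJet hħ F)
        (slowGrowth_algJet hħ F') (slowGrowth_algJet hħ G)])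
    (fun c F G => algJet_injective <| by
      rw [key (c • F) G, map_smul, map_smul, key, starJet_smul_left])
    (fun F G G' => algJet_injective <| by
      rw [key F (G + G'), map_add, map_add, key, key, starJet_add_right α (slowGrowth_algJet hħ F)
        (slowGrowth_algJet hħ G) (slowGrowth_algJet hħ G')])
    (fun c F G => algJet_injective <| by
      rw [key F (c • G), map_smul, map_smul, key, starJet_smul_right])

lemma algJet_wick (α : ℂ) (F G : Alg ħ p) :
    algJet ħ p (wick hħ p α F G) = starJet α (algJet ħ p F) (algJet ħ p G) :=
  algJet_ofJet hħ (slowGrowth_starJet α (slowGrowth_algJet hħ F) (slowGrowth_algJet hħ G))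

lemma isWickProduct_wick (α : ℂ) : IsWickProduct ħ p α (wick hħ p α) := by
  intro f g
  have hf := (mem_tildeA_iff hħ).1 f.2
  have hg := (mem_tildeA_iff hħ).1 g.2
  have hmem : ∀ N, wickTerm α (f : Fn n) (g : Fn n) N ∈ tildeA ħ p := fun N => by
    obtain ⟨h1, h2⟩ := jet_wickTerm p α hf.1 hg.1 N
    exact (mem_tildeA_iff hħ).2 ⟨h1, h2 ▸ slowGrowth_wickJet α hf.2 hg.2 N⟩
  have hjet : ∀ N, algJet ħ p (cls ħ p ⟨_, hmem N⟩) =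
      wickJet α N (jet p (f : Fn n)) (jet p (g : Fn n)) := fun N =>
    (jet_wickTerm p α hf.1 hg.1 N).2
  have hbd : ∀ δ : ℝ, 0 < δ → ∃ C : ℝ, ∀ N, JetBound δ (C * (1 / 2) ^ mdeg N)
      (algJet ħ p (cls ħ p ⟨_, hmem N⟩)) := fun δ hδ => by
    simpa only [hjet] using wickJet_bound α hf.2 hg.2 hδ
  refine ⟨hmem, summable_seminorm hħ summable_half_pow_mdeg hbd, ?_⟩
  have := (hasSum_ofJet hħ summable_half_pow_mdeg hbd).2
  simp only [hjet] at this
  exact this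

/-- The star products are bounded locally uniformly in the parameter. -/
lemma wick_bound {ρ : ℝ} (hρ : 0 ≤ ρ) (q : Seminorm ℂ (Alg ħ p)) (hq : Continuous q) :
    ∃ r : Seminorm ℂ (Alg ħ p), Continuous r ∧ ∀ α : ℂ, ‖α‖ ≤ ρ → ∀ F G : Alg ħ p,
      q (wick hħ p α F G) ≤ r F * r G := by
  obtain ⟨η, hη, D, hD, h⟩ := seminorm_le_of_continuous hħ q hq
  obtain ⟨δ, hδ, C, hC, h'⟩ := exists_wickJet_bound n hη hρ
  obtain ⟨r, hr, h''⟩ := exists_continuous_seminorm hħ p hδ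
  set E : ℝ := D * (C * geomConst n) with hE
  have hE0 : 0 ≤ E := mul_nonneg hD (mul_nonneg hC (geomConst_nonneg n))
  -- The constant is divided evenly between the two factors, so that one seminorm serves both.
  refine ⟨(√E).toNNReal • r, hr.const_smul (√E).toNNReal, fun α hα F G => ?_⟩
  have hb := JetBound.tsum (summable_half_pow_mdeg.mul_left (C * r F * r G))
    (h' α hα _ _ _ _ (h'' F) (h'' G))
  have hq := h (wick hħ p α F G) _ (by rw [algJet_wick]; exact hb)
  rw [tsum_mul_left] at hq
  simp only [smul_apply, NNReal.smul_def, smul_eq_mul, Real.coe_toNNReal _ (Real.sqrt_nonneg E)]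
  refine hq.trans_eq ?_
  calc D * (C * r F * r G * geomConst n) = E * (r F * r G) := by rw [hE]; ring
    _ = (√E * √E) * (r F * r G) := by rw [Real.mul_self_sqrt hE0]
    _ = _ := by ring

lemma continuous_wick (α : ℂ) : Continuous fun x : Alg ħ p × Alg ħ p => wick hħ p α x.1 x.2 := by
  rw [continuous_iff_continuousAt]
  rintro ⟨F₀, G₀⟩
  refine ((alg_withSeminorms ħ p).tendsto_nhds _ _).2 fun i ε hε => ?_
  obtain ⟨r, hr, h⟩ := wick_bound hħ p (norm_nonneg α) (algSeminorm ħ p i) (continuous_algSeminorm i)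
  have hlim : Filter.Tendsto (fun x : Alg ħ p × Alg ħ p =>
      r (x.1 - F₀) * r x.2 + r F₀ * r (x.2 - G₀)) (𝓝 (F₀, G₀)) (𝓝 0) := by
    have hc : Continuous fun x : Alg ħ p × Alg ħ p =>
        r (x.1 - F₀) * r x.2 + r F₀ * r (x.2 - G₀) :=
      ((hr.comp (continuous_fst.sub continuous_const)).mul (hr.comp continuous_snd)).add
        (continuous_const.mul (hr.comp (continuous_snd.sub continuous_const)))
    simpa using hc.tendsto (F₀, G₀)
  filter_upwards [hlim.eventually (gt_mem_nhds hε)] with x hx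
  have e : wick hħ p α x.1 x.2 - wick hħ p α F₀ G₀ =
      wick hħ p α (x.1 - F₀) x.2 + wick hħ p α F₀ (x.2 - G₀) := by
    simp only [map_sub, LinearMap.sub_apply]
    abel
  rw [e]
  exact ((map_add_le_add (algSeminorm ħ p i) _ _).trans
    (add_le_add (h α le_rfl _ _) (h α le_rfl _ _))).trans_lt hx

end WickProduct


/-! ### Associativity: shifts as derivations and the triple sum. -/

section Associativity

variable {n : ℕ}

lemma mdeg_single (k : Fin n) : mdeg (Pi.single k 1 : MultiIndex n) = 1 := by simp [mdeg]

lemma mfact_single (k : Fin n) : mfact (Pi.single k 1 : MultiIndex n) = 1 := by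
  refine Finset.prod_eq_one fun j _ => ?_
  by_cases hj : j = k
  · subst hj; simp
  · simp [hj]

/-- Makes slow growth stable under shifts: one more derivative costs an exponential factor, absorbed
by enlarging the exponent. -/
lemma exists_rpow_mfact_add_single_le {η : ℝ} (hη : 0 < η) :
    ∃ δ : ℝ, 0 < δ ∧ δ ≤ η ∧ ∃ C : ℝ, 0 < C ∧ ∀ (k : Fin n) (R : MultiIndex n),
      (mfact (R + Pi.single k 1) : ℝ) ^ δ ≤ C * (mfact R : ℝ) ^ η := by
  set δ := min η 1 / 2 with hδ
  have hδ0 : 0 < δ := by positivity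
  have hδη : δ + δ ≤ η := by have := min_le_left η 1; linarith
  have hδ1 : δ + δ ≤ 1 := by have := min_le_right η 1; linarith
  obtain ⟨C, hC, h⟩ := pow_mdeg_le (κ := Fin n) 2 (by positivity) hδ0
  refine ⟨δ, hδ0, by linarith, C * 2, by positivity, fun k R => ?_⟩
  refine (rpow_mfact_add_le R _ hδ0.le (by linarith)).trans ?_
  rw [mdeg_single, mfact_single, Nat.cast_one, Real.one_rpow, pow_one, mul_one]
  calc (2 : ℝ) ^ mdeg R * 2 * (mfact R : ℝ) ^ δ ≤ (C * (mfact R : ℝ) ^ δ) * 2 * (mfact R : ℝ) ^ δ := by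
        gcongr
        exact h R
    _ = C * 2 * (mfact R : ℝ) ^ (δ + δ) := by
        rw [Real.rpow_add (by exact_mod_cast mfact_pos R)]; ring
    _ ≤ _ := by
        gcongr
        exact one_le_mfact R

lemma SlowGrowth.shiftL {a : Jet n} (ha : SlowGrowth a) (k : Fin n) : SlowGrowth (shiftL k a) := by
  intro η hη
  obtain ⟨δ, hδ, hδη, C, hC, h⟩ := exists_rpow_mfact_add_single_le (n := n) hη
  obtain ⟨A, hA⟩ := ha δ hδ
  have hA0 := hA.nonneg
  refine ⟨A * C, fun R S => (hA _ _).trans ?_⟩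
  calc A * ((mfact (R + Pi.single k 1) : ℝ) ^ δ * (mfact S : ℝ) ^ δ)
      ≤ A * ((C * (mfact R : ℝ) ^ η) * (mfact S : ℝ) ^ η) := by
        gcongr
        · exact h k R
        · exact one_le_mfact S
    _ = _ := by ring

lemma SlowGrowth.shiftR {a : Jet n} (ha : SlowGrowth a) (k : Fin n) : SlowGrowth (shiftR k a) := by
  intro η hη
  obtain ⟨δ, hδ, hδη, C, hC, h⟩ := exists_rpow_mfact_add_single_le (n := n) hη
  obtain ⟨A, hA⟩ := ha δ hδ
  have hA0 := hA.nonneg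
  refine ⟨A * C, fun R S => (hA _ _).trans ?_⟩
  calc A * ((mfact R : ℝ) ^ δ * (mfact (S + Pi.single k 1) : ℝ) ^ δ)
      ≤ A * ((mfact R : ℝ) ^ η * (C * (mfact S : ℝ) ^ η)) := by
        gcongr
        · exact one_le_mfact R
        · exact h k S
    _ = _ := by ring

lemma shiftL_wickJet (α : ℂ) (N : MultiIndex n) (k : Fin n) (a b : Jet n) :
    shiftL k (wickJet α N a b) = wickJet α N (shiftL k a) b + wickJet α N a (shiftL k b) := by
  have h := shiftL_conv k (fun R S => a (R + N) S) (fun R S => b R (S + N))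
  have e : shiftL k (fun R S => a (R + N) S) = fun R S => shiftL k a (R + N) S := by
    funext R S
    simp only [shiftL, add_right_comm]
  rw [e] at h
  simp only [wickJet, ← smul_add]
  exact congrArg (((2 * α) ^ N.deg / (N.fact : ℂ)) • ·) h

lemma shiftR_wickJet (α : ℂ) (N : MultiIndex n) (k : Fin n) (a b : Jet n) :
    shiftR k (wickJet α N a b) = wickJet α N (shiftR k a) b + wickJet α N a (shiftR k b) := by
  have h := shiftR_conv k (fun R S => a (R + N) S) (fun R S => b R (S + N))
  have e : shiftR k (fun R S => b R (S + N)) = fun R S => shiftR k b R (S + N) := by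
    funext R S
    simp only [shiftR, add_right_comm]
  rw [e] at h
  simp only [wickJet, ← smul_add]
  exact congrArg (((2 * α) ^ N.deg / (N.fact : ℂ)) • ·) h

/-- The star product has constant coefficients, so derivatives act on it as derivations. This is
what lets associativity be tested at the constant coefficient. -/
lemma shiftL_starJet (α : ℂ) (k : Fin n) {a b : Jet n} (ha : SlowGrowth a) (hb : SlowGrowth b) :
    shiftL k (starJet α a b) = starJet α (shiftL k a) b + starJet α a (shiftL k b) := by
  funext R S
  have h : ∀ N, wickJet α N a b (R + Pi.single k 1) S =
      wickJet α N (shiftL k a) b R S + wickJet α N a (shiftL k b) R S := fun N =>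
    congrFun (congrFun (shiftL_wickJet α N k a b) R) S
  simp only [shiftL, starJet, Pi.add_apply, h]
  exact (summable_wickJet α (ha.shiftL k) hb R S).tsum_add (summable_wickJet α ha (hb.shiftL k) R S)

lemma shiftR_starJet (α : ℂ) (k : Fin n) {a b : Jet n} (ha : SlowGrowth a) (hb : SlowGrowth b) :
    shiftR k (starJet α a b) = starJet α (shiftR k a) b + starJet α a (shiftR k b) := by
  funext R S
  have h : ∀ N, wickJet α N a b R (S + Pi.single k 1) =
      wickJet α N (shiftR k a) b R S + wickJet α N a (shiftR k b) R S := fun N =>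
    congrFun (congrFun (shiftR_wickJet α N k a b) R) S
  simp only [shiftR, starJet, Pi.add_apply, h]
  exact (summable_wickJet α (ha.shiftR k) hb R S).tsum_add (summable_wickJet α ha (hb.shiftR k) R S)

/-- The coefficient `(2α)^{|N|} / N!` of the star product. -/
def wickCoeff (α : ℂ) (N : MultiIndex n) : ℂ := (2 * α) ^ N.deg / (N.fact : ℂ)

/-- The multiplicativity of exponential-series coefficients: it decouples the two parts of `M` in
the nested sums. -/
lemma wickCoeff_mul_binom (α : ℂ) {M I : MultiIndex n} (h : I ≤ M) :
    wickCoeff α M * (M.binom I : ℂ) = wickCoeff α I * wickCoeff α (M - I) := by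
  obtain ⟨K, rfl⟩ := exists_add_of_le h
  rw [add_tsub_cancel_left]
  have h1 : ((I + K : MultiIndex n).binom I * I.fact * K.fact : ℕ) = (I + K : MultiIndex n).fact := by
    simp only [MultiIndex.binom, MultiIndex.fact, ← Finset.prod_mul_distrib, Pi.add_apply]
    exact Finset.prod_congr rfl fun k _ => by
      rw [Nat.choose_symm_add, Nat.add_choose_mul_factorial_mul_factorial]
  have h2 : (I + K : MultiIndex n).deg = I.deg + K.deg := mdeg_add I K
  have hne : ∀ T : MultiIndex n, (T.fact : ℂ) ≠ 0 := fun T => by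
    exact_mod_cast (mfact_pos T).ne'
  have h1' : ((I + K : MultiIndex n).binom I : ℂ) * I.fact * K.fact =
      ((I + K : MultiIndex n).fact : ℂ) := by exact_mod_cast h1
  unfold wickCoeff
  rw [h2, pow_add, div_mul_div_comm, div_mul_eq_mul_div, div_eq_div_iff (hne _)
    (mul_ne_zero (hne _) (hne _)), ← h1']
  ring

lemma iic_zero_multiIndex : (Finset.Iic (0 : MultiIndex n)) = {0} := by ext; simp

lemma binom_zero_zero : (0 : MultiIndex n).binom 0 = 1 := by simp [MultiIndex.binom]

lemma wickJet_zero_zero (α : ℂ) (M : MultiIndex n) (a b : Jet n) :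
    wickJet α M a b 0 0 = wickCoeff α M * (a M 0 * b 0 M) := by
  simp [wickJet, wickCoeff, conv, iic_zero_multiIndex, binom_zero_zero]

lemma wickJet_right_zero (α : ℂ) (M N : MultiIndex n) (a b : Jet n) :
    wickJet α N a b M 0 = wickCoeff α N *
      ∑ I ∈ Finset.Iic M, (M.binom I : ℂ) * (a (I + N) 0 * b (M - I) N) := by
  simp [wickJet, wickCoeff, conv, iic_zero_multiIndex, binom_zero_zero]

lemma wickJet_left_zero (α : ℂ) (M N : MultiIndex n) (a b : Jet n) :
    wickJet α N a b 0 M = wickCoeff α N *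
      ∑ J ∈ Finset.Iic M, (M.binom J : ℂ) * (a N J * b 0 (M - J + N)) := by
  simp [wickJet, wickCoeff, conv, iic_zero_multiIndex, binom_zero_zero]

/-- Pairs of multi-indices, grouped by their sum. -/
def sigmaIicEquiv (n : ℕ) :
    (Σ M : MultiIndex n, {I // I ∈ Finset.Iic M}) ≃ MultiIndex n × MultiIndex n where
  toFun x := (x.2, x.1 - x.2)
  invFun z := ⟨z.1 + z.2, z.1, Finset.mem_Iic.2 le_self_add⟩
  left_inv := by
    rintro ⟨M, I, hI⟩
    obtain ⟨K, rfl⟩ := exists_add_of_le (Finset.mem_Iic.1 hI)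
    have h : ∀ L, L = K → (⟨I + L, I, Finset.mem_Iic.2 le_self_add⟩ :
        Σ M : MultiIndex n, {I // I ∈ Finset.Iic M}) = ⟨I + K, I, hI⟩ := by
      rintro _ rfl
      rfl
    exact h _ (add_tsub_cancel_left I K)
  right_inv z := by simp

lemma tsum_sum_Iic {Y : MultiIndex n × MultiIndex n → ℂ} (hY : Summable Y) :
    ∑' M, ∑ I ∈ Finset.Iic M, Y (I, M - I) = ∑' z, Y z := by
  have h := (sigmaIicEquiv n).summable_iff.2 hY
  rw [← (sigmaIicEquiv n).tsum_eq Y]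
  refine Eq.trans ?_ (Summable.tsum_sigma' (fun M => (hasSum_fintype _).summable) h).symm
  refine tsum_congr fun M => ?_
  rw [tsum_fintype, Finset.univ_eq_attach, ← Finset.sum_attach]
  rfl

/-- The general term of the triple sum for the constant coefficient of a product of three jets. -/
def tripleTerm (α : ℂ) (a b c : Jet n) (I K N : MultiIndex n) : ℂ :=
  wickCoeff α I * wickCoeff α K * wickCoeff α N * (a (I + N) 0 * b K N * c 0 (I + K))

lemma exists_wickCoeff_bound (n : ℕ) (α : ℂ) : ∃ D : ℝ, 0 < D ∧ ∀ N : MultiIndex n,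
    ‖wickCoeff α N‖ * (4 ^ mdeg N * ((mfact N : ℝ) ^ (1 / 8 : ℝ)) ^ 2) ≤ D * (1 / 2) ^ mdeg N := by
  obtain ⟨D, hD, h⟩ := pow_mdeg_le_half (κ := Fin n) (2 * ‖α‖ * 4) (by positivity)
    (ε := 1 / 8) (by norm_num)
  refine ⟨D, hD, fun N => ?_⟩
  have hN0 : (0 : ℝ) < mfact N := by exact_mod_cast mfact_pos N
  have e : ‖wickCoeff α N‖ = (2 * ‖α‖) ^ mdeg N / mfact N := by
    rw [wickCoeff, norm_div, norm_pow, norm_mul, Complex.norm_natCast, Complex.norm_ofNat]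
    rfl
  have e3 : (mfact N : ℝ) ^ (1 / 8 : ℝ) * ((mfact N : ℝ) ^ (1 / 8 : ℝ)) ^ 2 =
      (mfact N : ℝ) ^ (3 / 8 : ℝ) := by
    rw [← Real.rpow_natCast _ 2, ← Real.rpow_mul hN0.le, ← Real.rpow_add hN0]
    norm_num
  calc ‖wickCoeff α N‖ * (4 ^ mdeg N * ((mfact N : ℝ) ^ (1 / 8 : ℝ)) ^ 2)
      = (2 * ‖α‖ * 4) ^ mdeg N * ((mfact N : ℝ) ^ (1 / 8 : ℝ)) ^ 2 / mfact N := by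
        rw [e, mul_pow (2 * ‖α‖) 4]; ring
    _ ≤ D * (1 / 2) ^ mdeg N * (mfact N : ℝ) ^ (1 / 8 : ℝ) *
        ((mfact N : ℝ) ^ (1 / 8 : ℝ)) ^ 2 / mfact N := by
        gcongr
        exact h N
    _ = D * (1 / 2) ^ mdeg N * ((mfact N : ℝ) ^ (3 / 8 : ℝ) / mfact N) := by rw [← e3]; ring
    _ ≤ D * (1 / 2) ^ mdeg N * 1 := by
        gcongr
        rw [div_le_one hN0]
        exact (rpow_mfact_le_exponent N (by norm_num)).trans_eq (Real.rpow_one _)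
    _ = _ := mul_one _

/-- Each of `I`, `K`, `N` occurs in exactly two of the three jets. The weights therefore separate
into one factor per index, and each is beaten by its own `wickCoeff`. -/
lemma summable_tripleTerm (α : ℂ) {a b c : Jet n} (ha : SlowGrowth a) (hb : SlowGrowth b)
    (hc : SlowGrowth c) : Summable fun z : (MultiIndex n × MultiIndex n) × MultiIndex n =>
      tripleTerm α a b c z.1.1 z.1.2 z.2 := by
  obtain ⟨D, hD, hγ⟩ := exists_wickCoeff_bound n α
  obtain ⟨A, hA⟩ := ha (1 / 8) (by norm_num)
  obtain ⟨B, hB⟩ := hb (1 / 8) (by norm_num)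
  obtain ⟨C, hC⟩ := hc (1 / 8) (by norm_num)
  have hA0 := hA.nonneg
  have hB0 := hB.nonneg
  have hC0 := hC.nonneg
  have hu := summable_half_pow_mdeg (κ := Fin n)
  have h0 : ∀ N : MultiIndex n, (0 : ℝ) ≤ (1 / 2) ^ mdeg N := fun N => by positivity
  have hs := ((hu.mul_of_nonneg hu h0 h0).mul_of_nonneg hu
    (fun z => mul_nonneg (h0 _) (h0 _)) h0).mul_left (A * B * C * D ^ 3)
  refine Summable.of_norm_bounded hs ?_
  rintro ⟨⟨I, K⟩, N⟩
  dsimp only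
  set i := (mfact I : ℝ) ^ (1 / 8 : ℝ)
  set k := (mfact K : ℝ) ^ (1 / 8 : ℝ)
  set m := (mfact N : ℝ) ^ (1 / 8 : ℝ)
  have hz : (mfact (0 : MultiIndex n) : ℝ) ^ (1 / 8 : ℝ) = 1 := by simp [mfact]
  have h1 : ‖a (I + N) 0‖ ≤ A * (2 ^ mdeg I * 2 ^ mdeg N * (i * m)) := by
    refine (hA _ _).trans ?_
    rw [hz, mul_one]
    gcongr
    exact rpow_mfact_add_le I N (by norm_num) (by norm_num)
  have h2 : ‖b K N‖ ≤ B * (2 ^ mdeg K * 2 ^ mdeg N * (k * m)) := by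
    refine (hB _ _).trans ?_
    refine mul_le_mul_of_nonneg_left ?_ hB0
    have e1 : (1 : ℝ) ≤ 2 ^ mdeg K * 2 ^ mdeg N := by
      rw [← pow_add]; exact one_le_pow₀ (by norm_num)
    nlinarith [mul_nonneg (show (0 : ℝ) ≤ k by positivity) (show (0 : ℝ) ≤ m by positivity)]
  have h3 : ‖c 0 (I + K)‖ ≤ C * (2 ^ mdeg I * 2 ^ mdeg K * (i * k)) := by
    refine (hC _ _).trans ?_
    rw [hz, one_mul]
    gcongr
    exact rpow_mfact_add_le I K (by norm_num) (by norm_num)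
  have e4 : ∀ T : MultiIndex n, (4 : ℝ) ^ mdeg T = 2 ^ mdeg T * 2 ^ mdeg T := fun T => by
    rw [← mul_pow]; norm_num
  rw [tripleTerm]
  simp only [norm_mul]
  calc ‖wickCoeff α I‖ * ‖wickCoeff α K‖ * ‖wickCoeff α N‖ *
        (‖a (I + N) 0‖ * ‖b K N‖ * ‖c 0 (I + K)‖)
      ≤ ‖wickCoeff α I‖ * ‖wickCoeff α K‖ * ‖wickCoeff α N‖ *
        ((A * (2 ^ mdeg I * 2 ^ mdeg N * (i * m))) * (B * (2 ^ mdeg K * 2 ^ mdeg N * (k * m))) *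
          (C * (2 ^ mdeg I * 2 ^ mdeg K * (i * k)))) := by gcongr
    _ = A * B * C * ((‖wickCoeff α I‖ * (4 ^ mdeg I * i ^ 2)) *
        (‖wickCoeff α K‖ * (4 ^ mdeg K * k ^ 2)) * (‖wickCoeff α N‖ * (4 ^ mdeg N * m ^ 2))) := by
        rw [e4, e4, e4]; ring
    _ ≤ A * B * C * ((D * (1 / 2) ^ mdeg I) * (D * (1 / 2) ^ mdeg K) * (D * (1 / 2) ^ mdeg N)) := by
        gcongr _ * (?_ * ?_ * ?_)
        · exact hγ I
        · exact hγ K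
        · exact hγ N
    _ = _ := by ring

/-- The outer `M` holomorphic derivatives of `a ⋆ b` split as `M = I + K`, with `I` falling on `a`
and `K` on `b`; grouping the triple sum by `I + K` recovers the nested series. -/
lemma starJet_starJet_left_zero (α : ℂ) {a b c : Jet n} (ha : SlowGrowth a) (hb : SlowGrowth b)
    (hc : SlowGrowth c) : starJet α (starJet α a b) c 0 0 =
      ∑' z : (MultiIndex n × MultiIndex n) × MultiIndex n, tripleTerm α a b c z.1.1 z.1.2 z.2 := by
  have hX := summable_tripleTerm α ha hb hc
  rw [hX.tsum_prod, ← tsum_sum_Iic hX.prod]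
  refine tsum_congr fun M => ?_
  have hf : ∀ z : MultiIndex n × MultiIndex n, Summable fun N => tripleTerm α a b c z.1 z.2 N :=
    fun z => hX.prod_factor z
  rw [wickJet_zero_zero, starJet, ← Summable.tsum_finsetSum fun I _ => hf (I, M - I), ← tsum_mul_right,
    ← tsum_mul_left]
  refine tsum_congr fun N => ?_
  rw [wickJet_right_zero, Finset.mul_sum, Finset.sum_mul, Finset.mul_sum]
  refine Finset.sum_congr rfl fun I hI => ?_
  have hIM := Finset.mem_Iic.1 hI
  rw [tripleTerm, ← wickCoeff_mul_binom α hIM, add_tsub_cancel_of_le hIM]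
  ring

lemma starJet_starJet_right_zero (α : ℂ) {a b c : Jet n} (ha : SlowGrowth a) (hb : SlowGrowth b)
    (hc : SlowGrowth c) : starJet α a (starJet α b c) 0 0 =
      ∑' z : (MultiIndex n × MultiIndex n) × MultiIndex n, tripleTerm α a b c z.1.1 z.1.2 z.2 := by
  have hX := summable_tripleTerm α ha hb hc
  -- Here the outer antiholomorphic derivatives split between `b` and `c`, so the roles rotate: the
  -- first two entries are `N` and `I`, whose sum is the outer index, and the inner index is `K`.
  let e : (MultiIndex n × MultiIndex n) × MultiIndex n ≃
      (MultiIndex n × MultiIndex n) × MultiIndex n :=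
    ⟨fun z => ((z.1.2, z.2), z.1.1), fun z => ((z.2, z.1.1), z.1.2), fun _ => rfl, fun _ => rfl⟩
  have hX' := e.summable_iff.2 hX
  rw [← e.tsum_eq]
  refine Eq.trans ?_ (Summable.tsum_prod hX').symm
  rw [← tsum_sum_Iic hX'.prod]
  refine tsum_congr fun M => ?_
  have hf : ∀ z : MultiIndex n × MultiIndex n, Summable fun N => tripleTerm α a b c z.2 N z.1 :=
    fun z => hX'.prod_factor z
  rw [wickJet_zero_zero, starJet]
  change _ = ∑ J ∈ Finset.Iic M, ∑' N, tripleTerm α a b c (M - J) N J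
  rw [← Summable.tsum_finsetSum fun J _ => hf (J, M - J), ← tsum_mul_left, ← tsum_mul_left]
  refine tsum_congr fun N => ?_
  rw [wickJet_left_zero, Finset.mul_sum, Finset.mul_sum, Finset.mul_sum]
  refine Finset.sum_congr rfl fun J hJ => ?_
  have hJM := Finset.mem_Iic.1 hJ
  have h1 := wickCoeff_mul_binom α hJM
  rw [tripleTerm, tsub_add_cancel_of_le hJM]
  linear_combination (wickCoeff α N * a M 0 * b N J * c 0 (M - J + N)) * h1

/-- A shift of either bracketing is the sum of the same bracketings with one factor shifted.
Induction over all triples reduces to the constant coefficient, where both sides are the same triple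
sum. -/
lemma starJet_assoc (α : ℂ) {a b c : Jet n} (ha : SlowGrowth a) (hb : SlowGrowth b)
    (hc : SlowGrowth c) : starJet α (starJet α a b) c = starJet α a (starJet α b c) := by
  funext R S
  induction R using multiIndex_induction generalizing a b c with
  | h0 =>
    induction S using multiIndex_induction generalizing a b c with
    | h0 => rw [starJet_starJet_left_zero α ha hb hc, starJet_starJet_right_zero α ha hb hc]
    | hs k S ih =>
      have hab := slowGrowth_starJet α ha hb
      have hbc := slowGrowth_starJet α hb hc
      have ha' := ha.shiftR k
      have hb' := hb.shiftR k
      have hc' := hc.shiftR k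
      change shiftR k (starJet α (starJet α a b) c) 0 S = shiftR k (starJet α a (starJet α b c)) 0 S
      rw [shiftR_starJet α k hab hc, shiftR_starJet α k ha hbc, shiftR_starJet α k ha hb,
        shiftR_starJet α k hb hc, starJet_add_left α (slowGrowth_starJet α ha' hb)
        (slowGrowth_starJet α ha hb') hc, starJet_add_right α ha (slowGrowth_starJet α hb' hc)
        (slowGrowth_starJet α hb hc')]
      simp only [Pi.add_apply, ih ha' hb hc, ih ha hb' hc, ih ha hb hc', add_assoc]
  | hs k R ih =>
    have hab := slowGrowth_starJet α ha hb
    have hbc := slowGrowth_starJet α hb hc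
    have ha' := ha.shiftL k
    have hb' := hb.shiftL k
    have hc' := hc.shiftL k
    change shiftL k (starJet α (starJet α a b) c) R S = shiftL k (starJet α a (starJet α b c)) R S
    rw [shiftL_starJet α k hab hc, shiftL_starJet α k ha hbc, shiftL_starJet α k ha hb,
      shiftL_starJet α k hb hc, starJet_add_left α (slowGrowth_starJet α ha' hb)
      (slowGrowth_starJet α ha hb') hc, starJet_add_right α ha (slowGrowth_starJet α hb' hc)
      (slowGrowth_starJet α hb hc')]
    simp only [Pi.add_apply, ih ha' hb hc, ih ha hb' hc, ih ha hb hc', add_assoc]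

lemma wick_assoc {ħ : ℝ} (hħ : 0 < ħ) (p : Fin n → ℂ) (α : ℂ) (F G H : Alg ħ p) :
    wick hħ p α (wick hħ p α F G) H = wick hħ p α F (wick hħ p α G H) := by
  apply algJet_injective
  simp only [algJet_wick]
  exact starJet_assoc α (slowGrowth_algJet hħ F) (slowGrowth_algJet hħ G) (slowGrowth_algJet hħ H)

end Associativity


/-! ### The pointwise product at `α = 0`. -/

section Pointwise

variable {n : ℕ} {ħ : ℝ} (hħ : 0 < ħ) (p : Fin n → ℂ)

lemma wickTerm_zero_zero (f g : Fn n) : wickTerm 0 f g 0 = f * g := by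
  funext x
  simp [wickTerm, MultiIndex.deg, MultiIndex.fact, dzM_zero, dzbarM_zero]

lemma wickTerm_zero_of_ne (f g : Fn n) {N : MultiIndex n} (hN : N ≠ 0) : wickTerm 0 f g N = 0 := by
  have hd : N.deg ≠ 0 := fun h => hN <| funext fun k =>
    Finset.sum_eq_zero_iff.1 h k (Finset.mem_univ k)
  funext x
  simp [wickTerm, zero_pow hd]

/-- At `α = 0` only the term `N = 0` survives, and it is `f * g`; the Hausdorff property makes the
sum unique. -/
lemma isPointwiseProduct_wick_zero : IsPointwiseProduct ħ p (wick hħ p 0) := by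
  intro f g
  obtain ⟨hmem, -, hsum⟩ := isWickProduct_wick hħ p 0 f g
  have h0 : (f : Fn n) * (g : Fn n) ∈ tildeA ħ p := wickTerm_zero_zero (f : Fn n) g ▸ hmem 0
  refine ⟨h0, ?_⟩
  have := t1Space_alg (p := p) hħ
  have := IsTopologicalAddGroup.regularSpace (Alg ħ p)
  have hs : HasSum (fun N => cls ħ p ⟨wickTerm 0 (f : Fn n) (g : Fn n) N, hmem N⟩)
      (cls ħ p ⟨wickTerm 0 (f : Fn n) (g : Fn n) 0, hmem 0⟩) := by
    refine hasSum_single 0 fun N hN => ?_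
    have : (⟨wickTerm 0 (f : Fn n) (g : Fn n) N, hmem N⟩ : tildeA ħ p) = 0 :=
      Subtype.ext (wickTerm_zero_of_ne _ _ hN)
    rw [this, map_zero]
  rw [hsum.unique hs]
  congr 2
  exact wickTerm_zero_zero _ _

end Pointwise

/-! ### Complex conjugation as an involution. -/

section Conjugation

variable {n : ℕ} {ħ : ℝ} (hħ : 0 < ħ) (p : Fin n → ℂ)

/-- The jet of the complex conjugate of a function. -/
def conjJet (a : Jet n) : Jet n := fun R S => star (a S R)

lemma jet_star {f : Fn n} (hf : ContDiff ℝ ∞ f) : jet p (star f) = conjJet (jet p f) := by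
  funext R S
  simp only [jet, conjJet, wirt_star R S hf, Pi.star_apply]

lemma JetBound.conjJet {δ A : ℝ} {a : Jet n} (ha : JetBound δ A a) : JetBound δ A (conjJet a) :=
  fun R S => by
    rw [WickStar.conjJet, norm_star, mul_comm ((mfact R : ℝ) ^ δ)]
    exact ha S R

lemma SlowGrowth.conjJet {a : Jet n} (ha : SlowGrowth a) : SlowGrowth (conjJet a) := fun δ hδ =>
  (ha δ hδ).imp fun _ h => h.conjJet

lemma conjJet_add (a b : Jet n) : conjJet (a + b) = conjJet a + conjJet b := by
  funext R S
  simp [conjJet]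

lemma conjJet_smul (c : ℂ) (a : Jet n) : conjJet (c • a) = star c • conjJet a := by
  funext R S
  simp [conjJet]

/-- The complex conjugation on `A_{p,ħ}`. -/
def algConj : Alg ħ p →ₗ⋆[ℂ] Alg ħ p :=
  have key : ∀ F : Alg ħ p, algJet ħ p (ofJet ħ p (conjJet (algJet ħ p F))) =
      conjJet (algJet ħ p F) := fun F => algJet_ofJet hħ (slowGrowth_algJet hħ F).conjJet
  { toFun := fun F => ofJet ħ p (conjJet (algJet ħ p F))
    map_add' := fun F G => algJet_injective <| by
      rw [key (F + G), map_add, map_add, key, key, conjJet_add]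
    map_smul' := fun c F => algJet_injective <| by
      rw [key (c • F), map_smul, map_smul, key, conjJet_smul]
      rfl }

lemma algJet_algConj (F : Alg ħ p) : algJet ħ p (algConj hħ p F) = conjJet (algJet ħ p F) :=
  algJet_ofJet hħ (slowGrowth_algJet hħ F).conjJet

lemma isConjugation_algConj : IsConjugation ħ p (algConj hħ p) := by
  intro f
  have hf := (mem_tildeA_iff hħ).1 f.2
  have hj := jet_star p hf.1
  refine ⟨(mem_tildeA_iff hħ).2 ⟨smooth_star hf.1, hj ▸ hf.2.conjJet⟩, algJet_injective ?_⟩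
  rw [algJet_algConj, algJet_cls, algJet_cls]
  exact hj.symm

lemma continuous_algConj : Continuous (algConj hħ p) := by
  rw [continuous_iff_continuousAt]
  intro F₀
  refine tendsto_of_jetBound hħ fun δ hδ ε hε => ?_
  obtain ⟨r, hr, h⟩ := exists_continuous_seminorm hħ p hδ
  have hc : Filter.Tendsto (fun F => r (F - F₀)) (𝓝 F₀) (𝓝 0) := by
    have hc : Continuous fun F => r (F - F₀) := hr.comp (continuous_id.sub continuous_const)
    simpa using hc.tendsto F₀
  filter_upwards [hc.eventually (gt_mem_nhds hε)] with F hF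
  rw [← map_sub, algJet_algConj]
  exact ((h _).mono le_rfl hF.le).conjJet

lemma algConj_algConj (F : Alg ħ p) : algConj hħ p (algConj hħ p F) = F := by
  apply algJet_injective
  rw [algJet_algConj, algJet_algConj]
  funext R S
  simp [conjJet]

lemma star_wickTerm (α : ℂ) {f g : Fn n} (hf : ContDiff ℝ ∞ f) (hg : ContDiff ℝ ∞ g)
    (N : MultiIndex n) : star (wickTerm α f g N) = wickTerm (star α) (star g) (star f) N := by
  funext x
  simp only [Pi.star_apply, wickTerm, dzM_star N hg, dzbarM_star N hf]
  simp [mul_comm]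

/-- Conjugation exchanges holomorphic and antiholomorphic derivatives, so each term becomes the
corresponding term with the factors swapped and `α` conjugated. -/
lemma algConj_wick (α : ℂ) (F G : Alg ħ p) : algConj hħ p (wick hħ p α F G) =
    wick hħ p (star α) (algConj hħ p G) (algConj hħ p F) := by
  obtain ⟨f, rfl⟩ := cls_surjective ħ p F
  obtain ⟨g, rfl⟩ := cls_surjective ħ p G
  apply algJet_injective
  rw [algJet_algConj, algJet_wick, algJet_wick, algJet_algConj, algJet_algConj, algJet_cls,
    algJet_cls, ← jet_star p f.2.1, ← jet_star p g.2.1]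
  funext R S
  simp only [conjJet, starJet]
  rw [tsum_star]
  refine tsum_congr fun N => ?_
  have h1 := jet_wickTerm p α f.2.1 g.2.1 N
  rw [← h1.2, ← (jet_wickTerm p (star α) (smooth_star g.2.1) (smooth_star f.2.1) N).2,
    ← star_wickTerm α f.2.1 g.2.1, jet_star p h1.1, conjJet]

end Conjugation

/-! ### Entire dependence on the deformation parameter. -/

section Holomorphy

variable {n : ℕ} {ħ : ℝ} (hħ : 0 < ħ) (p : Fin n → ℂ)

lemma nat_mul_pow_pred_le (x : ℝ) (hx : 0 ≤ x) (d : ℕ) : d * x ^ (d - 1) ≤ (2 + x) ^ d := by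
  induction d with
  | zero => simp
  | succ d ih =>
    have h1 : x ^ d ≤ (2 + x) ^ d := pow_le_pow_left₀ hx (by linarith) _
    have h2 : x * (d * x ^ (d - 1)) = d * x ^ d := by
      cases d with
      | zero => simp
      | succ d => simp only [Nat.add_sub_cancel]; ring
    have h3 := mul_le_mul_of_nonneg_left ih hx
    rw [h2] at h3
    have h4 : (0 : ℝ) ≤ (2 + x) ^ d := by positivity
    rw [Nat.add_sub_cancel, pow_succ (2 + x)]
    push_cast
    nlinarith

/-- The loss is only exponential in `d`, so the star series at parameter `2 + ‖α‖` dominates the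
remainder. For `d = 0` the truncated exponent is harmless, as it is multiplied by `d`. -/
lemma norm_pow_taylor_le (α h : ℂ) (hh : ‖h‖ ≤ 1) (d : ℕ) :
    ‖(α + h) ^ d - α ^ d - h * (d * α ^ (d - 1))‖ ≤ ‖h‖ ^ 2 * (2 + ‖α‖) ^ d := by
  induction d with
  | zero => simp
  | succ d ih =>
    have e : (α + h) ^ (d + 1) - α ^ (d + 1) - h * ((d + 1 : ℕ) * α ^ (d + 1 - 1)) =
        (α + h) * ((α + h) ^ d - α ^ d - h * (d * α ^ (d - 1))) +
          h ^ 2 * (d * α ^ (d - 1)) := by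
      cases d with
      | zero => simp
      | succ d =>
        simp only [Nat.add_sub_cancel]
        push_cast
        ring
    have h1 : ‖(d : ℂ) * α ^ (d - 1)‖ ≤ (2 + ‖α‖) ^ d := by
      rw [norm_mul, norm_pow, Complex.norm_natCast]
      exact nat_mul_pow_pred_le _ (norm_nonneg α) d
    have h2 : ‖α + h‖ ≤ ‖α‖ + 1 := (norm_add_le _ _).trans (by linarith)
    rw [e]
    refine (norm_add_le _ _).trans ?_
    rw [norm_mul, norm_mul (h ^ 2), norm_pow]
    calc ‖α + h‖ * ‖(α + h) ^ d - α ^ d - h * (d * α ^ (d - 1))‖ +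
          ‖h‖ ^ 2 * ‖(d : ℂ) * α ^ (d - 1)‖
        ≤ (‖α‖ + 1) * (‖h‖ ^ 2 * (2 + ‖α‖) ^ d) + ‖h‖ ^ 2 * (2 + ‖α‖) ^ d := by gcongr
      _ = _ := by ring

lemma wickJet_eq_pow_smul (α : ℂ) (N : MultiIndex n) (a b : Jet n) :
    wickJet α N a b = α ^ mdeg N • wickJet 1 N a b := by
  simp only [wickJet, smul_smul]
  congr 1
  change (2 * α) ^ mdeg N / _ = α ^ mdeg N * ((2 * 1) ^ mdeg N / _)
  rw [mul_pow]
  ring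

open scoped Pointwise in
/-- A map with a quadratic remainder in all continuous seminorms is differentiable. -/
lemma differentiableAt_of_quadratic {φ : ℂ → Alg ħ p} {D : Alg ħ p} {α : ℂ}
    (hφ : ∀ q : Seminorm ℂ (Alg ħ p), Continuous q → ∃ C : ℝ, 0 ≤ C ∧ ∀ x, ‖x - α‖ ≤ 1 →
      q (φ x - φ α - (x - α) • D) ≤ C * ‖x - α‖ ^ 2) : DifferentiableAt ℂ φ α := by
  have hw := alg_withSeminorms ħ p
  have := hw.continuousSMul
  refine ⟨ContinuousLinearMap.toSpanSingleton ℂ D, .of_isLittleOTVS ⟨fun U hU => ?_⟩⟩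
  obtain ⟨⟨s, r⟩, hr, hsub⟩ := hw.hasBasis_zero_ball.mem_iff.1 hU
  dsimp only at hr hsub
  obtain ⟨C, hC, h⟩ := hφ (s.sup (algFamily ħ p))
    (hw.finset_sups.continuous_seminorm s)
  refine ⟨Metric.ball 0 1, Metric.ball_mem_nhds 0 one_pos, fun ε hε => ?_⟩
  have hε0 : (0 : ℝ) < ε := by positivity
  have hlim : Filter.Tendsto (fun x : ℂ => C * ‖x - α‖ / ε) (𝓝 α) (𝓝 0) := by
    have hc : Continuous fun x : ℂ => C * ‖x - α‖ / ε := by fun_prop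
    simpa using hc.tendsto α
  filter_upwards [hlim.eventually (gt_mem_nhds hr), Metric.ball_mem_nhds α one_pos] with x h1 h2
  rw [ContinuousLinearMap.toSpanSingleton_apply]
  by_cases hx : x = α
  · subst hx
    rw [sub_self, sub_self, zero_smul, sub_self, egauge_zero_right ℂ ⟨0, mem_of_mem_nhds hU⟩]
    exact zero_le
  have hx0 : 0 < ‖x - α‖ := norm_pos_iff.2 (sub_ne_zero.2 hx)
  -- The remainder lies in `c • U` as soon as `C ‖x - α‖ / ε < r`, and then its gauge is at most
  -- `‖c‖`, that is `ε ‖x - α‖`.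
  set c : ℂ := ((ε : ℝ) : ℂ) * (x - α)
  have hcn : ‖c‖ = ε * ‖x - α‖ := by
    rw [norm_mul, Complex.norm_real, Real.norm_of_nonneg hε0.le]
  have hc0 : c ≠ 0 := norm_pos_iff.1 (by rw [hcn]; positivity)
  have hmem : φ x - φ α - (x - α) • D ∈ c • U := by
    refine ⟨c⁻¹ • (φ x - φ α - (x - α) • D), hsub ?_, smul_inv_smul₀ hc0 _⟩
    rw [Seminorm.mem_ball_zero, map_smul_eq_mul, norm_inv, hcn]
    refine lt_of_le_of_lt ?_ h1
    have := h x (by simpa [dist_eq_norm] using (Metric.mem_ball.1 h2).le)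
    rw [inv_mul_le_iff₀ (by positivity)]
    refine this.trans_eq ?_
    field_simp
  calc egauge ℂ U (φ x - φ α - (x - α) • D) ≤ ‖c‖ₑ := egauge_le_of_mem_smul hmem
    _ = ε * ‖x - α‖ₑ := by
        rw [enorm_mul]
        congr 1
        rw [← ofReal_norm, Complex.norm_real, Real.norm_of_nonneg hε0.le,
          ENNReal.ofReal_coe_nnreal]
    _ ≤ _ := by
        gcongr
        exact le_egauge_ball_one ℂ (x - α)

/-- The product is a power series in `α` with the terms at `α = 1` as coefficients. Its termwise
derivative `d` and the quadratic remainder are both dominated by the star series at a larger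
parameter. -/
lemma differentiable_wick (F G : Alg ħ p) : Differentiable ℂ fun α => wick hħ p α F G := by
  intro α
  have ha := slowGrowth_algJet hħ F
  have hb := slowGrowth_algJet hħ G
  set a := algJet ħ p F
  set b := algJet ħ p G
  -- The comparison parameter: `(2 + ‖α‖)^|N|` bounds the derivative and the remainder of `α^|N|`.
  set β : ℂ := ((2 + ‖α‖ : ℝ) : ℂ) with hβ
  have hβn : ‖β‖ = 2 + ‖α‖ := by rw [hβ, Complex.norm_real, Real.norm_of_nonneg (by positivity)]
  have hu := summable_half_pow_mdeg (κ := Fin n)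
  have hT : ∀ {η C : ℝ}, (∀ N, JetBound η (C * (1 / 2) ^ mdeg N) (wickJet β N a b)) →
      ∀ (c : ℂ) (t : ℝ) (N : MultiIndex n), 0 ≤ t → ‖c‖ ≤ t * (2 + ‖α‖) ^ mdeg N →
        JetBound η (t * C * (1 / 2) ^ mdeg N) (c • wickJet 1 N a b) := by
    intro η C hC c t N ht hc R S
    have h1 := hC N R S
    rw [wickJet_eq_pow_smul, Pi.smul_apply, Pi.smul_apply, norm_smul, norm_pow, hβn] at h1
    rw [Pi.smul_apply, Pi.smul_apply, norm_smul]
    calc ‖c‖ * ‖wickJet 1 N a b R S‖ ≤ t * (2 + ‖α‖) ^ mdeg N * ‖wickJet 1 N a b R S‖ := by gcongr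
      _ = t * ((2 + ‖α‖) ^ mdeg N * ‖wickJet 1 N a b R S‖) := by ring
      _ ≤ t * (C * (1 / 2) ^ mdeg N * ((mfact R : ℝ) ^ η * (mfact S : ℝ) ^ η)) := by gcongr
      _ = _ := by ring
  have hderiv : ∀ N : MultiIndex n, ‖(mdeg N : ℂ) * α ^ (mdeg N - 1)‖ ≤ 1 * (2 + ‖α‖) ^ mdeg N :=
    fun N => by
      rw [norm_mul, norm_pow, Complex.norm_natCast, one_mul]
      exact nat_mul_pow_pred_le _ (norm_nonneg α) _
  set d : Jet n := fun R S =>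
    ∑' N : MultiIndex n, (((mdeg N : ℂ) * α ^ (mdeg N - 1)) • wickJet 1 N a b) R S with hd
  have hdg : SlowGrowth d := fun η hη => by
    obtain ⟨C, hC⟩ := wickJet_bound β ha hb hη
    exact ⟨_, JetBound.tsum (hu.mul_left (1 * C)) fun N => hT hC _ 1 N zero_le_one (hderiv N)⟩
  refine differentiableAt_of_quadratic p (D := ofJet ħ p d) fun q hq => ?_
  obtain ⟨η, hη, E, hE, hqE⟩ := seminorm_le_of_continuous hħ q hq
  obtain ⟨C, hC⟩ := wickJet_bound β ha hb hη
  have hC0 : 0 ≤ C := by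
    have := (hC 0).nonneg
    simpa [mdeg] using this
  refine ⟨E * (C * geomConst n), mul_nonneg hE (mul_nonneg hC0 (geomConst_nonneg n)),
    fun x hx => ?_⟩
  have hjet : algJet ħ p (wick hħ p x F G - wick hħ p α F G - (x - α) • ofJet ħ p d) =
      fun R S => ∑' N : MultiIndex n, ((x ^ mdeg N - α ^ mdeg N -
        (x - α) * (mdeg N * α ^ (mdeg N - 1))) • wickJet 1 N a b) R S := by
    funext R S
    rw [map_sub, map_sub, map_smul, algJet_wick, algJet_wick, algJet_ofJet hħ hdg]
    have s1 := summable_wickJet x ha hb R S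
    have s2 := summable_wickJet α ha hb R S
    have s3 : Summable fun N : MultiIndex n =>
        (((mdeg N : ℂ) * α ^ (mdeg N - 1)) • wickJet 1 N a b) R S := by
      obtain ⟨C, hC⟩ := wickJet_bound β ha hb one_pos
      exact JetBound.summable (hu.mul_left (1 * C))
        (fun N => hT hC _ 1 N zero_le_one (hderiv N)) R S
    change starJet x a b R S - starJet α a b R S - (x - α) * d R S = _
    rw [starJet, starJet, hd, ← tsum_mul_left, ← s1.tsum_sub s2,
      ← (s1.sub s2).tsum_sub (s3.mul_left _)]
    refine tsum_congr fun N => ?_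
    rw [wickJet_eq_pow_smul x, wickJet_eq_pow_smul α]
    simp only [Pi.smul_apply, smul_eq_mul]
    ring
  have hbd : JetBound η (∑' N : MultiIndex n, ‖x - α‖ ^ 2 * C * (1 / 2) ^ mdeg N)
      (algJet ħ p (wick hħ p x F G - wick hħ p α F G - (x - α) • ofJet ħ p d)) := by
    rw [hjet]
    refine JetBound.tsum (hu.mul_left _) fun N => hT hC _ _ N (by positivity) ?_
    have := norm_pow_taylor_le α (x - α) hx (mdeg N)
    rwa [add_sub_cancel] at this
  refine (hqE _ _ hbd).trans_eq ?_
  rw [tsum_mul_left, geomConst]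
  ring

end Holomorphy

/-! ### Assembly. -/

section Main

variable {n : ℕ} {ħ : ℝ} (hħ : 0 < ħ) (p : Fin n → ℂ)

lemma isFrechetStarAlgebra_wick : IsFrechetStarAlgebra (wick hħ p (ħ : ℂ)) (algConj hħ p) where
  frechet := isFrechetSpace_alg hħ p
  assoc := wick_assoc hħ p _
  continuous_mul := continuous_wick hħ p _
  continuous_inv := continuous_algConj hħ p
  inv_inv := algConj_algConj hħ p
  inv_mul F G := by
    rw [algConj_wick, show star (ħ : ℂ) = ħ from Complex.conj_ofReal ħ]

lemma isHolomorphicDeformation_wick : IsHolomorphicDeformation (wick hħ p 0) (wick hħ p) where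
  at_zero := rfl
  assoc := wick_assoc hħ p
  entire := differentiable_wick hħ p
  bound K hK q hq := by
    obtain ⟨ρ, hρ⟩ := hK.isBounded.exists_norm_le
    -- The bound `ρ` may be negative when `K` is empty, hence the maximum with `0`.
    obtain ⟨r, hr, h⟩ := wick_bound hħ p (le_max_right ρ 0) q hq
    exact ⟨r, hr, fun α hα F G => h α ((hρ α hα).trans (le_max_left _ _)) F G⟩

end Main

end WickStar

end

theorem mainTheorem1 (n : ℕ) (ħ : ℝ) (hħ : 0 < ħ) (p : Fin n → ℂ) :
    WickStar.IsFrechetSpace (WickStar.Alg ħ p) ∧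
    ∃ (wick : ℂ → WickStar.Alg ħ p →ₗ[ℂ] WickStar.Alg ħ p →ₗ[ℂ] WickStar.Alg ħ p)
      (pw : WickStar.Alg ħ p →ₗ[ℂ] WickStar.Alg ħ p →ₗ[ℂ] WickStar.Alg ħ p)
      (conj : WickStar.Alg ħ p →ₗ⋆[ℂ] WickStar.Alg ħ p),
      WickStar.IsPointwiseProduct ħ p pw ∧
      WickStar.IsConjugation ħ p conj ∧
      (∀ α : ℂ, WickStar.IsWickProduct ħ p α (wick α) ∧
        (Continuous fun x : WickStar.Alg ħ p × WickStar.Alg ħ p => wick α x.1 x.2) ∧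
        ∀ F G H : WickStar.Alg ħ p, wick α (wick α F G) H = wick α F (wick α G H)) ∧
      WickStar.IsFrechetStarAlgebra (wick (ħ : ℂ)) conj ∧
      WickStar.IsHolomorphicDeformation pw wick := by
  exact ⟨WickStar.isFrechetSpace_alg hħ p, WickStar.wick hħ p, WickStar.wick hħ p 0,
    WickStar.algConj hħ p, WickStar.isPointwiseProduct_wick_zero hħ p,
    WickStar.isConjugation_algConj hħ p,
    fun α => ⟨WickStar.isWickProduct_wick hħ p α, WickStar.continuous_wick hħ p α,
      WickStar.wick_assoc hħ p α⟩,
    WickStar.isFrechetStarAlgebra_wick hħ p, WickStar.isHolomorphicDeformation_wick hħ p⟩
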